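/- Let $H$ be a Hopf algebra (of arbitrary dimension) over a field $\mathbb K$ whose antipode $S$ is involutive, $S^2=\mathrm{id}$. For $p,q\ge 0$ put $C^{p,q}=\operatorname{Hom}_{\mathbb K}(H^{\otimes p},H^{\otimes q})$. Write $h\triangleright(x^1\otimes\cdots\otimes x^q)=h_{(1)}x^1\otimes\cdots\otimes h_{(q)}x^q$ and $(x^1\otimes\cdots\otimes x^q)\triangleleft h=x^1h_{(1)}\otimes\cdots\otimes x^qh_{(q)}$ for the diagonal actions (through the counit $\varepsilon$ if $q=0$), and $f=f^{(1)}\otimes\cdots\otimes f^{(q)}$ for the components of the values of $f\in C^{p,q}$. For $f\in C^{p,q}$ define vertical maps $$(\delta^v_if)(u^0,\dots,u^p)=\begin{cases}u^0\triangleright f(u^1,\dots,u^p)& i=0\\ f(u^0,\dots,u^{i-1}u^i,\dots,u^p)&1\le i\le p\\ f(u^0,\dots,u^{p-1})\triangleleft u^p& i=p+1,\end{cases}$$ $$(\sigma^v_jf)(u^1,\dots,u^{p-1})=f(u^1,\dots,u^j,1,u^{j+1},\dots,u^{p-1})\quad(0\le j\le p-1),$$ $$(\tau_{\mathrm{alg}}f)(u^1,\dots,u^p)=(u^1_{(3)}\cdots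 u^p_{(3)})\triangleright f\big(S^{-1}(u^1_{(2)}\cdots u^p_{(2)}),u^1_{(1)},\dots,u^{p-1}_{(1)}\big)\triangleleft u^p_{(1)}$$ ($\tau_{\mathrm{alg}}=\mathrm{id}$ if $p=0$), and horizontal maps, with $u=(u^1,\dots,u^p)$ and $u_{(r)}=(u^1_{(r)},\dots,u^p_{(r)})$, $$(\delta^h_if)(u)=\begin{cases}u^1_{(1)}\cdots u^p_{(1)}\otimes f(u_{(2)})& i=0\\ (\mathrm{id}^{i-1}\otimes\Delta\otimes\mathrm{id}^{q-i})f(u)&1\le i\le q\\ f(u_{(1)})\otimes u^1_{(2)}\cdots u^p_{(2)}& i=q+1,\end{cases}$$ $$(\sigma^h_jf)(u)=(\mathrm{id}^j\otimes\varepsilon\otimes\mathrm{id}^{q-j-1})f(u)\quad(0\le j\le q-1),$$ $$(\tau_{\mathrm{coalg}}f)(u)=\big(u^1_{(1)}\cdots u^p_{(1)}S(f^{(1)}(u_{(2)}))\big)\triangleright\big(f^{(2)}(u_{(2)})\otimes\cdots\otimes f^{(q)}(u_{(2)})\otimes u^1_{(3)}\cdots u^p_{(3)}\big)$$ ($\tau_{\mathrm{coalg}}=\mathrm{id}$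 if $q=0$). A para-cocyclic module is a cosimplicial $\mathbb K$-module $(C^\bullet,\delta_\bullet,\sigma_\bullet)$ with linear maps $\tau_n:C^n\to C^n$ such that $\tau_n\delta_0=\delta_n$, $\tau_n\delta_i=\delta_{i-1}\tau_{n-1}$ for $1\le i\le n$, $\tau_n\sigma_0=\sigma_n\tau_{n+1}^2$, and $\tau_n\sigma_i=\sigma_{i-1}\tau_{n+1}$ for $1\le i\le n$; it is cocyclic if also $\tau_n^{n+1}=\mathrm{id}$. Then: 1. $(C^{\bullet\bullet},\delta^v,\sigma^v,\tau_{\mathrm{alg}},\delta^h,\sigma^h,\tau_{\mathrm{coalg}})$ is a cylindrical $\mathbb K$-module: each column $C^{\bullet,q}$ is para-cocyclic under the vertical maps, each row $C^{p,\bullet}$ is para-cocyclic under the horizontal maps, all vertical maps commute with all horizontal maps, and $\tau_{\mathrm{alg}}^{\,p+1}\circ\tau_{\mathrm{coalg}}^{\,q+1}=\mathrm{id}$ on $C^{p,q}$ for all $p,q\ge0$. 2. On $C^n_{\mathrm{diag}}=C^{n,n}$ one has $\tau_{\mathrm{diag}}:=\tau_{\mathrm{alg}}\circ\tau_{\mathrm{coalg}}=\tau_{\mathrm{coalg}}\circ\tau_{\mathrm{alg}}$,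 and $C^\bullet_{\mathrm{diag}}$ with cofaces $\delta^v_i\circ\delta^h_i$, codegeneracies $\sigma^v_j\circ\sigma^h_j$ and operators $\tau_{\mathrm{diag}}$ is a cocyclic $\mathbb K$-module. 3. Let $\delta=\sum_{i=0}^{n+1}(-1)^i\delta_i^v\delta_i^h:C^n_{\mathrm{diag}}\to C^{n+1}_{\mathrm{diag}}$, and with $\tau=\tau_{\mathrm{diag}}$ and $\sigma_n=\sigma^v_n\sigma^h_n$ let $$B=\Big(\sum_{i=0}^n(-1)^{ni}\tau_n^i\Big)\,\sigma_n\tau_{n+1}\,\big(1-(-1)^{n+1}\tau_{n+1}\big):C^{n+1}_{\mathrm{diag}}\to C^n_{\mathrm{diag}}$$ ($B=0$ on $C^0_{\mathrm{diag}}$). Then $\delta^2=0$, $B^2=0$ and $\delta B+B\delta=0$, that is, $(C^\bullet_{\mathrm{diag}},\delta,B)$ is a mixed complex. Hence $(C^\bullet_{\mathrm{diag}}[[u]],\delta+uB)$, with $u$ of degree $+2$, is a cochain complex: $(\delta+uB)^2=0$, and in every degree the coboundaries are cocycles. Its cohomology is called the cyclic Gerstenhaber–Schack cohomology of $H$. 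-/

import Mathlib

open scoped TensorProduct

/-! ### Cosimplicial, para-cocyclic, cocyclic, cylindrical modules and mixed complexes

A graded module is a family `C : ℕ → Type*`. Cofaces `δ n i : C n → C (n + 1)` are meaningful for
`i ≤ n + 1`, codegeneracies `σ n j : C (n + 1) → C n` for `j ≤ n`; every axiom is restricted to
these ranges. -/

namespace Cocyclic

section Single

universe u v

variable {k : Type u} [CommRing k]

/-- The cosimplicial identities. -/
structure IsCosimplicial (C : ℕ → Type v) [∀ n, AddCommGroup (C n)] [∀ n, Module k (C n)]
    (δ : ∀ n, ℕ → (C n →ₗ[k] C (n + 1))) (σ : ∀ n, ℕ → (C (n + 1) →ₗ[k] C n)) : Prop where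
  coface_coface : ∀ n i j, i ≤ j → j ≤ n + 1 →
    δ (n + 1) (j + 1) ∘ₗ δ n i = δ (n + 1) i ∘ₗ δ n j
  codeg_codeg : ∀ n i j, i ≤ j → j ≤ n →
    σ n j ∘ₗ σ (n + 1) i = σ n i ∘ₗ σ (n + 1) (j + 1)
  codeg_coface_lt : ∀ n i j, i ≤ j → j ≤ n →
    σ (n + 1) (j + 1) ∘ₗ δ (n + 1) i = δ n i ∘ₗ σ n j
  codeg_coface_self : ∀ n j, j ≤ n → σ n j ∘ₗ δ n j = LinearMap.id
  codeg_coface_succ : ∀ n j, j ≤ n → σ n j ∘ₗ δ n (j + 1) = LinearMap.id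
  codeg_coface_gt : ∀ n i j, j < i → i ≤ n + 1 →
    σ (n + 1) j ∘ₗ δ (n + 1) (i + 1) = δ n i ∘ₗ σ n j

/-- A para-cocyclic module: a cosimplicial module with operators `τ n` compatible with cofaces
and codegeneracies. -/
structure IsParaCocyclic (C : ℕ → Type v) [∀ n, AddCommGroup (C n)] [∀ n, Module k (C n)]
    (δ : ∀ n, ℕ → (C n →ₗ[k] C (n + 1))) (σ : ∀ n, ℕ → (C (n + 1) →ₗ[k] C n))
    (τ : ∀ n, C n →ₗ[k] C n) : Prop extends IsCosimplicial C δ σ where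
  cyc_coface_zero : ∀ n, τ (n + 1) ∘ₗ δ n 0 = δ n (n + 1)
  cyc_coface_succ : ∀ n i, i ≤ n → τ (n + 1) ∘ₗ δ n (i + 1) = δ n i ∘ₗ τ n
  cyc_codeg_zero : ∀ n, τ n ∘ₗ σ n 0 = σ n n ∘ₗ τ (n + 1) ∘ₗ τ (n + 1)
  cyc_codeg_succ : ∀ n i, i + 1 ≤ n → τ n ∘ₗ σ n (i + 1) = σ n i ∘ₗ τ (n + 1)

/-- A cocyclic module: a para-cocyclic module with `τ ^ (n + 1) = id` in degree `n`. -/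
structure IsCocyclic (C : ℕ → Type v) [∀ n, AddCommGroup (C n)] [∀ n, Module k (C n)]
    (δ : ∀ n, ℕ → (C n →ₗ[k] C (n + 1))) (σ : ∀ n, ℕ → (C (n + 1) →ₗ[k] C n))
    (τ : ∀ n, C n →ₗ[k] C n) : Prop extends IsParaCocyclic C δ σ τ where
  cyc_pow : ∀ n, τ n ^ (n + 1) = LinearMap.id

variable {C : ℕ → Type v} [∀ n, AddCommGroup (C n)] [∀ n, Module k (C n)]

/-- The coboundary `∑ i, (-1) ^ i δ i`. -/
def coboundary (δ : ∀ n, ℕ → (C n →ₗ[k] C (n + 1))) (n : ℕ) : C n →ₗ[k] C (n + 1) :=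
  ∑ i ∈ Finset.range (n + 2), (-1 : k) ^ i • δ n i

/-- The norm operator `N = ∑ i, λ ^ i`, where `λ = (-1) ^ n τ` in degree `n`. -/
def norm (τ : ∀ n, C n →ₗ[k] C n) (n : ℕ) : C n →ₗ[k] C n :=
  ∑ i ∈ Finset.range (n + 1), (-1 : k) ^ (n * i) • τ n ^ i

/-- The extra degeneracy `σ₋₁ = σ n ∘ τ`. -/
def extraDegeneracy (σ : ∀ n, ℕ → (C (n + 1) →ₗ[k] C n)) (τ : ∀ n, C n →ₗ[k] C n) (n : ℕ) :
    C (n + 1) →ₗ[k] C n :=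
  σ n n ∘ₗ τ (n + 1)

/-- Connes' coboundary `B = N σ₋₁ (1 - λ)` from degree `n + 1` to degree `n`. -/
def connesB (σ : ∀ n, ℕ → (C (n + 1) →ₗ[k] C n)) (τ : ∀ n, C n →ₗ[k] C n) (n : ℕ) :
    C (n + 1) →ₗ[k] C n :=
  norm τ n ∘ₗ extraDegeneracy σ τ n ∘ₗ (LinearMap.id - (-1 : k) ^ (n + 1) • τ (n + 1))

/-- A mixed (cochain) complex in degrees `≥ 0`: `d` of degree `+1`, `B` of degree `-1`
(with `B = 0` on degree `0`), `d d = 0`, `B B = 0`, `d B + B d = 0`. -/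
structure IsMixedComplex (d : ∀ n, C n →ₗ[k] C (n + 1)) (B : ∀ n, C (n + 1) →ₗ[k] C n) :
    Prop where
  d_d : ∀ n, d (n + 1) ∘ₗ d n = 0
  B_B : ∀ n, B n ∘ₗ B (n + 1) = 0
  B_d_zero : B 0 ∘ₗ d 0 = 0
  anticomm : ∀ n, d n ∘ₗ B n + B (n + 1) ∘ₗ d (n + 1) = 0

/-! ### The complex `(C[[u]], d + u B)` with `u` of degree `2`

A power series is `x : ℕ → ∀ m, C m`, where `x l m` is the component in `C m` of the coefficient
of `u ^ l`; that component has degree `m + 2 * l`. -/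

/-- `d` as an operator on the graded module. -/
def gradedD (d : ∀ n, C n →ₗ[k] C (n + 1)) : (∀ m, C m) →ₗ[k] (∀ m, C m) :=
  LinearMap.pi fun m => match m with
    | 0 => 0
    | m + 1 => d m ∘ₗ LinearMap.proj m

/-- `B` as an operator on the graded module. -/
def gradedB (B : ∀ n, C (n + 1) →ₗ[k] C n) : (∀ m, C m) →ₗ[k] (∀ m, C m) :=
  LinearMap.pi fun m => B m ∘ₗ LinearMap.proj (m + 1)

/-- The differential `d + u B` on `C[[u]]`. -/
def cyclicD (d : ∀ n, C n →ₗ[k] C (n + 1)) (B : ∀ n, C (n + 1) →ₗ[k] C n) :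
    (ℕ → ∀ m, C m) →ₗ[k] (ℕ → ∀ m, C m) :=
  LinearMap.pi fun l => match l with
    | 0 => gradedD d ∘ₗ LinearMap.proj 0
    | l + 1 => gradedD d ∘ₗ LinearMap.proj (l + 1) + gradedB B ∘ₗ LinearMap.proj l

variable (k C) in
/-- The elements of `C[[u]]` that are homogeneous of degree `n` (an integer). -/
def homogeneous (n : ℤ) : Submodule k (ℕ → ∀ m, C m) where
  carrier := {x | ∀ l m : ℕ, (m : ℤ) + 2 * l ≠ n → x l m = 0}
  zero_mem' := fun _ _ _ => rfl
  add_mem' := fun {x y} hx hy l m h => by simp [hx l m h, hy l m h]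
  smul_mem' := fun c x hx l m h => by simp [hx l m h]

/-- The cocycles of degree `n` of `(C[[u]], d + u B)`. -/
def cyclicCocycles (d : ∀ n, C n →ₗ[k] C (n + 1)) (B : ∀ n, C (n + 1) →ₗ[k] C n) (n : ℤ) :
    Submodule k (ℕ → ∀ m, C m) :=
  homogeneous k C n ⊓ LinearMap.ker (cyclicD d B)

/-- The coboundaries of degree `n` of `(C[[u]], d + u B)`. -/
def cyclicCoboundaries (d : ∀ n, C n →ₗ[k] C (n + 1)) (B : ∀ n, C (n + 1) →ₗ[k] C n) (n : ℤ) :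
    Submodule k (ℕ → ∀ m, C m) :=
  (homogeneous k C (n - 1)).map (cyclicD d B)

/-- The cohomology in degree `n` of `(C[[u]], d + u B)`. -/
abbrev CyclicCohomology (d : ∀ n, C n →ₗ[k] C (n + 1)) (B : ∀ n, C (n + 1) →ₗ[k] C n) (n : ℤ) :
    Type _ :=
  cyclicCocycles d B n ⧸ (cyclicCoboundaries d B n).submoduleOf (cyclicCocycles d B n)

end Single

section Double

universe u v

variable {k : Type u} [CommRing k]

/-- A bi-para-cocyclic module: for fixed second index `q` the column `C · q`, and for fixed first
index `p` the row `C p ·`, is para-cocyclic, and all vertical structure maps commute with all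
horizontal ones. -/
structure IsBiParaCocyclic (C : ℕ → ℕ → Type v) [∀ p q, AddCommGroup (C p q)]
    [∀ p q, Module k (C p q)]
    (δv : ∀ p q, ℕ → (C p q →ₗ[k] C (p + 1) q)) (σv : ∀ p q, ℕ → (C (p + 1) q →ₗ[k] C p q))
    (τv : ∀ p q, C p q →ₗ[k] C p q)
    (δh : ∀ p q, ℕ → (C p q →ₗ[k] C p (q + 1))) (σh : ∀ p q, ℕ → (C p (q + 1) →ₗ[k] C p q))
    (τh : ∀ p q, C p q →ₗ[k] C p q) : Prop where
  column : ∀ q, IsParaCocyclic (fun p => C p q) (fun p => δv p q) (fun p => σv p q)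
    (fun p => τv p q)
  row : ∀ p, IsParaCocyclic (C p) (δh p) (σh p) (τh p)
  δv_δh : ∀ p q i j, i ≤ p + 1 → j ≤ q + 1 → δv p (q + 1) i ∘ₗ δh p q j = δh (p + 1) q j ∘ₗ δv p q i
  δv_σh : ∀ p q i j, i ≤ p + 1 → j ≤ q → δv p q i ∘ₗ σh p q j = σh (p + 1) q j ∘ₗ δv p (q + 1) i
  δv_τh : ∀ p q i, i ≤ p + 1 → δv p q i ∘ₗ τh p q = τh (p + 1) q ∘ₗ δv p q i
  σv_δh : ∀ p q i j, i ≤ p → j ≤ q + 1 → σv p (q + 1) i ∘ₗ δh (p + 1) q j = δh p q j ∘ₗ σv p q i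
  σv_σh : ∀ p q i j, i ≤ p → j ≤ q → σv p q i ∘ₗ σh (p + 1) q j = σh p q j ∘ₗ σv p (q + 1) i
  σv_τh : ∀ p q i, i ≤ p → σv p q i ∘ₗ τh (p + 1) q = τh p q ∘ₗ σv p q i
  τv_δh : ∀ p q j, j ≤ q + 1 → τv p (q + 1) ∘ₗ δh p q j = δh p q j ∘ₗ τv p q
  τv_σh : ∀ p q j, j ≤ q → τv p q ∘ₗ σh p q j = σh p q j ∘ₗ τv p (q + 1)
  τv_τh : ∀ p q, τv p q ∘ₗ τh p q = τh p q ∘ₗ τv p q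

/-- A cylindrical module: a bi-para-cocyclic module with
`τv ^ (p + 1) ∘ τh ^ (q + 1) = id` in bidegree `(p, q)`. -/
structure IsCylindrical (C : ℕ → ℕ → Type v) [∀ p q, AddCommGroup (C p q)]
    [∀ p q, Module k (C p q)]
    (δv : ∀ p q, ℕ → (C p q →ₗ[k] C (p + 1) q)) (σv : ∀ p q, ℕ → (C (p + 1) q →ₗ[k] C p q))
    (τv : ∀ p q, C p q →ₗ[k] C p q)
    (δh : ∀ p q, ℕ → (C p q →ₗ[k] C p (q + 1))) (σh : ∀ p q, ℕ → (C p (q + 1) →ₗ[k] C p q))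
    (τh : ∀ p q, C p q →ₗ[k] C p q) : Prop
    extends IsBiParaCocyclic C δv σv τv δh σh τh where
  cylindrical : ∀ p q, (τv p q ^ (p + 1)) ∘ₗ (τh p q ^ (q + 1)) = LinearMap.id

end Double

end Cocyclic

/-! ### The Gerstenhaber-Schack bicomplex of a Hopf algebra -/

namespace GerstenhaberSchack

open TensorProduct

noncomputable section

universe u v

variable (k : Type u) [Field k] (H : Type v) [Ring H] [HopfAlgebra k H]

/-- The tensor power `H ^ ⊗ n` over `k`. -/
abbrev T (n : ℕ) : Type (max u v) := ⨂[k]^n H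

/-- The entry `Hom(H ^ ⊗ p, H ^ ⊗ q)` in bidegree `(p, q)`. -/
abbrev GS (p q : ℕ) : Type (max u v) := T k H p →ₗ[k] T k H q

/-- `H ⊗ H ^ ⊗ n ≃ H ^ ⊗ (n + 1)`, splitting off the first factor. -/
def cons (n : ℕ) : H ⊗[k] T k H n ≃ₗ[k] T k H (n + 1) :=
  (TensorProduct.congr (PiTensorProduct.subsingletonEquiv (R := k) (s := fun _ => H) (0 : Fin 1)).symm
    (LinearEquiv.refl k (T k H n))).trans
    (TensorPower.mulEquiv.trans (TensorPower.cast k H (Nat.add_comm 1 n)))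

/-- `H ^ ⊗ n ⊗ H ≃ H ^ ⊗ (n + 1)`, splitting off the last factor. -/
def snoc (n : ℕ) : T k H n ⊗[k] H ≃ₗ[k] T k H (n + 1) :=
  (TensorProduct.congr (LinearEquiv.refl k (T k H n))
    (PiTensorProduct.subsingletonEquiv (R := k) (s := fun _ => H) (0 : Fin 1)).symm).trans
    TensorPower.mulEquiv

theorem cons_tmul_tprod (n : ℕ) (a : H) (w : Fin n → H) :
    cons k H n (a ⊗ₜ PiTensorProduct.tprod k w) =
      PiTensorProduct.tprod k (Fin.cons a w : Fin (n + 1) → H) := by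
  simp only [cons, LinearEquiv.trans_apply, TensorProduct.congr_tmul, LinearEquiv.refl_apply,
    PiTensorProduct.subsingletonEquiv_symm_apply']
  rw [← TensorPower.gMul_def, TensorPower.tprod_mul_tprod, TensorPower.cast_tprod,
    Fin.append_left_eq_cons]
  rfl

theorem snoc_tprod_tmul (n : ℕ) (w : Fin n → H) (a : H) :
    snoc k H n (PiTensorProduct.tprod k w ⊗ₜ a) =
      PiTensorProduct.tprod k (Fin.snoc w a : Fin (n + 1) → H) := by
  simp only [snoc, LinearEquiv.trans_apply, TensorProduct.congr_tmul, LinearEquiv.refl_apply,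
    PiTensorProduct.subsingletonEquiv_symm_apply']
  rw [← TensorPower.gMul_def, TensorPower.tprod_mul_tprod, Fin.append_right_eq_snoc]

variable {k H} in
/-- `id ⊗ g` for `g : H ^ ⊗ a → H ^ ⊗ b`. -/
def shift {a b : ℕ} (g : T k H a →ₗ[k] T k H b) : T k H (a + 1) →ₗ[k] T k H (b + 1) :=
  (cons k H b).toLinearMap ∘ₗ g.lTensor H ∘ₗ (cons k H a).symm.toLinearMap

/-- `u⁰ ⊗ ⋯ ⊗ uⁿ ↦ u⁰ ⊗ ⋯ ⊗ uⁱ uⁱ⁺¹ ⊗ ⋯ ⊗ uⁿ`, for `i < n`. -/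
def mulAt : ∀ n : ℕ, ℕ → (T k H (n + 1) →ₗ[k] T k H n)
  | 0, _ => 0
  | n + 1, 0 => (cons k H n).toLinearMap ∘ₗ (LinearMap.mul' k H).rTensor (T k H n) ∘ₗ
      (TensorProduct.assoc k H H (T k H n)).symm.toLinearMap ∘ₗ
      (cons k H n).symm.toLinearMap.lTensor H ∘ₗ (cons k H (n + 1)).symm.toLinearMap
  | n + 1, i + 1 => shift (mulAt n i)

/-- `u¹ ⊗ ⋯ ⊗ uⁿ ↦ u¹ ⊗ ⋯ ⊗ uʲ ⊗ 1 ⊗ uʲ⁺¹ ⊗ ⋯ ⊗ uⁿ`, for `j ≤ n`. -/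
def oneAt : ∀ n : ℕ, ℕ → (T k H n →ₗ[k] T k H (n + 1))
  | n, 0 => (cons k H n).toLinearMap ∘ₗ TensorProduct.mk k H (T k H n) 1
  | 0, _ + 1 => 0
  | n + 1, j + 1 => shift (oneAt n j)

/-- `id ^ ⊗ i ⊗ Δ ⊗ id ^ ⊗ (n - i - 1)`, for `i < n`. -/
def comulAt : ∀ n : ℕ, ℕ → (T k H n →ₗ[k] T k H (n + 1))
  | 0, _ => 0
  | n + 1, 0 => (cons k H (n + 1)).toLinearMap ∘ₗ (cons k H n).toLinearMap.lTensor H ∘ₗ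
      (TensorProduct.assoc k H H (T k H n)).toLinearMap ∘ₗ
      (Coalgebra.comul (R := k) (A := H)).rTensor (T k H n) ∘ₗ (cons k H n).symm.toLinearMap
  | n + 1, i + 1 => shift (comulAt n i)

/-- `id ^ ⊗ j ⊗ ε ⊗ id ^ ⊗ (n - j)`, for `j ≤ n`. -/
def counitAt : ∀ n : ℕ, ℕ → (T k H (n + 1) →ₗ[k] T k H n)
  | n, 0 => (TensorProduct.lid k (T k H n)).toLinearMap ∘ₗ
      (Coalgebra.counit (R := k) (A := H)).rTensor (T k H n) ∘ₗ (cons k H n).symm.toLinearMap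
  | 0, _ + 1 => 0
  | n + 1, j + 1 => shift (counitAt n j)

/-- The product `u¹ ⊗ ⋯ ⊗ uᵖ ↦ u¹ ⋯ uᵖ` (equal to `1` for `p = 0`). -/
def prod (p : ℕ) : T k H p →ₗ[k] H :=
  PiTensorProduct.lift (MultilinearMap.mkPiAlgebraFin k p H)

/-- The coproduct of the tensor product coalgebra `H ^ ⊗ p`,
`u¹ ⊗ ⋯ ⊗ uᵖ ↦ (u¹₍₁₎ ⊗ ⋯ ⊗ uᵖ₍₁₎) ⊗ (u¹₍₂₎ ⊗ ⋯ ⊗ uᵖ₍₂₎)`. -/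
def comulT : ∀ p : ℕ, T k H p →ₗ[k] T k H p ⊗[k] T k H p
  | 0 => (TensorProduct.mk k (T k H 0) (T k H 0)).flip 1
  | p + 1 => TensorProduct.map (cons k H p).toLinearMap (cons k H p).toLinearMap ∘ₗ
      (TensorProduct.tensorTensorTensorComm k H H (T k H p) (T k H p)).toLinearMap ∘ₗ
      TensorProduct.map (Coalgebra.comul (R := k) (A := H)) (comulT p) ∘ₗ
      (cons k H p).symm.toLinearMap

/-- The iterated coproduct `u ↦ u₍₁₎ ⊗ (u₍₂₎ ⊗ u₍₃₎)` of `H ^ ⊗ p`. -/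
def comulT₃ (p : ℕ) : T k H p →ₗ[k] T k H p ⊗[k] (T k H p ⊗[k] T k H p) :=
  (comulT k H p).lTensor (T k H p) ∘ₗ comulT k H p

/-- The iterated coproduct `H → H ^ ⊗ q`, `h ↦ h₍₁₎ ⊗ ⋯ ⊗ h₍q₎` (the counit for `q = 0`). -/
def iterComul : ∀ q : ℕ, H →ₗ[k] T k H q
  | 0 => (Coalgebra.counit (R := k) (A := H)).smulRight (1 : T k H 0)
  | q + 1 => (cons k H q).toLinearMap ∘ₗ (iterComul q).lTensor H ∘ₗ
      Coalgebra.comul (R := k) (A := H)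

/-- The left diagonal action `h ⊗ x ↦ h₍₁₎ x¹ ⊗ ⋯ ⊗ h₍q₎ xᵠ` on `H ^ ⊗ q`. -/
def leftAct (q : ℕ) : H ⊗[k] T k H q →ₗ[k] T k H q :=
  LinearMap.mul' k (T k H q) ∘ₗ (iterComul k H q).rTensor (T k H q)

/-- The right diagonal action `x ⊗ h ↦ x¹ h₍₁₎ ⊗ ⋯ ⊗ xᵠ h₍q₎` on `H ^ ⊗ q`. -/
def rightAct (q : ℕ) : T k H q ⊗[k] H →ₗ[k] T k H q :=
  LinearMap.mul' k (T k H q) ∘ₗ (iterComul k H q).lTensor (T k H q)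

/-- The inverse of the antipode, as an element of the ring of `k`-linear endomorphisms
(only used when the antipode is invertible). -/
def antipodeInv : H →ₗ[k] H :=
  Ring.inverse (HopfAlgebra.antipode k : Module.End k H)

/-! #### The columns (Hochschild direction) -/

/-- `(δᵛ₀ f)(u⁰, …, uᵖ) = u⁰ ▹ f(u¹, …, uᵖ)`. -/
def cofaceVFirst (p q : ℕ) : GS k H p q →ₗ[k] GS k H (p + 1) q where
  toFun f := leftAct k H q ∘ₗ f.lTensor H ∘ₗ (cons k H p).symm.toLinearMap
  map_add' f g := by simp [LinearMap.lTensor_add, LinearMap.add_comp, LinearMap.comp_add]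
  map_smul' c f := by simp [LinearMap.lTensor_smul, LinearMap.smul_comp, LinearMap.comp_smul]

/-- `(δᵛₚ₊₁ f)(u⁰, …, uᵖ) = f(u⁰, …, uᵖ⁻¹) ◃ uᵖ`. -/
def cofaceVLast (p q : ℕ) : GS k H p q →ₗ[k] GS k H (p + 1) q where
  toFun f := rightAct k H q ∘ₗ f.rTensor H ∘ₗ (snoc k H p).symm.toLinearMap
  map_add' f g := by simp [LinearMap.rTensor_add, LinearMap.add_comp, LinearMap.comp_add]
  map_smul' c f := by simp [LinearMap.rTensor_smul, LinearMap.smul_comp, LinearMap.comp_smul]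

/-- The vertical cofaces; for `1 ≤ i ≤ p` one has
`(δᵛᵢ f)(u⁰, …, uᵖ) = f(u⁰, …, uⁱ⁻¹ uⁱ, …, uᵖ)`. -/
def cofaceV (p q : ℕ) (i : ℕ) : GS k H p q →ₗ[k] GS k H (p + 1) q :=
  if i = 0 then cofaceVFirst k H p q
  else if i = p + 1 then cofaceVLast k H p q
  else LinearMap.lcomp k (T k H q) (mulAt k H p (i - 1))

/-- The vertical codegeneracies `(σᵛⱼ f)(u¹, …, uᵖ) = f(u¹, …, uʲ, 1, uʲ⁺¹, …, uᵖ)`. -/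
def codegV (p q : ℕ) (j : ℕ) : GS k H (p + 1) q →ₗ[k] GS k H p q :=
  LinearMap.lcomp k (T k H q) (oneAt k H p j)

/-- For `f` on `H ^ ⊗ (m + 1)`, the map
`(w ⊗ v) ⊗ (s ⊗ h) ↦ h ▹ f(s ⊗ w) ◃ v` with `w ∈ H ^ ⊗ m` and `v, s, h ∈ H`. -/
def tauAlgCore (m q : ℕ) (f : GS k H (m + 1) q) :
    (T k H m ⊗[k] H) ⊗[k] (H ⊗[k] H) →ₗ[k] T k H q :=
  leftAct k H q ∘ₗ (TensorProduct.comm k (T k H q) H).toLinearMap ∘ₗ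
    (rightAct k H q).rTensor H ∘ₗ (TensorProduct.assoc k (T k H q) H H).symm.toLinearMap ∘ₗ
    (f ∘ₗ (cons k H m).toLinearMap ∘ₗ (TensorProduct.comm k (T k H m) H).toLinearMap).rTensor
      (H ⊗[k] H) ∘ₗ
    (TensorProduct.tensorTensorTensorComm k (T k H m) H H H).toLinearMap

/-- The vertical operator
`(τ f)(u¹, …, uᵖ) =
  (u¹₍₃₎ ⋯ uᵖ₍₃₎) ▹ f(S⁻¹(u¹₍₂₎ ⋯ uᵖ₍₂₎), u¹₍₁₎, …, uᵖ⁻¹₍₁₎) ◃ uᵖ₍₁₎`,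
which is the identity for `p = 0`. -/
def tauAlg : ∀ p q : ℕ, GS k H p q →ₗ[k] GS k H p q
  | 0, _ => LinearMap.id
  | m + 1, q =>
    { toFun := fun f => tauAlgCore k H m q f ∘ₗ
        TensorProduct.map (snoc k H m).symm.toLinearMap
          (TensorProduct.map (antipodeInv k H ∘ₗ prod k H (m + 1)) (prod k H (m + 1))) ∘ₗ
        comulT₃ k H (m + 1)
      map_add' := fun f g => by
        simp [tauAlgCore, LinearMap.rTensor_add, LinearMap.add_comp, LinearMap.comp_add]
      map_smul' := fun c f => by
        simp [tauAlgCore, LinearMap.rTensor_smul, LinearMap.smul_comp, LinearMap.comp_smul] }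

/-! #### The rows (coHochschild direction) -/

/-- `(δʰ₀ f)(u) = u¹₍₁₎ ⋯ uᵖ₍₁₎ ⊗ f(u₍₂₎)`. -/
def cofaceHFirst (p q : ℕ) : GS k H p q →ₗ[k] GS k H p (q + 1) where
  toFun f := (cons k H q).toLinearMap ∘ₗ TensorProduct.map (prod k H p) f ∘ₗ comulT k H p
  map_add' f g := by simp [TensorProduct.map_add_right, LinearMap.add_comp, LinearMap.comp_add]
  map_smul' c f := by
    simp [TensorProduct.map_smul_right, LinearMap.smul_comp, LinearMap.comp_smul]

/-- `(δʰ_{q+1} f)(u) = f(u₍₁₎) ⊗ u¹₍₂₎ ⋯ uᵖ₍₂₎`. -/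
def cofaceHLast (p q : ℕ) : GS k H p q →ₗ[k] GS k H p (q + 1) where
  toFun f := (snoc k H q).toLinearMap ∘ₗ TensorProduct.map f (prod k H p) ∘ₗ comulT k H p
  map_add' f g := by simp [TensorProduct.map_add_left, LinearMap.add_comp, LinearMap.comp_add]
  map_smul' c f := by
    simp [TensorProduct.map_smul_left, LinearMap.smul_comp, LinearMap.comp_smul]

/-- The horizontal cofaces; for `1 ≤ i ≤ q` one has
`(δʰᵢ f)(u) = (id ^ ⊗ (i - 1) ⊗ Δ ⊗ id ^ ⊗ (q - i)) f(u)`. -/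
def cofaceH (p q : ℕ) (i : ℕ) : GS k H p q →ₗ[k] GS k H p (q + 1) :=
  if i = 0 then cofaceHFirst k H p q
  else if i = q + 1 then cofaceHLast k H p q
  else LinearMap.llcomp k (T k H p) (T k H q) (T k H (q + 1)) (comulAt k H q (i - 1))

/-- The horizontal codegeneracies `(σʰⱼ f)(u) = (id ^ ⊗ j ⊗ ε ⊗ id ^ ⊗ (q - j)) f(u)`. -/
def codegH (p q : ℕ) (j : ℕ) : GS k H p (q + 1) →ₗ[k] GS k H p q :=
  LinearMap.llcomp k (T k H p) (T k H (q + 1)) (T k H q) (counitAt k H q j)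

/-- The map `h ⊗ ((x¹ ⊗ ⋯ ⊗ x^{m+1}) ⊗ g) ↦ (h S(x¹)) ▹ (x² ⊗ ⋯ ⊗ x^{m+1} ⊗ g)`. -/
def tauCoalgCore (m : ℕ) : H ⊗[k] (T k H (m + 1) ⊗[k] H) →ₗ[k] T k H (m + 1) :=
  leftAct k H (m + 1) ∘ₗ
    TensorProduct.map
      (LinearMap.mul' k H ∘ₗ (HopfAlgebra.antipode k (A := H)).lTensor H)
      (snoc k H m).toLinearMap ∘ₗ
    (TensorProduct.assoc k H H (T k H m ⊗[k] H)).symm.toLinearMap ∘ₗ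
    ((TensorProduct.assoc k H (T k H m) H).toLinearMap ∘ₗ
      (cons k H m).symm.toLinearMap.rTensor H).lTensor H

/-- The horizontal operator
`(τ f)(u) = (u¹₍₁₎ ⋯ uᵖ₍₁₎ S(f⁽¹⁾(u₍₂₎))) ▹ (f⁽²⁾(u₍₂₎) ⊗ ⋯ ⊗ f⁽q⁾(u₍₂₎) ⊗ u¹₍₃₎ ⋯ uᵖ₍₃₎)`,
which is the identity for `q = 0`. -/
def tauCoalg : ∀ p q : ℕ, GS k H p q →ₗ[k] GS k H p q
  | _, 0 => LinearMap.id
  | p, m + 1 =>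
    { toFun := fun f => tauCoalgCore k H m ∘ₗ
        TensorProduct.map (prod k H p) (TensorProduct.map f (prod k H p)) ∘ₗ comulT₃ k H p
      map_add' := fun f g => by
        simp [TensorProduct.map_add_left, TensorProduct.map_add_right, LinearMap.add_comp,
          LinearMap.comp_add]
      map_smul' := fun c f => by
        simp [TensorProduct.map_smul_left, TensorProduct.map_smul_right, LinearMap.smul_comp,
          LinearMap.comp_smul] }

/-! #### The diagonal -/

/-- The diagonal module `Hom(H ^ ⊗ n, H ^ ⊗ n)` in degree `n`. -/
abbrev Diag (n : ℕ) : Type (max u v) := GS k H n n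

/-- `δᵢ = δᵛᵢ ∘ δʰᵢ` on the diagonal. -/
def cofaceDiag (n : ℕ) (i : ℕ) : Diag k H n →ₗ[k] Diag k H (n + 1) :=
  cofaceV k H n (n + 1) i ∘ₗ cofaceH k H n n i

/-- `σⱼ = σᵛⱼ ∘ σʰⱼ` on the diagonal. -/
def codegDiag (n : ℕ) (j : ℕ) : Diag k H (n + 1) →ₗ[k] Diag k H n :=
  codegV k H n n j ∘ₗ codegH k H (n + 1) n j

/-- `τ = τ_alg ∘ τ_coalg` on the diagonal. -/
def tauDiag (n : ℕ) : Diag k H n →ₗ[k] Diag k H n :=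
  tauAlg k H n n ∘ₗ tauCoalg k H n n

/-- The coboundary of the diagonal complex. -/
def dDiag (n : ℕ) : Diag k H n →ₗ[k] Diag k H (n + 1) :=
  Cocyclic.coboundary (cofaceDiag k H) n

/-- Connes' coboundary on the diagonal complex. -/
def BDiag (n : ℕ) : Diag k H (n + 1) →ₗ[k] Diag k H n :=
  Cocyclic.connesB (codegDiag k H) (tauDiag k H) n

/-- Cyclic Gerstenhaber-Schack cohomology: the cohomology of `(C_diag[[u]], d + u B)`. -/
abbrev CyclicGSCohomology (n : ℤ) : Type (max u v) :=
  Cocyclic.CyclicCohomology (dDiag k H) (BDiag k H) n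

end

end GerstenhaberSchack

namespace Cocyclic

/-! ### The mixed complex of a cocyclic module -/

section Single

universe u v

variable {k : Type u} [CommRing k] {C : ℕ → Type v} [∀ n, AddCommGroup (C n)] [∀ n, Module k (C n)]
  {δ : ∀ n, ℕ → (C n →ₗ[k] C (n + 1))} {σ : ∀ n, ℕ → (C (n + 1) →ₗ[k] C n)}
  {τ : ∀ n, C n →ₗ[k] C n}

/-! The formal half is Connes' argument. The diagonal of a cylindrical module is cocyclic because
vertical and horizontal operators commute, so that `(τv τh)^(n+1) = τv^(n+1) τh^(n+1) = 1`. In a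
cocyclic module write `λ` for the signed cyclic operator, `N` for its norm, `b` for the coboundary,
`b'` for `b` without its last coface and `s` for the extra degeneracy. Then `(1 - λ) b = b' (1 -
λ)`, `b N = N b'`, `N (1 - λ) = (1 - λ) N = 0`, and `s` contracts `b'`; these give a mixed complex
with `B = N s (1 - λ)`.

The Hopf-theoretic half regards an element of bidegree `(p, q)` as a map from the coalgebra `H^⊗p`
to the algebra `H^⊗q`. Such maps carry two associative convolution products, `f(u₁) g(u₂)` (written
`⧆`) and `f(u₂) g(u₁)` (written `⧇`). The product `P : H^⊗p → H` is a coalgebra map and the iterated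
coproduct `D : H → H^⊗q` is an algebra map. Hence `D S P` is inverse to `D P` for `⧆`, and also for
`⧇` because `S² = id`.

In these terms (for `p, q > 0`) `τ_coalg f = DP ⧆ ((R ∘ f) ⧆ ℓP)`, where `R` is the Connes-Moscovici
operator `cmRotate` and `ℓ` the inclusion of the last slot, and dually `τ_alg f = DP ⧇ ((f ∘ R') ⧇
Dπ)`, where `R'` is `corotate` and `π` the projection to the last factor. The operator `R` is the
cyclic rotation of `q + 1` factors seen through `contract`, and `R'` is the rotation of `p + 1`
factors seen through `antipodeCons`; so `R^(q+1) = 1` and `R'^(p+1) = 1`. Moving the flanking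
factors through `R` and `R'` gives `τ_coalg^(q+1) f = DP(u₁) DSP(u₄) f(u₃) DSP(u₂) DP(u₅)`,
`τ_alg^(p+1) f = DP(u₅) DSP(u₂) f(u₃) DSP(u₄) DP(u₁)`, and these two conjugations cancel
(`colCyc_iterate_rowCyc_iterate`).

The cosimplicial identities become those of the bar and cobar constructions once `f` is extended by
one slot or argument at each end (`coactBoth`, `actBoth`). For the mixed commutations, inner
operators are composition with coalgebra or algebra maps and commute by naturality. The outer ones
follow from four computations, `actFirst_coactLast`, `actFirst_rowCyc`, `colCyc_coactLast` and
`colCyc_rowCyc`, since a last coface is `τ δ₀` and `τ_coalg` is injective. -/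

theorem comp_finsetSum {M N P ι : Type*} [AddCommGroup M] [AddCommGroup N] [AddCommGroup P]
    [Module k M] [Module k N] [Module k P] (s : Finset ι) (g : N →ₗ[k] P) (f : ι → M →ₗ[k] N) :
    g ∘ₗ (∑ i ∈ s, f i) = ∑ i ∈ s, g ∘ₗ f i := by
  ext; simp

theorem finsetSum_comp {M N P ι : Type*} [AddCommGroup M] [AddCommGroup N] [AddCommGroup P]
    [Module k M] [Module k N] [Module k P] (s : Finset ι) (g : ι → N →ₗ[k] P) (f : M →ₗ[k] N) :
    (∑ i ∈ s, g i) ∘ₗ f = ∑ i ∈ s, g i ∘ₗ f := by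
  ext; simp

/-- The signed cyclic operator `(-1) ^ n τ`. -/
def signedCyclic (τ : ∀ n, C n →ₗ[k] C n) (n : ℕ) : C n →ₗ[k] C n := (-1 : k) ^ n • τ n

/-- The coboundary without its last term. -/
def coboundary' (δ : ∀ n, ℕ → (C n →ₗ[k] C (n + 1))) (n : ℕ) : C n →ₗ[k] C (n + 1) :=
  ∑ i ∈ Finset.range (n + 1), (-1 : k) ^ i • δ n i

theorem coboundary_eq_coboundary'_add (n : ℕ) :
    coboundary δ n = coboundary' δ n + (-1 : k) ^ (n + 1) • δ n (n + 1) := by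
  rw [coboundary, Finset.sum_range_succ, coboundary']

theorem norm_eq_sum_signedCyclic_pow (n : ℕ) :
    norm τ n = ∑ i ∈ Finset.range (n + 1), signedCyclic τ n ^ i := by
  simp only [norm, signedCyclic, smul_pow, ← pow_mul]

theorem coboundary_comp_coboundary (h : IsCosimplicial C δ σ) (n : ℕ) :
    coboundary δ (n + 1) ∘ₗ coboundary δ n = 0 := by
  have key : ∀ x : C n, (coboundary δ (n + 1)) (coboundary δ n x) = 0 := by
    intro x
    have e1 : coboundary δ (n + 1) (coboundary δ n x) =
        ∑ p ∈ Finset.range (n + 3) ×ˢ Finset.range (n + 2),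
          ((-1 : k) ^ (p.1 + p.2)) • δ (n + 1) p.1 (δ n p.2 x) := by
      simp only [coboundary, LinearMap.sum_apply, LinearMap.smul_apply, map_sum, map_smul,
        Finset.sum_product, Finset.smul_sum, smul_smul, pow_add]
      rw [Finset.sum_comm]
      simp only [mul_comm]
    -- The coface identity matches the pairs with `p.2 < p.1` bijectively with the remaining ones;
    -- lowering one index by one makes the signs opposite.
    rw [e1, ← Finset.sum_filter_add_sum_filter_not _ (fun p : ℕ × ℕ => p.2 < p.1),
      ← eq_neg_iff_add_eq_zero, ← Finset.sum_neg_distrib]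
    refine Finset.sum_bij' (fun p _ => (p.2, p.1 - 1)) (fun p _ => (p.2 + 1, p.1)) ?_ ?_ ?_ ?_ ?_
    · rintro ⟨a, b⟩ h; simp only [Finset.mem_filter, Finset.mem_product, Finset.mem_range] at h ⊢
      omega
    · rintro ⟨a, b⟩ h; simp only [Finset.mem_filter, Finset.mem_product, Finset.mem_range] at h ⊢
      omega
    · rintro ⟨a, b⟩ h; simp only [Finset.mem_filter, Finset.mem_product, Finset.mem_range] at h ⊢
      ext <;> simp; omega
    · rintro ⟨a, b⟩ h; simp
    · rintro ⟨a, b⟩ hab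
      simp only [Finset.mem_filter, Finset.mem_product, Finset.mem_range] at hab
      obtain ⟨c, rfl⟩ : ∃ c, a = c + 1 := ⟨a - 1, by omega⟩
      have := LinearMap.congr_fun (h.coface_coface n b c (by omega) (by omega)) x
      simp only [LinearMap.comp_apply] at this
      simp only [this, Nat.add_sub_cancel]
      rw [← neg_smul]; congr 1; ring
  ext x; exact key x

/-- Each application of `λ` lowers the coface index by one, and the sign in `λ` absorbs the
alternating sign. All terms of `b` and `b'` thereby become `δ₀` up to powers of `λ`, which `N`
swallows. -/
theorem pow_smul_comp_pow (h : IsParaCocyclic C δ σ τ) (n i : ℕ) (hi : i ≤ n + 1) :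
    (signedCyclic τ (n + 1) ^ i) ∘ₗ ((-1 : k) ^ i • δ n i) = δ n 0 ∘ₗ (signedCyclic τ n ^ i) := by
  induction i with
  | zero => ext; simp
  | succ i ih =>
    have e : signedCyclic τ (n + 1) ∘ₗ ((-1 : k) ^ (i + 1) • δ n (i + 1)) =
        ((-1 : k) ^ i • δ n i) ∘ₗ signedCyclic τ n := by
      rw [signedCyclic, signedCyclic, LinearMap.smul_comp, LinearMap.comp_smul,
        h.cyc_coface_succ n i (by omega), LinearMap.smul_comp, LinearMap.comp_smul, smul_smul,
        smul_smul]
      congr 1; ring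
    rw [pow_succ, Module.End.mul_eq_comp, LinearMap.comp_assoc, e, ← LinearMap.comp_assoc,
      ih (by omega), LinearMap.comp_assoc, pow_succ, Module.End.mul_eq_comp]

theorem signedCyclic_pow (h : IsCocyclic C δ σ τ) (n : ℕ) : signedCyclic τ n ^ (n + 1) = 1 := by
  rw [signedCyclic, smul_pow, h.cyc_pow, ← pow_mul, Even.neg_one_pow (Nat.even_mul_succ_self n),
    one_smul]
  rfl

theorem norm_comp_signedCyclic (h : IsCocyclic C δ σ τ) (n : ℕ) :
    norm τ n ∘ₗ signedCyclic τ n = norm τ n := by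
  rw [norm_eq_sum_signedCyclic_pow, ← Module.End.mul_eq_comp, Finset.sum_mul]
  simp only [← pow_succ]
  rw [Finset.sum_range_succ, signedCyclic_pow h, Finset.sum_range_succ', pow_zero]

theorem signedCyclic_comp_norm (h : IsCocyclic C δ σ τ) (n : ℕ) :
    signedCyclic τ n ∘ₗ norm τ n = norm τ n := by
  nth_rw 2 [← norm_comp_signedCyclic h]
  rw [norm_eq_sum_signedCyclic_pow, ← Module.End.mul_eq_comp, ← Module.End.mul_eq_comp,
    Finset.sum_mul, Finset.mul_sum]
  simp only [← pow_succ, ← pow_succ']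

theorem norm_comp_signedCyclic_pow (h : IsCocyclic C δ σ τ) (n i : ℕ) :
    norm τ n ∘ₗ (signedCyclic τ n ^ i) = norm τ n := by
  induction i with
  | zero => rfl
  | succ i ih =>
    rw [pow_succ, Module.End.mul_eq_comp, ← LinearMap.comp_assoc, ih, norm_comp_signedCyclic h]

theorem signedCyclic_pow_comp_norm (h : IsCocyclic C δ σ τ) (n i : ℕ) :
    (signedCyclic τ n ^ i) ∘ₗ norm τ n = norm τ n := by
  induction i with
  | zero => rfl
  | succ i ih =>
    rw [pow_succ, Module.End.mul_eq_comp, LinearMap.comp_assoc, signedCyclic_comp_norm h, ih]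

/-- `N` on the left absorbs `λ^i`, and the powers left on the right of `δ₀` run over exactly the
summands of `N`. Comparison with `coboundary_comp_norm` yields `b N = N b'`. -/
theorem norm_comp_coboundary' (h : IsCocyclic C δ σ τ) (n : ℕ) :
    norm τ (n + 1) ∘ₗ coboundary' δ n = norm τ (n + 1) ∘ₗ δ n 0 ∘ₗ norm τ n := by
  rw [coboundary', comp_finsetSum, norm_eq_sum_signedCyclic_pow n, comp_finsetSum,
    comp_finsetSum]
  refine Finset.sum_congr rfl fun i hi => ?_
  rw [Finset.mem_range] at hi
  rw [← pow_smul_comp_pow h.toIsParaCocyclic n i (by omega), ← LinearMap.comp_assoc,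
    norm_comp_signedCyclic_pow h]

theorem coboundary_comp_norm (h : IsCocyclic C δ σ τ) (n : ℕ) :
    coboundary δ n ∘ₗ norm τ n = norm τ (n + 1) ∘ₗ δ n 0 ∘ₗ norm τ n := by
  have e : ∀ i ∈ Finset.range (n + 2), ((-1 : k) ^ i • δ n i) ∘ₗ norm τ n =
      (signedCyclic τ (n + 1) ^ (n + 2 - i)) ∘ₗ δ n 0 ∘ₗ norm τ n := by
    intro i hi
    rw [Finset.mem_range] at hi
    have h1 : (signedCyclic τ (n + 1) ^ (n + 2 - i)) ∘ₗ (signedCyclic τ (n + 1) ^ i) =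
        LinearMap.id := by
      rw [← Module.End.mul_eq_comp, ← pow_add, Nat.sub_add_cancel (by omega), signedCyclic_pow h]
      rfl
    nth_rw 2 [← signedCyclic_pow_comp_norm h n i]
    rw [← LinearMap.comp_assoc (norm τ n), ← pow_smul_comp_pow h.toIsParaCocyclic n i (by omega),
      ← LinearMap.comp_assoc, ← LinearMap.comp_assoc, h1, LinearMap.id_comp]
  rw [coboundary, finsetSum_comp, Finset.sum_congr rfl e, ← finsetSum_comp]
  congr 1
  -- The exponents `n + 2 - i` run over `1, …, n + 2` instead of `0, …, n + 1`, so the norm is first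
  -- replaced by `λ N`.
  rw [← signedCyclic_comp_norm h, norm_eq_sum_signedCyclic_pow, ← Module.End.mul_eq_comp,
    Finset.mul_sum, ← Finset.sum_range_reflect]
  refine Finset.sum_congr rfl fun i hi => ?_
  rw [Finset.mem_range] at hi
  rw [← pow_succ']
  congr 1; omega

theorem id_sub_signedCyclic_comp_coboundary (h : IsParaCocyclic C δ σ τ) (n : ℕ) :
    (LinearMap.id - signedCyclic τ (n + 1)) ∘ₗ coboundary δ n =
      coboundary' δ n ∘ₗ (LinearMap.id - signedCyclic τ n) := by
  have e : signedCyclic τ (n + 1) ∘ₗ coboundary δ n =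
      coboundary' δ n ∘ₗ signedCyclic τ n + (-1 : k) ^ (n + 1) • δ n (n + 1) := by
    rw [coboundary, comp_finsetSum, Finset.sum_range_succ', coboundary', finsetSum_comp]
    congr 1
    · refine Finset.sum_congr rfl fun i hi => ?_
      rw [Finset.mem_range] at hi
      rw [signedCyclic, signedCyclic, LinearMap.smul_comp, LinearMap.comp_smul,
        h.cyc_coface_succ n i (by omega), LinearMap.smul_comp, LinearMap.comp_smul, smul_smul,
        smul_smul]
      congr 1; ring
    · rw [signedCyclic, pow_zero, one_smul, LinearMap.smul_comp, h.cyc_coface_zero]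
  rw [LinearMap.sub_comp, LinearMap.comp_sub, e, coboundary_eq_coboundary'_add, LinearMap.id_comp,
    LinearMap.comp_id]
  abel

theorem extraDegeneracy_comp_coface_zero (h : IsParaCocyclic C δ σ τ) (n : ℕ) :
    extraDegeneracy σ τ n ∘ₗ δ n 0 = LinearMap.id := by
  rw [extraDegeneracy, LinearMap.comp_assoc, h.cyc_coface_zero, h.codeg_coface_succ n n le_rfl]

theorem extraDegeneracy_comp_coface_succ (h : IsParaCocyclic C δ σ τ) (n i : ℕ) (hi : i ≤ n) :
    extraDegeneracy σ τ (n + 1) ∘ₗ δ (n + 1) (i + 1) = δ n i ∘ₗ extraDegeneracy σ τ n := by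
  rw [extraDegeneracy, LinearMap.comp_assoc, h.cyc_coface_succ _ _ (by omega),
    ← LinearMap.comp_assoc, h.codeg_coface_lt n i n hi le_rfl, extraDegeneracy,
    LinearMap.comp_assoc]

theorem extraDegeneracy_comp_coboundary'_zero (h : IsParaCocyclic C δ σ τ) :
    extraDegeneracy σ τ 0 ∘ₗ coboundary' δ 0 = LinearMap.id := by
  rw [coboundary', Finset.sum_range_one, pow_zero, one_smul, extraDegeneracy_comp_coface_zero h]

/-- The extra degeneracy splits `δ₀` and commutes with the other cofaces after an index shift, which
flips the signs. On the last coface it would give `τ` instead, which is why the homotopy is for `b'`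
and not for `b`. -/
theorem coboundary'_homotopy (h : IsParaCocyclic C δ σ τ) (n : ℕ) :
    extraDegeneracy σ τ (n + 1) ∘ₗ coboundary' δ (n + 1) =
      LinearMap.id - coboundary' δ n ∘ₗ extraDegeneracy σ τ n := by
  rw [coboundary', comp_finsetSum, Finset.sum_range_succ', coboundary', finsetSum_comp,
    pow_zero, one_smul, extraDegeneracy_comp_coface_zero h, add_comm _ LinearMap.id, sub_eq_add_neg,
    ← Finset.sum_neg_distrib]
  congr 1
  refine Finset.sum_congr rfl fun i hi => ?_
  rw [Finset.mem_range] at hi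
  rw [LinearMap.comp_smul, extraDegeneracy_comp_coface_succ h n i (by omega), pow_succ,
    LinearMap.smul_comp]
  simp

theorem connesB_eq (n : ℕ) : connesB σ τ n =
    norm τ n ∘ₗ extraDegeneracy σ τ n ∘ₗ (LinearMap.id - signedCyclic τ (n + 1)) := rfl

theorem id_sub_signedCyclic_comp_norm (h : IsCocyclic C δ σ τ) (n : ℕ) :
    (LinearMap.id - signedCyclic τ n) ∘ₗ norm τ n = 0 := by
  rw [LinearMap.sub_comp, signedCyclic_comp_norm h, LinearMap.id_comp, sub_self]

theorem norm_comp_id_sub_signedCyclic (h : IsCocyclic C δ σ τ) (n : ℕ) :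
    norm τ n ∘ₗ (LinearMap.id - signedCyclic τ n) = 0 := by
  rw [LinearMap.comp_sub, norm_comp_signedCyclic h, LinearMap.comp_id, sub_self]

theorem connesB_comp_coboundary (h : IsCocyclic C δ σ τ) (n : ℕ) :
    connesB σ τ n ∘ₗ coboundary δ n = norm τ n ∘ₗ (extraDegeneracy σ τ n ∘ₗ coboundary' δ n) ∘ₗ
      (LinearMap.id - signedCyclic τ n) := by
  rw [connesB_eq, LinearMap.comp_assoc, LinearMap.comp_assoc,
    id_sub_signedCyclic_comp_coboundary h.toIsParaCocyclic]
  rfl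

/-- The mixed complex of a cocyclic module. -/
theorem IsCocyclic.isMixedComplex (h : IsCocyclic C δ σ τ) :
    IsMixedComplex (coboundary δ) (connesB σ τ) where
  d_d := coboundary_comp_coboundary h.toIsCosimplicial
  B_B n := by
    rw [connesB_eq, connesB_eq, LinearMap.comp_assoc, LinearMap.comp_assoc,
      ← LinearMap.comp_assoc _ (norm τ (n + 1)), id_sub_signedCyclic_comp_norm h,
      LinearMap.zero_comp, LinearMap.comp_zero, LinearMap.comp_zero]
  B_d_zero := by
    rw [connesB_comp_coboundary h, extraDegeneracy_comp_coboundary'_zero h.toIsParaCocyclic,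
      LinearMap.id_comp, norm_comp_id_sub_signedCyclic h]
  anticomm n := by
    -- `B b = N (s b') (1 - λ) = N (1 - λ) - N b' s (1 - λ)`; the first term vanishes and the second
    -- is `-b N s (1 - λ) = -b B`.
    rw [connesB_comp_coboundary h, coboundary'_homotopy h.toIsParaCocyclic, LinearMap.sub_comp,
      LinearMap.id_comp, LinearMap.comp_sub, norm_comp_id_sub_signedCyclic h, connesB_eq,
      ← LinearMap.comp_assoc, coboundary_comp_norm h, ← norm_comp_coboundary' h]
    simp only [LinearMap.comp_assoc]
    abel

variable {d : ∀ n, C n →ₗ[k] C (n + 1)} {B : ∀ n, C (n + 1) →ₗ[k] C n}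

theorem cyclicD_zero_zero (x : ℕ → ∀ m, C m) : cyclicD d B x 0 0 = 0 := rfl

theorem cyclicD_zero_succ (x : ℕ → ∀ m, C m) (m : ℕ) :
    cyclicD d B x 0 (m + 1) = d m (x 0 m) := rfl

theorem cyclicD_succ_zero (x : ℕ → ∀ m, C m) (l : ℕ) :
    cyclicD d B x (l + 1) 0 = B 0 (x l 1) := zero_add _

theorem cyclicD_succ_succ (x : ℕ → ∀ m, C m) (l m : ℕ) :
    cyclicD d B x (l + 1) (m + 1) = d m (x (l + 1) m) + B (m + 1) (x l (m + 2)) := rfl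

/-- The square of `d + u B` vanishes. -/
theorem IsMixedComplex.cyclicD_comp_cyclicD (h : IsMixedComplex d B) :
    cyclicD d B ∘ₗ cyclicD d B = 0 := by
  have hd : ∀ n x, d (n + 1) (d n x) = 0 := fun n x => LinearMap.congr_fun (h.d_d n) x
  have hB : ∀ n x, B n (B (n + 1) x) = 0 := fun n x => LinearMap.congr_fun (h.B_B n) x
  have h0 : ∀ x, B 0 (d 0 x) = 0 := fun x => LinearMap.congr_fun h.B_d_zero x
  have hs : ∀ n x, d n (B n x) + B (n + 1) (d (n + 1) x) = 0 :=
    fun n x => LinearMap.congr_fun (h.anticomm n) x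
  refine LinearMap.ext fun x => ?_
  funext l m
  change cyclicD d B (cyclicD d B x) l m = 0
  -- Two applications of `d + u B` reach back at most two powers of `u` and two degrees, so the
  -- cases `0`, `1` and `≥ 2` of each index exhibit `d d`, `d B + B d` and `B B`.
  rcases l with _ | _ | l <;> rcases m with _ | _ | m <;>
    simp only [cyclicD_zero_zero, cyclicD_zero_succ, cyclicD_succ_zero, cyclicD_succ_succ,
      zero_add, map_add, map_zero, hd, hB, h0, hs, add_zero]

theorem cyclicD_mem_homogeneous {n : ℤ} {x : ℕ → ∀ m, C m} (hx : x ∈ homogeneous k C (n - 1)) :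
    cyclicD d B x ∈ homogeneous k C n := by
  have hx' : ∀ l m : ℕ, (m : ℤ) + 2 * l ≠ n - 1 → x l m = 0 := hx
  intro l m hlm
  rcases l with _ | l <;> rcases m with _ | m <;>
    simp only [cyclicD_zero_zero, cyclicD_zero_succ, cyclicD_succ_zero, cyclicD_succ_succ]
  · rw [hx' _ _ (by push_cast at hlm ⊢; omega), map_zero]
  · rw [hx' _ _ (by push_cast at hlm ⊢; omega), map_zero]
  · rw [hx' _ _ (by push_cast at hlm ⊢; omega), hx' _ _ (by push_cast at hlm ⊢; omega), map_zero,
      map_zero, add_zero]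

theorem IsMixedComplex.cyclicCoboundaries_le (h : IsMixedComplex d B) (n : ℤ) :
    cyclicCoboundaries d B n ≤ cyclicCocycles d B n := by
  rintro _ ⟨x, hx, rfl⟩
  exact ⟨cyclicD_mem_homogeneous hx, LinearMap.congr_fun h.cyclicD_comp_cyclicD x⟩

end Single

/-! ### The diagonal of a cylindrical module -/

section Double

universe u v

variable {k : Type u} [CommRing k] {C : ℕ → ℕ → Type v} [∀ p q, AddCommGroup (C p q)]
  [∀ p q, Module k (C p q)]
  {δv : ∀ p q, ℕ → (C p q →ₗ[k] C (p + 1) q)} {σv : ∀ p q, ℕ → (C (p + 1) q →ₗ[k] C p q)}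
  {τv : ∀ p q, C p q →ₗ[k] C p q}
  {δh : ∀ p q, ℕ → (C p q →ₗ[k] C p (q + 1))} {σh : ∀ p q, ℕ → (C p (q + 1) →ₗ[k] C p q)}
  {τh : ∀ p q, C p q →ₗ[k] C p q}

/-- The diagonal of a cylindrical module is a cocyclic module. -/
theorem IsCylindrical.diagonal (h : IsCylindrical C δv σv τv δh σh τh) :
    IsCocyclic (fun n => C n n) (fun n i => δv n (n + 1) i ∘ₗ δh n n i)
      (fun n j => σv n n j ∘ₗ σh (n + 1) n j) (fun n => τv n n ∘ₗ τh n n) where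
  coface_coface n i j hij hj := by
    have c := (h.column (n + 2)).coface_coface n i j hij hj
    have r := (h.row n).coface_coface n i j hij hj
    have m1 := h.δv_δh n (n + 1) i (j + 1) (by omega) (by omega)
    have m2 := h.δv_δh n (n + 1) j i (by omega) (by omega)
    beta_reduce at c r ⊢
    rw [LinearMap.comp_assoc, ← LinearMap.comp_assoc _ (δv n (n + 1) i), ← m1,
      LinearMap.comp_assoc, r, ← LinearMap.comp_assoc, c, LinearMap.comp_assoc,
      ← LinearMap.comp_assoc _ _ (δv n (n + 1 + 1) j), m2]
    rfl
  codeg_codeg n i j hij hj := by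
    have c := (h.column n).codeg_codeg n i j hij hj
    have r := (h.row (n + 2)).codeg_codeg n i j hij hj
    have m1 := h.σv_σh (n + 1) n i j (by omega) (by omega)
    have m2 := h.σv_σh (n + 1) n (j + 1) i (by omega) (by omega)
    beta_reduce at c r ⊢
    rw [LinearMap.comp_assoc, ← LinearMap.comp_assoc _ (σv (n + 1) (n + 1) i), ← m1,
      LinearMap.comp_assoc, r, ← LinearMap.comp_assoc, c, LinearMap.comp_assoc,
      ← LinearMap.comp_assoc _ _ (σv (n + 1) n (j + 1)), m2]
    rfl
  codeg_coface_lt n i j hij hj := by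
    have c := (h.column (n + 1)).codeg_coface_lt n i j hij hj
    have r := (h.row (n + 1)).codeg_coface_lt n i j hij hj
    have m1 := h.δv_σh (n + 1) (n + 1) i (j + 1) (by omega) (by omega)
    have m2 := h.σv_δh n n j i (by omega) (by omega)
    beta_reduce at c r ⊢
    rw [LinearMap.comp_assoc, ← LinearMap.comp_assoc _ (δv (n + 1) (n + 2) i), ← m1,
      LinearMap.comp_assoc, r, ← LinearMap.comp_assoc, c, LinearMap.comp_assoc,
      ← LinearMap.comp_assoc _ _ (σv n (n + 1) j), m2]
    rfl
  codeg_coface_self n j hj := by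
    have c := (h.column n).codeg_coface_self n j hj
    have r := (h.row n).codeg_coface_self n j hj
    have m1 := h.δv_σh n n j j (by omega) (by omega)
    beta_reduce at c r ⊢
    rw [LinearMap.comp_assoc, ← LinearMap.comp_assoc _ (δv n (n + 1) j), ← m1,
      LinearMap.comp_assoc, r, ← LinearMap.comp_assoc, c]
    rfl
  codeg_coface_succ n j hj := by
    have c := (h.column n).codeg_coface_succ n j hj
    have r := (h.row n).codeg_coface_succ n j hj
    have m1 := h.δv_σh n n (j + 1) j (by omega) (by omega)
    beta_reduce at c r ⊢
    rw [LinearMap.comp_assoc, ← LinearMap.comp_assoc _ (δv n (n + 1) (j + 1)), ← m1,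
      LinearMap.comp_assoc, r, ← LinearMap.comp_assoc, c]
    rfl
  codeg_coface_gt n i j hij hi := by
    have c := (h.column (n + 1)).codeg_coface_gt n i j hij hi
    have r := (h.row (n + 1)).codeg_coface_gt n i j hij hi
    have m1 := h.δv_σh (n + 1) (n + 1) (i + 1) j (by omega) (by omega)
    have m2 := h.σv_δh n n j i (by omega) (by omega)
    beta_reduce at c r ⊢
    rw [LinearMap.comp_assoc, ← LinearMap.comp_assoc _ (δv (n + 1) (n + 2) (i + 1)), ← m1,
      LinearMap.comp_assoc, r, ← LinearMap.comp_assoc, c, LinearMap.comp_assoc,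
      ← LinearMap.comp_assoc _ _ (σv n (n + 1) j), m2]
    rfl
  cyc_coface_zero n := by
    have c := (h.column (n + 1)).cyc_coface_zero n
    have r := (h.row n).cyc_coface_zero n
    have m1 := h.δv_τh n (n + 1) 0 (by omega)
    beta_reduce at c r ⊢
    rw [LinearMap.comp_assoc, ← LinearMap.comp_assoc _ (δv n (n + 1) 0), ← m1,
      LinearMap.comp_assoc, r, ← LinearMap.comp_assoc, c]
  cyc_coface_succ n i hi := by
    have c := (h.column (n + 1)).cyc_coface_succ n i hi
    have r := (h.row n).cyc_coface_succ n i hi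
    have m1 := h.δv_τh n (n + 1) (i + 1) (by omega)
    have m2 := h.τv_δh n n i (by omega)
    beta_reduce at c r ⊢
    rw [LinearMap.comp_assoc, ← LinearMap.comp_assoc _ (δv n (n + 1) (i + 1)), ← m1,
      LinearMap.comp_assoc, r, ← LinearMap.comp_assoc, c, LinearMap.comp_assoc,
      ← LinearMap.comp_assoc _ _ (τv n (n + 1)), m2]
    rfl
  cyc_codeg_zero n := by
    have c := (h.column n).cyc_codeg_zero n
    have r := (h.row (n + 1)).cyc_codeg_zero n
    have m1 := h.σv_τh n n 0 (by omega)
    have m2 := h.τv_σh (n + 1) n n (by omega)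
    have m3 := h.τv_τh (n + 1) (n + 1)
    beta_reduce at c r ⊢
    ext1 f
    have c' := fun f => LinearMap.congr_fun c f
    have r' := fun f => LinearMap.congr_fun r f
    have m1' := fun f => LinearMap.congr_fun m1 f
    have m2' := fun f => LinearMap.congr_fun m2 f
    have m3' := fun f => LinearMap.congr_fun m3 f
    simp only [LinearMap.comp_apply] at c' r' m1' m2' m3' ⊢
    -- The squares `τh²` and `τv²` appear separately; one exchange of `τv` and `τh` turns their
    -- product into `(τv τh)²`.
    rw [← m1', r', c', m2', m2', m3']
  cyc_codeg_succ n i hi := by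
    have c := (h.column n).cyc_codeg_succ n i hi
    have r := (h.row (n + 1)).cyc_codeg_succ n i hi
    have m1 := h.σv_τh n n (i + 1) (by omega)
    have m2 := h.τv_σh (n + 1) n i (by omega)
    beta_reduce at c r ⊢
    rw [LinearMap.comp_assoc, ← LinearMap.comp_assoc _ (σv n n (i + 1)), ← m1,
      LinearMap.comp_assoc, r, ← LinearMap.comp_assoc, c, LinearMap.comp_assoc,
      ← LinearMap.comp_assoc _ _ (τv (n + 1) n), m2]
    rfl
  cyc_pow n := by
    have m := h.τv_τh n n
    have hc : Commute (τv n n) (τh n n) := m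
    rw [← h.cylindrical n n, ← Module.End.mul_eq_comp, ← Module.End.mul_eq_comp, hc.mul_pow]

end Double

end Cocyclic

open scoped TensorProduct
namespace GerstenhaberSchack

noncomputable section

open TensorProduct Coalgebra

/-! ### The two convolution products on maps from a coalgebra to an algebra -/

section Convolution

variable {k : Type*} [CommRing k]
  {A : Type*} [AddCommGroup A] [Module k A] [Coalgebra k A]
  {A' : Type*} [AddCommGroup A'] [Module k A'] [Coalgebra k A']
  {B : Type*} [Ring B] [Algebra k B] {B' : Type*} [Ring B'] [Algebra k B']

/-- The convolution product `u ↦ f(u₍₁₎) g(u₍₂₎)`. -/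
def conv (f g : A →ₗ[k] B) : A →ₗ[k] B :=
  (LinearMap.mul' k B ∘ₗ TensorProduct.map f g) ∘ₗ comul

/-- The product `u ↦ f(u₍₂₎) g(u₍₁₎)`, i.e. convolution over the co-opposite coalgebra. -/
def opConv (f g : A →ₗ[k] B) : A →ₗ[k] B :=
  (LinearMap.mul' k B ∘ₗ TensorProduct.map f g ∘ₗ (TensorProduct.comm k A A).toLinearMap) ∘ₗ comul

infixl:70 " ⧆ " => conv
infixl:70 " ⧇ " => opConv

variable (k A B) in
/-- The unit `u ↦ ε(u) 1` of both convolution products. -/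
def convUnit : A →ₗ[k] B := Algebra.linearMap k B ∘ₗ counit

theorem convUnit_apply (u : A) : convUnit k A B u = algebraMap k B (counit u) := rfl

theorem conv_apply {u : A} {ι : Type*} (r : Coalgebra.Repr k u ι) (f g : A →ₗ[k] B) :
    (f ⧆ g) u = ∑ i ∈ r.index, f (r.left i) * g (r.right i) := by
  simp [conv, ← r.eq]

theorem opConv_apply {u : A} {ι : Type*} (r : Coalgebra.Repr k u ι) (f g : A →ₗ[k] B) :
    (f ⧇ g) u = ∑ i ∈ r.index, f (r.right i) * g (r.left i) := by
  simp [opConv, ← r.eq]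

/-- Normal form for a threefold product: a single linear map applied to the iterated coproduct `u₁ ⊗
(u₂ ⊗ u₃)`. With the three companions below, any identity mixing `⧆` and `⧇` reduces to an equality
of linear maps on pure tensors. -/
theorem conv_comul_right (f : A →ₗ[k] B) (w : A ⊗[k] A →ₗ[k] B) :
    f ⧆ (w ∘ₗ comul) = (LinearMap.mul' k B ∘ₗ TensorProduct.map f w) ∘ₗ
      (comul (R := k) (A := A)).lTensor A ∘ₗ comul := by
  have : TensorProduct.map f (w ∘ₗ comul) = TensorProduct.map f w ∘ₗ
      (comul (R := k) (A := A)).lTensor A := by ext; simp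
  rw [conv, this]; rfl

theorem conv_comul_left (w : A ⊗[k] A →ₗ[k] B) (g : A →ₗ[k] B) :
    (w ∘ₗ comul) ⧆ g = (LinearMap.mul' k B ∘ₗ TensorProduct.map w g ∘ₗ
      (TensorProduct.assoc k A A A).symm.toLinearMap) ∘ₗ
      (comul (R := k) (A := A)).lTensor A ∘ₗ comul := by
  have : TensorProduct.map (w ∘ₗ comul) g = TensorProduct.map w g ∘ₗ
      (comul (R := k) (A := A)).rTensor A := by ext; simp
  rw [conv, this, ← coassoc]; ext; simp

theorem opConv_comul_right (f : A →ₗ[k] B) (w : A ⊗[k] A →ₗ[k] B) :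
    f ⧇ (w ∘ₗ comul) = (LinearMap.mul' k B ∘ₗ TensorProduct.map f w ∘ₗ
      (TensorProduct.comm k (A ⊗[k] A) A).toLinearMap ∘ₗ
      (TensorProduct.assoc k A A A).symm.toLinearMap) ∘ₗ
      (comul (R := k) (A := A)).lTensor A ∘ₗ comul := by
  have : TensorProduct.map f (w ∘ₗ comul) ∘ₗ (TensorProduct.comm k A A).toLinearMap =
      TensorProduct.map f w ∘ₗ (TensorProduct.comm k (A ⊗[k] A) A).toLinearMap ∘ₗ
      (comul (R := k) (A := A)).rTensor A := by ext; simp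
  rw [opConv, this, ← coassoc]; ext; simp

theorem opConv_comul_left (w : A ⊗[k] A →ₗ[k] B) (g : A →ₗ[k] B) :
    (w ∘ₗ comul) ⧇ g = (LinearMap.mul' k B ∘ₗ TensorProduct.map w g ∘ₗ
      (TensorProduct.comm k A (A ⊗[k] A)).toLinearMap) ∘ₗ
      (comul (R := k) (A := A)).lTensor A ∘ₗ comul := by
  have : TensorProduct.map (w ∘ₗ comul) g ∘ₗ (TensorProduct.comm k A A).toLinearMap =
      TensorProduct.map w g ∘ₗ (TensorProduct.comm k A (A ⊗[k] A)).toLinearMap ∘ₗ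
      (comul (R := k) (A := A)).lTensor A := by ext; simp
  rw [opConv, this]; rfl

theorem conv_assoc (f g h : A →ₗ[k] B) : f ⧆ g ⧆ h = f ⧆ (g ⧆ h) := by
  rw [conv, conv.eq_def g h, ← conv, conv_comul_right, conv.eq_def f g, conv_comul_left]
  congr 1; ext; simp [mul_assoc]

theorem opConv_assoc (f g h : A →ₗ[k] B) : f ⧇ g ⧇ h = f ⧇ (g ⧇ h) := by
  rw [opConv.eq_def g h, opConv_comul_right, opConv.eq_def f g, opConv_comul_left]
  congr 1; ext; simp [mul_assoc]

/-- Both sides evaluate `a`, `f`, `b` at `u₁`, `u₂`, `u₃`; only the order of two commuting values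
differs. The next two lemmas hold for the same reason. -/
theorem opConv_conv_right_comm {f a b : A →ₗ[k] B} (h : ∀ u v, Commute (a u) (b v)) :
    (f ⧇ a) ⧆ b = (f ⧆ b) ⧇ a := by
  rw [opConv.eq_def f a, conv_comul_left, conv.eq_def f b, opConv_comul_left]
  congr 1; ext; simp [mul_assoc, (h _ _).eq]

theorem conv_opConv_left_comm {f a b : A →ₗ[k] B} (h : ∀ u v, Commute (a u) (b v)) :
    a ⧆ (b ⧇ f) = b ⧇ (a ⧆ f) := by
  rw [opConv.eq_def b f, conv_comul_right, conv.eq_def a f, opConv_comul_right]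
  congr 1; ext; simp [← mul_assoc, (h _ _).eq]

theorem opConv_conv_eq {f a b : A →ₗ[k] B} (h : ∀ u v, Commute (f u) (b v)) :
    (a ⧇ f) ⧆ b = (a ⧆ b) ⧇ f := by
  rw [opConv.eq_def a f, conv_comul_left, conv.eq_def a b, opConv_comul_left]
  congr 1; ext; simp [mul_assoc, (h _ _).eq]

theorem convUnit_conv (f : A →ₗ[k] B) : convUnit k A B ⧆ f = f := by
  ext u
  rw [conv_apply (ℛ k u)]
  simp only [convUnit_apply, ← Algebra.smul_def, ← map_smul, ← map_sum,
    sum_counit_smul]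

theorem opConv_convUnit (f : A →ₗ[k] B) : f ⧇ convUnit k A B = f := by
  ext u
  rw [opConv_apply (ℛ k u)]
  simp only [convUnit_apply, ← Algebra.commutes, ← Algebra.smul_def, ← map_smul, ← map_sum,
    sum_counit_smul]

theorem sum_smul_counit {u : A} {ι : Type*} (r : Coalgebra.Repr k u ι) :
    ∑ i ∈ r.index, counit (R := k) (r.right i) • r.left i = u := by
  have := congrArg (TensorProduct.rid k A) (sum_tmul_counit_eq (R := k) r)
  simpa only [map_sum, TensorProduct.rid_tmul, one_smul] using this

theorem conv_convUnit (f : A →ₗ[k] B) : f ⧆ convUnit k A B = f := by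
  ext u
  rw [conv_apply (ℛ k u)]
  simp only [convUnit_apply, ← Algebra.commutes, ← Algebra.smul_def, ← map_smul, ← map_sum,
    sum_smul_counit]

theorem convUnit_opConv (f : A →ₗ[k] B) : convUnit k A B ⧇ f = f := by
  ext u
  rw [opConv_apply (ℛ k u)]
  simp only [convUnit_apply, ← Algebra.smul_def, ← map_smul, ← map_sum,
    sum_smul_counit]

theorem opConv_eq_conv_of_commute {f g : A →ₗ[k] B} (h : ∀ u v, Commute (f u) (g v)) :
    f ⧇ g = g ⧆ f := by
  ext u
  rw [opConv_apply (ℛ k u), conv_apply (ℛ k u)]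
  exact Finset.sum_congr rfl fun i _ => (h _ _).eq

theorem comp_conv (g : B →ₐ[k] B') (f h : A →ₗ[k] B) :
    g.toLinearMap ∘ₗ (f ⧆ h) = (g.toLinearMap ∘ₗ f) ⧆ (g.toLinearMap ∘ₗ h) := by
  ext u
  simp [conv_apply (ℛ k u)]

theorem comp_opConv (g : B →ₐ[k] B') (f h : A →ₗ[k] B) :
    g.toLinearMap ∘ₗ (f ⧇ h) = (g.toLinearMap ∘ₗ f) ⧇ (g.toLinearMap ∘ₗ h) := by
  ext u
  simp [opConv_apply (ℛ k u)]

theorem comp_convUnit (g : B →ₐ[k] B') :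
    g.toLinearMap ∘ₗ convUnit k A B = convUnit k A B' := by
  ext u; simp [convUnit_apply]

/-- Compatibility of a linear map with comultiplication and counit. -/
structure IsCoalgMap (s : A' →ₗ[k] A) : Prop where
  comul_comp : comul ∘ₗ s = TensorProduct.map s s ∘ₗ comul
  counit_comp : counit ∘ₗ s = counit (R := k)

namespace IsCoalgMap

variable {s : A' →ₗ[k] A}

theorem conv_comp (hs : IsCoalgMap s) (f g : A →ₗ[k] B) : (f ⧆ g) ∘ₗ s = (f ∘ₗ s) ⧆ (g ∘ₗ s) := by
  rw [conv, LinearMap.comp_assoc, hs.comul_comp, conv, TensorProduct.map_comp]; rfl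

theorem opConv_comp (hs : IsCoalgMap s) (f g : A →ₗ[k] B) :
    (f ⧇ g) ∘ₗ s = (f ∘ₗ s) ⧇ (g ∘ₗ s) := by
  rw [opConv, LinearMap.comp_assoc, hs.comul_comp, opConv, TensorProduct.map_comp]
  have : (TensorProduct.comm k A A).toLinearMap ∘ₗ TensorProduct.map s s =
    TensorProduct.map s s ∘ₗ (TensorProduct.comm k A' A').toLinearMap := by ext; simp
  simp only [LinearMap.comp_assoc]
  rw [← LinearMap.comp_assoc comul, this]; rfl

theorem convUnit_comp (hs : IsCoalgMap s) : convUnit k A B ∘ₗ s = convUnit k A' B := by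
  rw [convUnit, LinearMap.comp_assoc, hs.counit_comp, convUnit]

theorem comp {A'' : Type*} [AddCommGroup A''] [Module k A''] [Coalgebra k A''] {s' : A'' →ₗ[k] A'}
    (hs : IsCoalgMap s) (hs' : IsCoalgMap s') : IsCoalgMap (s ∘ₗ s') where
  comul_comp := by
    rw [← LinearMap.comp_assoc, hs.comul_comp, LinearMap.comp_assoc, hs'.comul_comp,
      TensorProduct.map_comp]; rfl
  counit_comp := by rw [← LinearMap.comp_assoc, hs.counit_comp, hs'.counit_comp]

end IsCoalgMap

end Convolution

/-! ### The antipode as a convolution inverse -/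

section Antipode

variable {k : Type*} [CommRing k] {H : Type*} [Ring H] [HopfAlgebra k H]
  {B : Type*} [Ring B] [Algebra k B]

open HopfAlgebra

theorem algHom_conv_antipode (X : H →ₐ[k] B) :
    X.toLinearMap ⧆ (X.toLinearMap ∘ₗ antipode k) = convUnit k H B := by
  ext h
  rw [conv_apply (ℛ k h)]
  simp only [AlgHom.toLinearMap_apply, LinearMap.comp_apply, ← map_mul, ← map_sum,
    sum_mul_antipode_eq_algebraMap_counit, AlgHom.commutes, convUnit_apply]

theorem antipode_conv_algHom (X : H →ₐ[k] B) :
    (X.toLinearMap ∘ₗ antipode k) ⧆ X.toLinearMap = convUnit k H B := by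
  ext h
  rw [conv_apply (ℛ k h)]
  simp only [AlgHom.toLinearMap_apply, LinearMap.comp_apply, ← map_mul, ← map_sum,
    sum_antipode_mul_eq_algebraMap_counit, AlgHom.commutes, convUnit_apply]

variable (k H) in
/-- The antipode reverses the comultiplication. -/
theorem comul_comp_antipode : comul ∘ₗ antipode k (A := H) =
    TensorProduct.map (antipode k) (antipode k) ∘ₗ (TensorProduct.comm k H H).toLinearMap ∘ₗ
      comul := by
  let i₁ : H →ₐ[k] H ⊗[k] H := Algebra.TensorProduct.includeLeft
  let i₂ : H →ₐ[k] H ⊗[k] H := Algebra.TensorProduct.includeRight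
  let Δ : H →ₐ[k] H ⊗[k] H := Bialgebra.comulAlgHom k H
  have hΔ : Δ.toLinearMap = i₁.toLinearMap ⧆ i₂.toLinearMap := by
    ext h
    rw [conv_apply (ℛ k h)]
    simp only [AlgHom.toLinearMap_apply, i₁, i₂, Algebra.TensorProduct.includeLeft_apply,
      Algebra.TensorProduct.includeRight_apply, Algebra.TensorProduct.tmul_mul_tmul, mul_one,
      one_mul]
    exact (ℛ k h).eq.symm
  have hG : TensorProduct.map (antipode k) (antipode k) ∘ₗ
      (TensorProduct.comm k H H).toLinearMap ∘ₗ comul =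
      (i₂.toLinearMap ∘ₗ antipode k) ⧆ (i₁.toLinearMap ∘ₗ antipode k) := by
    ext h
    rw [conv_apply (ℛ k h)]
    simp [i₁, i₂, ← (ℛ k h).eq]
  -- Uniqueness of inverses: the flipped `S ⊗ S` is a left inverse of the coproduct for `⧆`, and the
  -- coproduct followed after `S` is a right inverse.
  have h1 : (i₂.toLinearMap ∘ₗ antipode k) ⧆ (i₁.toLinearMap ∘ₗ antipode k) ⧆ Δ.toLinearMap =
      convUnit k H _ := by
    rw [hΔ, ← conv_assoc, conv_assoc _ _ i₁.toLinearMap, antipode_conv_algHom, conv_convUnit,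
      antipode_conv_algHom]
  have h2 := algHom_conv_antipode Δ
  rw [hG, ← conv_convUnit ((i₂.toLinearMap ∘ₗ antipode k) ⧆ _), ← h2, ← conv_assoc, h1,
    convUnit_conv]
  rfl

theorem conv_comp_antipode (f g : H →ₗ[k] B) :
    (f ⧆ g) ∘ₗ antipode k = (f ∘ₗ antipode k) ⧇ (g ∘ₗ antipode k) := by
  rw [conv, LinearMap.comp_assoc, comul_comp_antipode, opConv, TensorProduct.map_comp]; rfl

theorem convUnit_comp_antipode : convUnit k H B ∘ₗ antipode k = convUnit k H B := by
  ext; simp [convUnit_apply]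

theorem antipode_comp_antipode (hS : ∀ x : H, antipode k (antipode k x) = x) :
    antipode k ∘ₗ antipode k (A := H) = LinearMap.id := LinearMap.ext hS

/-- Precomposing the identity for `⧆` with `S` exchanges `⧆` and `⧇`, and `S² = id` turns `X S S`
back into `X`. For a general bijective antipode the `⧇`-inverse would involve `S⁻¹` instead. -/
theorem algHom_opConv_antipode (hS : ∀ x : H, antipode k (antipode k x) = x) (X : H →ₐ[k] B) :
    X.toLinearMap ⧇ (X.toLinearMap ∘ₗ antipode k) = convUnit k H B := by
  have := congrArg (fun f => f ∘ₗ antipode k) (antipode_conv_algHom X)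
  rwa [conv_comp_antipode, convUnit_comp_antipode, LinearMap.comp_assoc,
    antipode_comp_antipode hS] at this

theorem antipode_opConv_algHom (hS : ∀ x : H, antipode k (antipode k x) = x) (X : H →ₐ[k] B) :
    (X.toLinearMap ∘ₗ antipode k) ⧇ X.toLinearMap = convUnit k H B := by
  have := congrArg (fun f => f ∘ₗ antipode k) (algHom_conv_antipode X)
  rwa [conv_comp_antipode, convUnit_comp_antipode, LinearMap.comp_assoc,
    antipode_comp_antipode hS] at this

end Antipode

end

end GerstenhaberSchack

open scoped TensorProduct
namespace GerstenhaberSchack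

noncomputable section

open TensorProduct Coalgebra

/-! ### Stability of coalgebra maps -/

section CoalgMap

variable {k : Type*} [CommRing k]
  {A : Type*} [AddCommGroup A] [Module k A] [Coalgebra k A]
  {B : Type*} [AddCommGroup B] [Module k B] [Coalgebra k B]
  {C : Type*} [AddCommGroup C] [Module k C] [Coalgebra k C]
  {D : Type*} [AddCommGroup D] [Module k D] [Coalgebra k D]

namespace IsCoalgMap

theorem of_coalgHom (f : A →ₗc[k] B) : IsCoalgMap f.toLinearMap :=
  ⟨f.map_comp_comul.symm, f.counit_comp⟩

/-- The bundled coalgebra homomorphism. -/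
def toCoalgHom {f : A →ₗ[k] B} (hf : IsCoalgMap f) : A →ₗc[k] B :=
  { f with counit_comp := hf.counit_comp, map_comp_comul := hf.comul_comp.symm }

theorem id : IsCoalgMap (LinearMap.id : A →ₗ[k] A) := of_coalgHom (CoalgHom.id k A)

theorem map {f : A →ₗ[k] B} {g : C →ₗ[k] D} (hf : IsCoalgMap f) (hg : IsCoalgMap g) :
    IsCoalgMap (TensorProduct.map f g) :=
  of_coalgHom (Coalgebra.TensorProduct.map hf.toCoalgHom hg.toCoalgHom)

theorem lTensor {g : C →ₗ[k] D} (hg : IsCoalgMap g) : IsCoalgMap (g.lTensor A) := id.map hg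

theorem rTensor {g : C →ₗ[k] D} (hg : IsCoalgMap g) : IsCoalgMap (g.rTensor A) := hg.map id

theorem symm {e : A ≃ₗ[k] B} (he : IsCoalgMap e.toLinearMap) : IsCoalgMap e.symm.toLinearMap where
  comul_comp := by
    have h := he.comul_comp
    ext x
    obtain ⟨y, rfl⟩ := e.surjective x
    have h1 := LinearMap.congr_fun h y
    have h2 : ∀ z : A ⊗[k] A, TensorProduct.map e.symm.toLinearMap e.symm.toLinearMap
        (TensorProduct.map e.toLinearMap e.toLinearMap z) = z := by
      intro z
      rw [← LinearMap.comp_apply, ← TensorProduct.map_comp]; simp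
    simp only [LinearMap.comp_apply, LinearEquiv.coe_coe] at h1 ⊢
    rw [h1, h2, LinearEquiv.symm_apply_apply]
  counit_comp := by
    ext x
    obtain ⟨y, rfl⟩ := e.surjective x
    simpa using (LinearMap.congr_fun he.counit_comp y).symm

theorem assoc : IsCoalgMap (TensorProduct.assoc k A B C).toLinearMap :=
  of_coalgHom (Coalgebra.TensorProduct.assoc k k A B C).toCoalgHom

theorem lid : IsCoalgMap (TensorProduct.lid k A).toLinearMap :=
  of_coalgHom (Coalgebra.TensorProduct.lid k A).toCoalgHom

theorem rid : IsCoalgMap (TensorProduct.rid k A).toLinearMap :=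
  of_coalgHom (Coalgebra.TensorProduct.rid k k A).toCoalgHom

theorem counit : IsCoalgMap (Coalgebra.counit : A →ₗ[k] k) where
  comul_comp := by
    ext u
    have h : ∑ i ∈ (ℛ k u).index, Coalgebra.counit (R := k) ((ℛ k u).left i) •
      Coalgebra.counit (R := k) ((ℛ k u).right i) = Coalgebra.counit (R := k) u := by
      simp only [← map_smul, ← map_sum, sum_counit_smul]
    simp only [LinearMap.comp_apply, CommSemiring.comul_apply]
    conv_rhs => rw [← (ℛ k u).eq]
    rw [← h]
    simp only [map_sum, TensorProduct.map_tmul, TensorProduct.tmul_sum]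
    refine Finset.sum_congr rfl fun i _ => ?_
    rw [TensorProduct.tmul_smul, TensorProduct.smul_tmul', smul_eq_mul, mul_one]
  counit_comp := by ext; simp

theorem mul {H : Type*} [Ring H] [Bialgebra k H] : IsCoalgMap (LinearMap.mul' k H) where
  comul_comp := by
    ext a b
    simp only [TensorProduct.AlgebraTensorModule.curry_apply, LinearMap.restrictScalars_self,
      TensorProduct.curry_apply, LinearMap.comp_apply, LinearMap.mul'_apply, Bialgebra.comul_mul,
      TensorProduct.comul_tmul]
    generalize Coalgebra.comul (R := k) a = z
    generalize Coalgebra.comul (R := k) b = w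
    induction z with
    | zero => simp
    | add _ _ h1 h2 => simp only [map_add, add_mul, h1, h2, TensorProduct.add_tmul]
    | tmul a1 a2 =>
      induction w with
      | zero => simp
      | add _ _ h1 h2 => simp only [map_add, mul_add, h1, h2, TensorProduct.tmul_add]
      | tmul b1 b2 => simp
  counit_comp := by ext; simp [mul_comm]

theorem comm : IsCoalgMap (TensorProduct.comm k A B).toLinearMap where
  comul_comp := by
    ext a b
    simp only [TensorProduct.AlgebraTensorModule.curry_apply, LinearMap.restrictScalars_self,
      TensorProduct.curry_apply, LinearMap.comp_apply, LinearEquiv.coe_coe,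
      TensorProduct.comm_tmul, TensorProduct.comul_tmul]
    generalize Coalgebra.comul (R := k) a = z
    generalize Coalgebra.comul (R := k) b = w
    induction z with
    | zero => simp
    | add _ _ h1 h2 => simp only [map_add, h1, h2, TensorProduct.add_tmul, TensorProduct.tmul_add]
    | tmul a1 a2 =>
      induction w with
      | zero => simp
      | add _ _ h1 h2 =>
        simp only [map_add, h1, h2, TensorProduct.add_tmul, TensorProduct.tmul_add]
      | tmul b1 b2 => simp
  counit_comp := by ext; simp [mul_comm]

theorem one_tmul {H : Type*} [Ring H] [Bialgebra k H] :
    IsCoalgMap (TensorProduct.mk k H A 1) where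
  comul_comp := by
    ext a
    simp only [LinearMap.comp_apply, TensorProduct.mk_apply, TensorProduct.comul_tmul,
      Bialgebra.comul_one, Algebra.TensorProduct.one_def]
    generalize Coalgebra.comul (R := k) a = z
    induction z with
    | zero => simp
    | add _ _ h1 h2 => simp only [map_add, h1, h2, TensorProduct.tmul_add]
    | tmul b1 b2 => simp
  counit_comp := by ext; simp

end IsCoalgMap

end CoalgMap

universe u v

variable {k : Type u} [Field k] {H : Type v} [Ring H] [HopfAlgebra k H]

/-! ### Slots of tensor powers and the diagonal homomorphism -/

section Basics

theorem ext_cons {M : Type*} [AddCommGroup M] [Module k M] {n : ℕ} {f g : T k H (n + 1) →ₗ[k] M}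
    (h : ∀ a x, f (cons k H n (a ⊗ₜ x)) = g (cons k H n (a ⊗ₜ x))) : f = g := by
  have : f ∘ₗ (cons k H n).toLinearMap = g ∘ₗ (cons k H n).toLinearMap :=
    TensorProduct.ext' h
  ext1
  ext w
  obtain ⟨z, hz⟩ := (cons k H n).surjective (PiTensorProduct.tprod k w)
  have := LinearMap.congr_fun this z
  simpa [hz] using this

theorem ext_snoc {M : Type*} [AddCommGroup M] [Module k M] {n : ℕ} {f g : T k H (n + 1) →ₗ[k] M}
    (h : ∀ x a, f (snoc k H n (x ⊗ₜ a)) = g (snoc k H n (x ⊗ₜ a))) : f = g := by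
  have : f ∘ₗ (snoc k H n).toLinearMap = g ∘ₗ (snoc k H n).toLinearMap :=
    TensorProduct.ext' h
  ext1
  ext w
  obtain ⟨z, hz⟩ := (snoc k H n).surjective (PiTensorProduct.tprod k w)
  have := LinearMap.congr_fun this z
  simpa [hz] using this

theorem ext_zero {M : Type*} [AddCommGroup M] [Module k M] {f g : T k H 0 →ₗ[k] M}
    (h : f 1 = g 1) : f = g := by
  ext w
  rw [Subsingleton.elim w 1]
  exact h

theorem cons_snoc {n : ℕ} (a : H) (x : T k H n) (b : H) :
    cons k H (n + 1) (a ⊗ₜ snoc k H n (x ⊗ₜ b)) = snoc k H (n + 1) (cons k H n (a ⊗ₜ x) ⊗ₜ b) := by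
  induction x using PiTensorProduct.induction_on with
  | smul_tprod r w =>
    simp only [TensorProduct.tmul_smul, ← TensorProduct.smul_tmul', map_smul, snoc_tprod_tmul,
      cons_tmul_tprod, Fin.cons_snoc_eq_snoc_cons]
  | add x y hx hy =>
    simp only [TensorProduct.add_tmul, TensorProduct.tmul_add, map_add, hx, hy]

theorem cons_mul_cons {n : ℕ} (a b : H) (x y : T k H n) :
    cons k H n (a ⊗ₜ x) * cons k H n (b ⊗ₜ y) = cons k H n ((a * b) ⊗ₜ (x * y)) := by
  induction x using PiTensorProduct.induction_on with
  | smul_tprod r w =>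
    induction y using PiTensorProduct.induction_on with
    | smul_tprod s z =>
      simp only [TensorProduct.tmul_smul, map_smul, smul_mul_assoc, mul_smul_comm,
        cons_tmul_tprod, PiTensorProduct.tprod_mul_tprod]
      congr 3
      funext i
      refine Fin.cases ?_ (fun j => ?_) i <;> simp
    | add x y hx hy => simp only [TensorProduct.tmul_add, map_add, mul_add, hx, hy]
  | add x y hx hy => simp only [TensorProduct.tmul_add, map_add, add_mul, hx, hy]

theorem snoc_mul_snoc {n : ℕ} (a b : H) (x y : T k H n) :
    snoc k H n (x ⊗ₜ a) * snoc k H n (y ⊗ₜ b) = snoc k H n ((x * y) ⊗ₜ (a * b)) := by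
  induction x using PiTensorProduct.induction_on with
  | smul_tprod r w =>
    induction y using PiTensorProduct.induction_on with
    | smul_tprod s z =>
      simp only [← TensorProduct.smul_tmul', map_smul, smul_mul_assoc, mul_smul_comm,
        snoc_tprod_tmul, PiTensorProduct.tprod_mul_tprod]
      congr 3
      funext i
      refine Fin.lastCases ?_ (fun j => ?_) i <;> simp
    | add x y hx hy => simp only [TensorProduct.add_tmul, map_add, mul_add, hx, hy]
  | add x y hx hy => simp only [TensorProduct.add_tmul, map_add, add_mul, hx, hy]

theorem cons_one_one (n : ℕ) : cons k H n (1 ⊗ₜ 1) = 1 := by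
  rw [PiTensorProduct.one_def, cons_tmul_tprod, PiTensorProduct.one_def]
  congr 1
  funext i
  refine Fin.cases ?_ (fun j => ?_) i <;> simp

theorem snoc_one_one (n : ℕ) : snoc k H n (1 ⊗ₜ 1) = 1 := by
  rw [PiTensorProduct.one_def, snoc_tprod_tmul, PiTensorProduct.one_def]
  congr 1
  funext i
  refine Fin.lastCases ?_ (fun j => ?_) i <;> simp

theorem cons_zero_eq_snoc (a : H) : cons k H 0 (a ⊗ₜ 1) = snoc k H 0 (1 ⊗ₜ a) := by
  rw [PiTensorProduct.one_def, cons_tmul_tprod, snoc_tprod_tmul]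
  congr 1
  funext i
  fin_cases i
  rfl

variable (k H) in
/-- Splitting off the first factor, as an isomorphism of algebras. -/
def consAlg (n : ℕ) : H ⊗[k] T k H n ≃ₐ[k] T k H (n + 1) :=
  AlgEquiv.ofLinearEquiv (cons k H n) (cons_one_one n) (by
    intro z w
    induction z with
    | zero => simp
    | add _ _ h1 h2 => simp only [map_add, add_mul, h1, h2]
    | tmul a x =>
      induction w with
      | zero => simp
      | add _ _ h1 h2 => simp only [map_add, mul_add, h1, h2]
      | tmul b y => simp only [Algebra.TensorProduct.tmul_mul_tmul, cons_mul_cons])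

variable (k H) in
/-- Splitting off the last factor, as an isomorphism of algebras. -/
def snocAlg (n : ℕ) : T k H n ⊗[k] H ≃ₐ[k] T k H (n + 1) :=
  AlgEquiv.ofLinearEquiv (snoc k H n) (snoc_one_one n) (by
    intro z w
    induction z with
    | zero => simp
    | add _ _ h1 h2 => simp only [map_add, add_mul, h1, h2]
    | tmul a x =>
      induction w with
      | zero => simp
      | add _ _ h1 h2 => simp only [map_add, mul_add, h1, h2]
      | tmul b y => simp only [Algebra.TensorProduct.tmul_mul_tmul, snoc_mul_snoc])

variable (k H) in
/-- `a ↦ a ⊗ 1 ⊗ ⋯ ⊗ 1`. -/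
def firstHom (n : ℕ) : H →ₐ[k] T k H (n + 1) :=
  (consAlg k H n).toAlgHom.comp Algebra.TensorProduct.includeLeft

variable (k H) in
/-- `a ↦ 1 ⊗ ⋯ ⊗ 1 ⊗ a`. -/
def lastHom (n : ℕ) : H →ₐ[k] T k H (n + 1) :=
  (snocAlg k H n).toAlgHom.comp Algebra.TensorProduct.includeRight

variable (k H) in
/-- `x ↦ 1 ⊗ x`. -/
def consOne (n : ℕ) : T k H n →ₐ[k] T k H (n + 1) :=
  (consAlg k H n).toAlgHom.comp Algebra.TensorProduct.includeRight

variable (k H) in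
/-- `x ↦ x ⊗ 1`. -/
def snocOne (n : ℕ) : T k H n →ₐ[k] T k H (n + 1) :=
  (snocAlg k H n).toAlgHom.comp Algebra.TensorProduct.includeLeft

theorem firstHom_apply (n : ℕ) (a : H) : firstHom k H n a = cons k H n (a ⊗ₜ 1) := rfl
theorem lastHom_apply (n : ℕ) (a : H) : lastHom k H n a = snoc k H n (1 ⊗ₜ a) := rfl
theorem consOne_apply (n : ℕ) (x : T k H n) : consOne k H n x = cons k H n (1 ⊗ₜ x) := rfl
theorem snocOne_apply (n : ℕ) (x : T k H n) : snocOne k H n x = snoc k H n (x ⊗ₜ 1) := rfl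

/-- Pure tensors become products of elements in commuting slots. This is what allows the rows to be
written as convolution products with values in the algebra `H^⊗q`. -/
theorem cons_eq_mul (n : ℕ) (a : H) (x : T k H n) :
    cons k H n (a ⊗ₜ x) = firstHom k H n a * consOne k H n x := by
  rw [firstHom_apply, consOne_apply, cons_mul_cons, mul_one, one_mul]

theorem snoc_eq_mul (n : ℕ) (x : T k H n) (a : H) :
    snoc k H n (x ⊗ₜ a) = snocOne k H n x * lastHom k H n a := by
  rw [snocOne_apply, lastHom_apply, snoc_mul_snoc, mul_one, one_mul]

theorem commute_firstHom_consOne (n : ℕ) (a : H) (x : T k H n) :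
    Commute (firstHom k H n a) (consOne k H n x) := by
  rw [Commute, SemiconjBy, firstHom_apply, consOne_apply, cons_mul_cons, cons_mul_cons]
  simp

theorem commute_snocOne_lastHom (n : ℕ) (x : T k H n) (a : H) :
    Commute (snocOne k H n x) (lastHom k H n a) := by
  rw [Commute, SemiconjBy, snocOne_apply, lastHom_apply, snoc_mul_snoc, snoc_mul_snoc]
  simp

theorem consOne_snocOne (n : ℕ) (x : T k H n) :
    consOne k H (n + 1) (snocOne k H n x) = snocOne k H (n + 1) (consOne k H n x) :=
  cons_snoc 1 x 1

theorem consOne_lastHom (n : ℕ) (a : H) :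
    consOne k H (n + 1) (lastHom k H n a) = lastHom k H (n + 1) a := by
  rw [lastHom_apply, consOne_apply, cons_snoc, cons_one_one, lastHom_apply]

theorem snocOne_firstHom (n : ℕ) (a : H) :
    snocOne k H (n + 1) (firstHom k H n a) = firstHom k H (n + 1) a := by
  rw [firstHom_apply, snocOne_apply, ← cons_snoc, snoc_one_one, firstHom_apply]

theorem firstHom_zero : firstHom k H 0 = lastHom k H 0 := AlgHom.ext cons_zero_eq_snoc

variable (k H) in
/-- The iterated coproduct as a homomorphism of algebras. -/
def diag : ∀ q : ℕ, H →ₐ[k] T k H q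
  | 0 => (Algebra.ofId k (T k H 0)).comp (Bialgebra.counitAlgHom k H)
  | q + 1 => (consAlg k H q).toAlgHom.comp
      ((Algebra.TensorProduct.map (AlgHom.id k H) (diag q)).comp (Bialgebra.comulAlgHom k H))

theorem toLinearMap_diag (q : ℕ) : (diag k H q).toLinearMap = iterComul k H q := by
  induction q with
  | zero =>
    ext h
    simp [diag, iterComul, Algebra.ofId_apply, Algebra.algebraMap_eq_smul_one]
  | succ q ih =>
    rw [iterComul, ← ih]
    rfl

theorem diag_succ (q : ℕ) : (diag k H (q + 1)).toLinearMap =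
    (firstHom k H q).toLinearMap ⧆ ((consOne k H q).toLinearMap ∘ₗ (diag k H q).toLinearMap) := by
  ext h
  rw [conv_apply (ℛ k h)]
  simp only [LinearMap.comp_apply, AlgHom.toLinearMap_apply, ← cons_eq_mul]
  rw [← AlgHom.toLinearMap_apply, toLinearMap_diag]
  simp only [iterComul, LinearMap.comp_apply, ← (ℛ k h).eq, map_sum, LinearMap.lTensor_tmul,
    LinearEquiv.coe_coe, ← toLinearMap_diag, AlgHom.toLinearMap_apply]

theorem diag_zero : (diag k H 0).toLinearMap = convUnit k H (T k H 0) := rfl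

/-- Coassociativity: the diagonal is built by splitting off the first slot, and induction moves the
splitting to the last slot, where the cyclic operators act. -/
theorem diag_succ' (q : ℕ) : (diag k H (q + 1)).toLinearMap =
    ((snocOne k H q).toLinearMap ∘ₗ (diag k H q).toLinearMap) ⧆ (lastHom k H q).toLinearMap := by
  induction q with
  | zero =>
    rw [diag_succ, diag_zero, comp_convUnit, comp_convUnit, conv_convUnit, convUnit_conv,
      firstHom_zero]
  | succ q ih =>
    rw [diag_succ, ih, comp_conv, ← conv_assoc]
    congr 1
    · rw [← ih, diag_succ, comp_conv]
      congr 1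
      · ext a; exact (snocOne_firstHom q a).symm
      · ext a; exact consOne_snocOne q _
    · ext a; exact consOne_lastHom q a

theorem diag_one : diag k H 1 = lastHom k H 0 := by
  apply AlgHom.toLinearMap_injective
  rw [diag_succ', diag_zero, comp_convUnit, convUnit_conv]

end Basics

end

end GerstenhaberSchack

open scoped TensorProduct
namespace GerstenhaberSchack

noncomputable section

open TensorProduct Coalgebra

universe u v

variable {k : Type u} [Field k] {H : Type v} [Ring H] [HopfAlgebra k H]

/-! ### The coalgebra structure of tensor powers -/

section TensorPowerCoalgebra

/-- Transport of structure along `e`, phrased for bare maps because the target has no coalgebra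
instance yet. It is the inductive step in proving the laws for `comulT`. -/
theorem coalgebra_laws_of_equiv {A N : Type*} [AddCommGroup A] [Module k A] [Coalgebra k A]
    [AddCommGroup N] [Module k N] (e : A ≃ₗ[k] N) {Δ : N →ₗ[k] N ⊗[k] N} {ε : N →ₗ[k] k}
    (hΔ : ∀ z, Δ (e z) = TensorProduct.map e.toLinearMap e.toLinearMap (comul z))
    (hε : ∀ z, ε (e z) = counit z) :
    (TensorProduct.assoc k _ _ _).toLinearMap ∘ₗ Δ.rTensor _ ∘ₗ Δ = Δ.lTensor _ ∘ₗ Δ ∧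
    ε.rTensor _ ∘ₗ Δ = TensorProduct.mk k k _ 1 ∧
    ε.lTensor _ ∘ₗ Δ = (TensorProduct.mk k _ k).flip 1 := by
  have hΔ' : Δ ∘ₗ e.toLinearMap = TensorProduct.map e.toLinearMap e.toLinearMap ∘ₗ comul :=
    LinearMap.ext hΔ
  have hε' : ε ∘ₗ e.toLinearMap = counit := LinearMap.ext hε
  refine ⟨LinearMap.ext fun w => ?_, LinearMap.ext fun w => ?_, LinearMap.ext fun w => ?_⟩ <;>
    obtain ⟨z, rfl⟩ := e.surjective w <;>
    simp only [LinearMap.comp_apply, hΔ]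
  · have h1 : Δ.rTensor N ∘ₗ TensorProduct.map e.toLinearMap e.toLinearMap =
        TensorProduct.map (TensorProduct.map e.toLinearMap e.toLinearMap) e.toLinearMap ∘ₗ
          (comul (R := k) (A := A)).rTensor A := by
      rw [LinearMap.rTensor, ← TensorProduct.map_comp, hΔ', LinearMap.rTensor,
        ← TensorProduct.map_comp]; rfl
    have h2 : Δ.lTensor N ∘ₗ TensorProduct.map e.toLinearMap e.toLinearMap =
        TensorProduct.map e.toLinearMap (TensorProduct.map e.toLinearMap e.toLinearMap) ∘ₗ
          (comul (R := k) (A := A)).lTensor A := by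
      rw [LinearMap.lTensor, ← TensorProduct.map_comp, hΔ', LinearMap.lTensor,
        ← TensorProduct.map_comp]; rfl
    have h3 : (TensorProduct.assoc k N N N).toLinearMap ∘ₗ
        TensorProduct.map (TensorProduct.map e.toLinearMap e.toLinearMap) e.toLinearMap =
        TensorProduct.map e.toLinearMap (TensorProduct.map e.toLinearMap e.toLinearMap) ∘ₗ
        (TensorProduct.assoc k A A A).toLinearMap := by ext; simp
    have h1' := LinearMap.congr_fun h1 (comul z)
    have h2' := LinearMap.congr_fun h2 (comul z)
    have h3' := LinearMap.congr_fun h3 ((comul (R := k) (A := A)).rTensor A (comul z))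
    simp only [LinearMap.comp_apply] at h1' h2' h3'
    rw [h1', h2', h3', LinearEquiv.coe_coe, coassoc_apply]
  · have h1 : ε.rTensor N ∘ₗ TensorProduct.map e.toLinearMap e.toLinearMap =
        e.toLinearMap.lTensor k ∘ₗ (counit (R := k) (A := A)).rTensor A := by
      rw [LinearMap.rTensor, ← TensorProduct.map_comp, hε', LinearMap.rTensor, LinearMap.lTensor,
        ← TensorProduct.map_comp]; rfl
    have h1' := LinearMap.congr_fun h1 (comul z)
    simp only [LinearMap.comp_apply] at h1'
    rw [h1', rTensor_counit_comul]; simp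
  · have h1 : ε.lTensor N ∘ₗ TensorProduct.map e.toLinearMap e.toLinearMap =
        e.toLinearMap.rTensor k ∘ₗ (counit (R := k) (A := A)).lTensor A := by
      rw [LinearMap.lTensor, ← TensorProduct.map_comp, hε', LinearMap.lTensor, LinearMap.rTensor,
        ← TensorProduct.map_comp]; rfl
    have h1' := LinearMap.congr_fun h1 (comul z)
    simp only [LinearMap.comp_apply] at h1'
    rw [h1', lTensor_counit_comul]; simp

theorem prod_cons (n : ℕ) (a : H) (x : T k H n) :
    prod k H (n + 1) (cons k H n (a ⊗ₜ x)) = a * prod k H n x := by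
  induction x using PiTensorProduct.induction_on with
  | smul_tprod r w =>
    simp only [TensorProduct.tmul_smul, map_smul, cons_tmul_tprod, mul_smul_comm]
    simp [prod]
  | add x y hx hy => simp only [TensorProduct.tmul_add, map_add, mul_add, hx, hy]

theorem prod_zero_one : prod k H 0 1 = 1 := by
  rw [PiTensorProduct.one_def]
  simp [prod]

theorem prod_snoc (n : ℕ) (x : T k H n) (a : H) :
    prod k H (n + 1) (snoc k H n (x ⊗ₜ a)) = prod k H n x * a := by
  induction n with
  | zero =>
    have : ((prod k H 1 ∘ₗ (snoc k H 0).toLinearMap) ∘ₗ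
        (TensorProduct.mk k (T k H 0) H).flip a) = LinearMap.mulRight k a ∘ₗ prod k H 0 := by
      apply ext_zero
      simp only [LinearMap.comp_apply, LinearMap.flip_apply, TensorProduct.mk_apply,
        LinearEquiv.coe_coe, LinearMap.mulRight_apply]
      rw [← cons_zero_eq_snoc, prod_cons, prod_zero_one, mul_one, one_mul]
    exact LinearMap.congr_fun this x
  | succ n ih =>
    have : ((prod k H (n + 2) ∘ₗ (snoc k H (n + 1)).toLinearMap) ∘ₗ
        (TensorProduct.mk k (T k H (n + 1)) H).flip a) =
        LinearMap.mulRight k a ∘ₗ prod k H (n + 1) := by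
      apply ext_cons
      intro b x
      simp only [LinearMap.comp_apply, LinearMap.flip_apply, TensorProduct.mk_apply,
        LinearEquiv.coe_coe, LinearMap.mulRight_apply]
      rw [← cons_snoc, prod_cons, ih, prod_cons, mul_assoc]
    exact LinearMap.congr_fun this x

/-- On `H^⊗0` the product is the convolution unit, so all factors `DP` disappear in degree `p = 0`.
-/
theorem prod_zero : prod k H 0 = Algebra.linearMap k H ∘ₗ counit ∘ₗ prod k H 0 := by
  apply ext_zero
  simp [prod_zero_one]

theorem comulT_cons (n : ℕ) (a : H) (x : T k H n) :
    comulT k H (n + 1) (cons k H n (a ⊗ₜ x)) =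
      TensorProduct.map (cons k H n).toLinearMap (cons k H n).toLinearMap
        (TensorProduct.tensorTensorTensorComm k H H (T k H n) (T k H n)
          (comul a ⊗ₜ comulT k H n x)) := by
  simp [comulT]

variable (k H) in
theorem comulT_laws (n : ℕ) :
    (TensorProduct.assoc k _ _ _).toLinearMap ∘ₗ (comulT k H n).rTensor _ ∘ₗ comulT k H n =
      (comulT k H n).lTensor _ ∘ₗ comulT k H n ∧
    (counit ∘ₗ prod k H n).rTensor _ ∘ₗ comulT k H n = TensorProduct.mk k k _ 1 ∧
    (counit ∘ₗ prod k H n).lTensor _ ∘ₗ comulT k H n = (TensorProduct.mk k _ k).flip 1 := by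
  induction n with
  | zero =>
    refine ⟨ext_zero ?_, ext_zero ?_, ext_zero ?_⟩ <;> simp [comulT, prod_zero_one]
  | succ n ih =>
    -- The induction hypothesis is packaged as a local instance, so that `H ⊗ H^⊗n` acquires the
    -- tensor product coalgebra structure to be transported along `cons`.
    let _ : Coalgebra k (T k H n) :=
      { comul := comulT k H n, counit := counit ∘ₗ prod k H n, coassoc := ih.1,
        rTensor_counit_comp_comul := ih.2.1, lTensor_counit_comp_comul := ih.2.2 }
    refine coalgebra_laws_of_equiv (cons k H n) (fun z => ?_) (fun z => ?_)
    · induction z with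
      | zero => simp
      | add _ _ h1 h2 => simp only [map_add, h1, h2]
      | tmul a x => rw [comulT_cons]; rfl
    · induction z with
      | zero => simp
      | add _ _ h1 h2 => simp only [map_add, h1, h2]
      | tmul a x =>
        rw [LinearMap.comp_apply, prod_cons, Bialgebra.counit_mul, mul_comm]
        rfl

/-- The tensor product coalgebra structure on `H ^ ⊗ n`. -/
instance coalgebraT (n : ℕ) : Coalgebra k (T k H n) where
  comul := comulT k H n
  counit := counit ∘ₗ prod k H n
  coassoc := (comulT_laws k H n).1
  rTensor_counit_comp_comul := (comulT_laws k H n).2.1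
  lTensor_counit_comp_comul := (comulT_laws k H n).2.2

theorem comul_eq_comulT (n : ℕ) : comul = comulT k H n := rfl

theorem counit_eq_counit_prod (n : ℕ) : counit = counit ∘ₗ prod k H n := rfl

theorem isCoalgMap_cons (n : ℕ) : IsCoalgMap (cons k H n).toLinearMap where
  comul_comp := by
    ext1
    ext1 a
    refine LinearMap.ext fun x => ?_
    exact comulT_cons n a x
  counit_comp := by
    ext1
    ext1 a
    refine LinearMap.ext fun x => ?_
    change counit (prod k H (n + 1) (cons k H n (a ⊗ₜ x))) = _
    rw [prod_cons, Bialgebra.counit_mul, mul_comm]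
    rfl

/-- Multiplication in a bialgebra is a coalgebra map, and `prod` iterates it. Thus the legs `u¹₍ᵣ₎ ⋯
uᵖ₍ᵣ₎` are the legs of the coproduct of one element of `H`. -/
theorem isCoalgMap_prod (n : ℕ) : IsCoalgMap (prod k H n) where
  comul_comp := by
    induction n with
    | zero =>
      apply ext_zero
      simp [comul_eq_comulT, comulT, prod_zero_one, Algebra.TensorProduct.one_def]
    | succ n ih =>
      have h : IsCoalgMap (prod k H n) := ⟨ih, rfl⟩
      have e : prod k H (n + 1) = LinearMap.mul' k H ∘ₗ (prod k H n).lTensor H ∘ₗ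
          (cons k H n).symm.toLinearMap := by
        apply ext_cons; intro a x; simp [prod_cons]
      rw [e]
      exact (IsCoalgMap.mul.comp (h.lTensor.comp (isCoalgMap_cons n).symm)).comul_comp
  counit_comp := rfl

theorem isCoalgMap_shift {a b : ℕ} {g : T k H a →ₗ[k] T k H b} (hg : IsCoalgMap g) :
    IsCoalgMap (shift g) :=
  (isCoalgMap_cons b).comp (hg.lTensor.comp (isCoalgMap_cons a).symm)

theorem isCoalgMap_mulAt (n i : ℕ) (hi : i < n) : IsCoalgMap (mulAt k H n i) := by
  induction n generalizing i with
  | zero => omega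
  | succ n ih =>
    cases i with
    | zero =>
      exact (isCoalgMap_cons n).comp (IsCoalgMap.mul.rTensor.comp (IsCoalgMap.assoc.symm.comp
        ((isCoalgMap_cons n).symm.lTensor.comp (isCoalgMap_cons (n + 1)).symm)))
    | succ i => exact isCoalgMap_shift (ih i (by omega))

theorem isCoalgMap_oneAt (n i : ℕ) (hi : i ≤ n) : IsCoalgMap (oneAt k H n i) := by
  induction n generalizing i with
  | zero =>
    obtain rfl : i = 0 := by omega
    exact (isCoalgMap_cons 0).comp IsCoalgMap.one_tmul
  | succ n ih =>
    cases i with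
    | zero => exact (isCoalgMap_cons (n + 1)).comp IsCoalgMap.one_tmul
    | succ i => exact isCoalgMap_shift (ih i (by omega))

/-- The coproduct was defined from the first factor; reassociation by `cons_snoc` shows that it
splits at the last factor just as well. -/
theorem isCoalgMap_snoc (n : ℕ) : IsCoalgMap (snoc k H n).toLinearMap := by
  induction n with
  | zero =>
    have e : (snoc k H 0).toLinearMap = (cons k H 0).toLinearMap ∘ₗ
      (TensorProduct.comm k (T k H 0) H).toLinearMap := by
      ext1
      apply ext_zero
      ext1 a
      exact (cons_zero_eq_snoc a).symm
    rw [e]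
    exact (isCoalgMap_cons 0).comp IsCoalgMap.comm
  | succ n ih =>
    have e : (snoc k H (n + 1)).toLinearMap = (cons k H (n + 1)).toLinearMap ∘ₗ
        (snoc k H n).toLinearMap.lTensor H ∘ₗ (TensorProduct.assoc k H (T k H n) H).toLinearMap ∘ₗ
        (cons k H n).symm.toLinearMap.rTensor H := by
      ext1
      apply ext_cons
      intro a x
      ext1 b
      simp [cons_snoc]
    rw [e]
    exact (isCoalgMap_cons _).comp (ih.lTensor.comp (IsCoalgMap.assoc.comp
      (isCoalgMap_cons n).symm.rTensor))

end TensorPowerCoalgebra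

end

end GerstenhaberSchack

open scoped TensorProduct
namespace GerstenhaberSchack

noncomputable section

open TensorProduct Coalgebra

universe u v

variable {k : Type u} [Field k] {H : Type v} [Ring H] [HopfAlgebra k H]

/-! ### Bar and cobar identities on tensor powers -/

section SimplicialOperators

@[elab_as_elim]
theorem cons_induction {n : ℕ} {p : T k H (n + 1) → Prop} (x : T k H (n + 1)) (zero : p 0)
    (add : ∀ x y, p x → p y → p (x + y)) (cons : ∀ a x, p (cons k H n (a ⊗ₜ x))) : p x := by
  obtain ⟨z, rfl⟩ := (GerstenhaberSchack.cons k H n).surjective x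
  induction z with
  | zero => simpa using zero
  | add z w h1 h2 => rw [map_add]; exact add _ _ h1 h2
  | tmul a x => exact cons a x

@[elab_as_elim]
theorem snoc_induction {n : ℕ} {p : T k H (n + 1) → Prop} (x : T k H (n + 1)) (zero : p 0)
    (add : ∀ x y, p x → p y → p (x + y)) (snoc : ∀ x a, p (snoc k H n (x ⊗ₜ a))) : p x := by
  obtain ⟨z, rfl⟩ := (GerstenhaberSchack.snoc k H n).surjective x
  induction z with
  | zero => simpa using zero
  | add z w h1 h2 => rw [map_add]; exact add _ _ h1 h2
  | tmul a x => exact snoc a x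

theorem shift_cons {a b : ℕ} (g : T k H a →ₗ[k] T k H b) (h : H) (x : T k H a) :
    shift g (cons k H a (h ⊗ₜ x)) = cons k H b (h ⊗ₜ g x) := by
  simp [shift]

theorem mulAt_zero_cons (n : ℕ) (a b : H) (x : T k H n) :
    mulAt k H (n + 1) 0 (cons k H (n + 1) (a ⊗ₜ cons k H n (b ⊗ₜ x))) =
      cons k H n ((a * b) ⊗ₜ x) := by
  simp [mulAt]

theorem mulAt_succ_cons (n i : ℕ) (a : H) (x : T k H (n + 1)) :
    mulAt k H (n + 1) (i + 1) (cons k H (n + 1) (a ⊗ₜ x)) = cons k H n (a ⊗ₜ mulAt k H n i x) :=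
  shift_cons _ _ _

theorem oneAt_zero (n : ℕ) (x : T k H n) : oneAt k H n 0 x = cons k H n (1 ⊗ₜ x) := by
  cases n <;> rfl

theorem oneAt_succ_cons (n i : ℕ) (a : H) (x : T k H n) :
    oneAt k H (n + 1) (i + 1) (cons k H n (a ⊗ₜ x)) = cons k H (n + 1) (a ⊗ₜ oneAt k H n i x) :=
  shift_cons _ _ _

/-- `a ↦ a ⊗ x`. -/
def consFlip {n : ℕ} (x : T k H n) : H →ₗ[k] T k H (n + 1) :=
  (cons k H n).toLinearMap ∘ₗ (TensorProduct.mk k H (T k H n)).flip x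

theorem consFlip_apply {n : ℕ} (x : T k H n) (a : H) : consFlip x a = cons k H n (a ⊗ₜ x) := rfl

theorem comulAt_zero_cons_eq (n : ℕ) (a : H) (x : T k H n) :
    comulAt k H (n + 1) 0 (cons k H n (a ⊗ₜ x)) =
      cons k H (n + 1) ((consFlip x).lTensor H (comul a)) := by
  simp only [comulAt, LinearMap.comp_apply, LinearEquiv.coe_coe, LinearEquiv.symm_apply_apply,
    LinearMap.rTensor_tmul]
  generalize comul (R := k) a = z
  induction z with
  | zero => rw [TensorProduct.zero_tmul, LinearEquiv.map_zero, LinearMap.map_zero,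
      LinearMap.map_zero, LinearEquiv.map_zero]
  | add _ _ h1 h2 => simp only [TensorProduct.add_tmul, map_add, h1, h2]
  | tmul a b => simp [consFlip_apply]

theorem comulAt_zero_cons (n : ℕ) {a : H} {ι : Type*} (r : Coalgebra.Repr k a ι) (x : T k H n) :
    comulAt k H (n + 1) 0 (cons k H n (a ⊗ₜ x)) =
      ∑ i ∈ r.index, cons k H (n + 1) (r.left i ⊗ₜ cons k H n (r.right i ⊗ₜ x)) := by
  simp [comulAt, ← r.eq, TensorProduct.sum_tmul]

theorem comulAt_succ_cons (n i : ℕ) (a : H) (x : T k H n) :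
    comulAt k H (n + 1) (i + 1) (cons k H n (a ⊗ₜ x)) = cons k H (n + 1) (a ⊗ₜ comulAt k H n i x) :=
  shift_cons _ _ _

theorem counitAt_zero_cons (n : ℕ) (a : H) (x : T k H n) :
    counitAt k H n 0 (cons k H n (a ⊗ₜ x)) = counit (R := k) a • x := by
  cases n <;> simp [counitAt]

theorem counitAt_succ_cons (n i : ℕ) (a : H) (x : T k H (n + 1)) :
    counitAt k H (n + 1) (i + 1) (cons k H (n + 1) (a ⊗ₜ x)) =
      cons k H n (a ⊗ₜ counitAt k H n i x) :=
  shift_cons _ _ _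

/-- This and the identities that follow go by induction on the number of slots. Operators acting
beyond the first slot reduce to the induction hypothesis; otherwise an axiom of algebras or
coalgebras is applied in the first slots. -/
theorem mulAt_comp_mulAt (n i j : ℕ) (hij : i ≤ j) (hj : j < n) :
    mulAt k H n i ∘ₗ mulAt k H (n + 1) (j + 1) = mulAt k H n j ∘ₗ mulAt k H (n + 1) i := by
  induction n generalizing i j with
  | zero => omega
  | succ n ih =>
    refine ext_cons fun a x => ?_
    simp only [LinearMap.comp_apply, mulAt_succ_cons]
    rcases i with _ | i
    · induction x using cons_induction with
      | zero => simp
      | add x y h1 h2 => simp only [TensorProduct.tmul_add, map_add, h1, h2]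
      | cons b x =>
        rcases j with _ | j
        · induction x using cons_induction with
          | zero => simp
          | add x y h1 h2 => simp only [TensorProduct.tmul_add, map_add, h1, h2]
          | cons c x => simp only [mulAt_zero_cons, mul_assoc]
        · simp only [mulAt_zero_cons, mulAt_succ_cons]
    · obtain ⟨j, rfl⟩ : ∃ j', j = j' + 1 := ⟨j - 1, by omega⟩
      have := LinearMap.congr_fun (ih i j (by omega) (by omega)) x
      simp only [LinearMap.comp_apply] at this
      simp only [mulAt_succ_cons, this]

theorem oneAt_comp_oneAt (n i j : ℕ) (hij : i ≤ j) (hj : j ≤ n) :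
    oneAt k H (n + 1) i ∘ₗ oneAt k H n j = oneAt k H (n + 1) (j + 1) ∘ₗ oneAt k H n i := by
  induction n generalizing i j with
  | zero =>
    obtain rfl : j = 0 := by omega
    obtain rfl : i = 0 := by omega
    ext1
    ext x
    simp [oneAt_zero, oneAt_succ_cons]
  | succ n ih =>
    rcases i with _ | i
    · refine LinearMap.ext fun x => ?_
      simp [oneAt_zero, oneAt_succ_cons]
    · obtain ⟨j, rfl⟩ : ∃ j', j = j' + 1 := ⟨j - 1, by omega⟩
      refine ext_cons fun a x => ?_
      have := LinearMap.congr_fun (ih i j (by omega) (by omega)) x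
      simp only [LinearMap.comp_apply] at this
      simp only [LinearMap.comp_apply, oneAt_succ_cons, this]

theorem mulAt_comp_oneAt_lt (n i j : ℕ) (hij : i < j) (hj : j ≤ n) :
    mulAt k H (n + 1) i ∘ₗ oneAt k H (n + 1) (j + 1) = oneAt k H n j ∘ₗ mulAt k H n i := by
  induction n generalizing i j with
  | zero => omega
  | succ n ih =>
    obtain ⟨j, rfl⟩ : ∃ j', j = j' + 1 := ⟨j - 1, by omega⟩
    refine ext_cons fun a x => ?_
    rcases i with _ | i
    · simp only [LinearMap.comp_apply, oneAt_succ_cons]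
      induction x using cons_induction with
      | zero => simp
      | add x y h1 h2 => simp only [TensorProduct.tmul_add, map_add, h1, h2]
      | cons b x => simp only [mulAt_zero_cons, oneAt_succ_cons]
    · have := LinearMap.congr_fun (ih i j (by omega) (by omega)) x
      simp only [LinearMap.comp_apply] at this
      simp only [LinearMap.comp_apply, oneAt_succ_cons, mulAt_succ_cons, this]

theorem mulAt_comp_oneAt_self (n j : ℕ) (hj : j ≤ n) :
    mulAt k H (n + 1) j ∘ₗ oneAt k H (n + 1) j = LinearMap.id := by
  induction n generalizing j with
  | zero =>
    obtain rfl : j = 0 := by omega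
    refine ext_cons fun a x => ?_
    simp [mulAt_zero_cons, oneAt_zero]
  | succ n ih =>
    refine ext_cons fun a x => ?_
    rcases j with _ | j
    · simp [mulAt_zero_cons, oneAt_zero]
    · have := LinearMap.congr_fun (ih j (by omega)) x
      simp only [LinearMap.comp_apply] at this
      simp only [LinearMap.comp_apply, oneAt_succ_cons, mulAt_succ_cons, this, LinearMap.id_apply]

theorem mulAt_comp_oneAt_succ (n j : ℕ) (hj : j ≤ n) :
    mulAt k H (n + 1) j ∘ₗ oneAt k H (n + 1) (j + 1) = LinearMap.id := by
  induction n generalizing j with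
  | zero =>
    obtain rfl : j = 0 := by omega
    refine ext_cons fun a x => ?_
    simp [mulAt_zero_cons, oneAt_zero, oneAt_succ_cons]
  | succ n ih =>
    refine ext_cons fun a x => ?_
    rcases j with _ | j
    · simp [mulAt_zero_cons, oneAt_zero, oneAt_succ_cons]
    · have := LinearMap.congr_fun (ih j (by omega)) x
      simp only [LinearMap.comp_apply] at this
      simp only [LinearMap.comp_apply, oneAt_succ_cons, mulAt_succ_cons, this, LinearMap.id_apply]

theorem mulAt_comp_oneAt_gt (n i j : ℕ) (hij : j ≤ i) (hi : i < n) :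
    mulAt k H (n + 1) (i + 1) ∘ₗ oneAt k H (n + 1) j = oneAt k H n j ∘ₗ mulAt k H n i := by
  induction n generalizing i j with
  | zero => omega
  | succ n ih =>
    rcases j with _ | j
    · refine LinearMap.ext fun x => ?_
      simp [oneAt_zero, mulAt_succ_cons]
    · obtain ⟨i, rfl⟩ : ∃ i', i = i' + 1 := ⟨i - 1, by omega⟩
      refine ext_cons fun a x => ?_
      have := LinearMap.congr_fun (ih i j (by omega) (by omega)) x
      simp only [LinearMap.comp_apply] at this
      simp only [LinearMap.comp_apply, oneAt_succ_cons, mulAt_succ_cons, this]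

theorem comulAt_comp_comulAt (n i j : ℕ) (hij : i ≤ j) (hj : j < n) :
    comulAt k H (n + 1) (j + 1) ∘ₗ comulAt k H n i =
      comulAt k H (n + 1) i ∘ₗ comulAt k H n j := by
  induction n generalizing i j with
  | zero => omega
  | succ n ih =>
    refine ext_cons fun a x => ?_
    simp only [LinearMap.comp_apply]
    rcases i with _ | i
    · rcases j with _ | j
      -- The only case where both coproducts hit the same factor. Both sides are put into one form,
      -- so that they differ by the two sides of coassociativity.
      · have h1 : ∀ z : H ⊗[k] H, comulAt k H (n + 2) (0 + 1)
            (cons k H (n + 1) ((consFlip x).lTensor H z)) = cons k H (n + 2)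
              (((cons k H (n + 1)).toLinearMap ∘ₗ (consFlip x).lTensor H).lTensor H
                ((comul (R := k) (A := H)).lTensor H z)) := by
          intro z
          induction z with
          | zero => simp
          | add _ _ h1 h2 => simp only [map_add, h1, h2]
          | tmul a b =>
            simp only [LinearMap.lTensor_tmul, comulAt_succ_cons, consFlip_apply,
              comulAt_zero_cons_eq, LinearMap.comp_apply, LinearEquiv.coe_coe]
        have h2 : ∀ z : H ⊗[k] H, comulAt k H (n + 2) 0
            (cons k H (n + 1) ((consFlip x).lTensor H z)) = cons k H (n + 2)
              (((cons k H (n + 1)).toLinearMap ∘ₗ (consFlip x).lTensor H).lTensor H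
                (TensorProduct.assoc k H H H ((comul (R := k) (A := H)).rTensor H z))) := by
          intro z
          induction z with
          | zero => simp
          | add _ _ h1 h2 => simp only [map_add, h1, h2]
          | tmul a b =>
            simp only [LinearMap.lTensor_tmul, comulAt_zero_cons_eq, LinearMap.rTensor_tmul]
            generalize comul (R := k) a = w
            induction w with
            | zero => simp
            | add _ _ h1 h2 => simp only [map_add, TensorProduct.add_tmul, h1, h2]
            | tmul a c => simp [consFlip_apply]
        rw [comulAt_zero_cons_eq, h1, h2, coassoc_apply]
      · rw [comulAt_zero_cons n (ℛ k a), comulAt_succ_cons, comulAt_zero_cons (n + 1) (ℛ k a)]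
        simp only [map_sum, comulAt_succ_cons]
    · obtain ⟨j, rfl⟩ : ∃ j', j = j' + 1 := ⟨j - 1, by omega⟩
      have := LinearMap.congr_fun (ih i j (by omega) (by omega)) x
      simp only [LinearMap.comp_apply] at this
      simp only [comulAt_succ_cons, this]

theorem counitAt_comp_counitAt (n i j : ℕ) (hij : i ≤ j) (hj : j ≤ n) :
    counitAt k H n j ∘ₗ counitAt k H (n + 1) i =
      counitAt k H n i ∘ₗ counitAt k H (n + 1) (j + 1) := by
  induction n generalizing i j with
  | zero =>
    obtain rfl : j = 0 := by omega
    obtain rfl : i = 0 := by omega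
    refine ext_cons fun a x => ?_
    simp [counitAt_zero_cons, counitAt_succ_cons]
  | succ n ih =>
    refine ext_cons fun a x => ?_
    rcases i with _ | i
    · simp [counitAt_zero_cons, counitAt_succ_cons]
    · obtain ⟨j, rfl⟩ : ∃ j', j = j' + 1 := ⟨j - 1, by omega⟩
      have := LinearMap.congr_fun (ih i j (by omega) (by omega)) x
      simp only [LinearMap.comp_apply] at this
      simp only [LinearMap.comp_apply, counitAt_succ_cons, this]

theorem counitAt_comp_comulAt_lt (n i j : ℕ) (hij : i < j) (hj : j ≤ n) :
    counitAt k H (n + 1) (j + 1) ∘ₗ comulAt k H (n + 1) i =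
      comulAt k H n i ∘ₗ counitAt k H n j := by
  induction n generalizing i j with
  | zero => omega
  | succ n ih =>
    obtain ⟨j, rfl⟩ : ∃ j', j = j' + 1 := ⟨j - 1, by omega⟩
    refine ext_cons fun a x => ?_
    rcases i with _ | i
    · simp only [LinearMap.comp_apply, counitAt_succ_cons]
      rw [comulAt_zero_cons _ (ℛ k a), comulAt_zero_cons _ (ℛ k a)]
      simp only [map_sum, counitAt_succ_cons]
    · have := LinearMap.congr_fun (ih i j (by omega) (by omega)) x
      simp only [LinearMap.comp_apply] at this
      simp only [LinearMap.comp_apply, counitAt_succ_cons, comulAt_succ_cons, this]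

theorem counitAt_zero_comulAt_zero_cons (n : ℕ) (a : H) (x : T k H n) :
    counitAt k H (n + 1) 0 (comulAt k H (n + 1) 0 (cons k H n (a ⊗ₜ x))) = cons k H n (a ⊗ₜ x) := by
  rw [comulAt_zero_cons _ (ℛ k a), map_sum]
  simp only [counitAt_zero_cons]
  simp only [← consFlip_apply, ← map_smul, ← map_sum, sum_counit_smul]

theorem counitAt_comp_comulAt_self (n j : ℕ) (hj : j ≤ n) :
    counitAt k H (n + 1) j ∘ₗ comulAt k H (n + 1) j = LinearMap.id := by
  induction n generalizing j with
  | zero =>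
    obtain rfl : j = 0 := by omega
    refine ext_cons fun a x => ?_
    exact counitAt_zero_comulAt_zero_cons _ _ _
  | succ n ih =>
    refine ext_cons fun a x => ?_
    rcases j with _ | j
    · exact counitAt_zero_comulAt_zero_cons _ _ _
    · have := LinearMap.congr_fun (ih j (by omega)) x
      simp only [LinearMap.comp_apply] at this
      simp only [LinearMap.comp_apply, counitAt_succ_cons, comulAt_succ_cons, this,
        LinearMap.id_apply]

theorem counitAt_one_comulAt_zero_cons (n : ℕ) (a : H) (x : T k H n) :
    counitAt k H (n + 1) 1 (comulAt k H (n + 1) 0 (cons k H n (a ⊗ₜ x))) = cons k H n (a ⊗ₜ x) := by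
  rw [comulAt_zero_cons _ (ℛ k a), map_sum]
  have h (b : H) (y : T k H (n + 1)) : counitAt k H (n + 1) 1 (cons k H (n + 1) (b ⊗ₜ y)) =
      cons k H n (b ⊗ₜ counitAt k H n 0 y) := counitAt_succ_cons n 0 b y
  simp only [h, counitAt_zero_cons, TensorProduct.tmul_smul, map_smul]
  simp only [← consFlip_apply, ← map_smul, ← map_sum, sum_smul_counit]

theorem counitAt_comp_comulAt_succ (n j : ℕ) (hj : j ≤ n) :
    counitAt k H (n + 1) (j + 1) ∘ₗ comulAt k H (n + 1) j = LinearMap.id := by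
  induction n generalizing j with
  | zero =>
    obtain rfl : j = 0 := by omega
    exact ext_cons fun a x => counitAt_one_comulAt_zero_cons _ _ _
  | succ n ih =>
    refine ext_cons fun a x => ?_
    rcases j with _ | j
    · exact counitAt_one_comulAt_zero_cons _ _ _
    · have := LinearMap.congr_fun (ih j (by omega)) x
      simp only [LinearMap.comp_apply] at this
      simp only [LinearMap.comp_apply, counitAt_succ_cons, comulAt_succ_cons, this,
        LinearMap.id_apply]

theorem counitAt_comp_comulAt_gt (n i j : ℕ) (hij : j ≤ i) (hi : i < n) :
    counitAt k H (n + 1) j ∘ₗ comulAt k H (n + 1) (i + 1) =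
      comulAt k H n i ∘ₗ counitAt k H n j := by
  induction n generalizing i j with
  | zero => omega
  | succ n ih =>
    refine ext_cons fun a x => ?_
    rcases j with _ | j
    · simp [counitAt_zero_cons, comulAt_succ_cons]
    · obtain ⟨i, rfl⟩ : ∃ i', i = i' + 1 := ⟨i - 1, by omega⟩
      have := LinearMap.congr_fun (ih i j (by omega) (by omega)) x
      simp only [LinearMap.comp_apply] at this
      simp only [LinearMap.comp_apply, counitAt_succ_cons, comulAt_succ_cons, this]

end SimplicialOperators

end

end GerstenhaberSchack

open scoped TensorProduct
namespace GerstenhaberSchack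

noncomputable section

open TensorProduct Coalgebra HopfAlgebra

universe u v

variable {k : Type u} [Field k] {H : Type v} [Ring H] [HopfAlgebra k H]

/-! ### Inner operators as algebra homomorphisms -/

section AlgebraOperators

/-- The counit and the coproduct of `H` are multiplicative, hence so are the slotwise operators.
Composition with them therefore distributes over both convolution products. -/
theorem counitAt_mul (n j : ℕ) (hj : j ≤ n) (x y : T k H (n + 1)) :
    counitAt k H n j (x * y) = counitAt k H n j x * counitAt k H n j y := by
  induction n generalizing j with
  | zero =>
    obtain rfl : j = 0 := by omega
    induction x using cons_induction with
    | zero => simp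
    | add _ _ h1 h2 => simp only [add_mul, map_add, h1, h2]
    | cons a x =>
      induction y using cons_induction with
      | zero => simp
      | add _ _ h1 h2 => simp only [mul_add, map_add, h1, h2]
      | cons b y =>
        simp only [cons_mul_cons, counitAt_zero_cons, Bialgebra.counit_mul, smul_mul_smul_comm]
  | succ n ih =>
    induction x using cons_induction with
    | zero => simp
    | add _ _ h1 h2 => simp only [add_mul, map_add, h1, h2]
    | cons a x =>
      induction y using cons_induction with
      | zero => simp
      | add _ _ h1 h2 => simp only [mul_add, map_add, h1, h2]
      | cons b y =>
        rcases j with _ | j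
        · simp only [cons_mul_cons, counitAt_zero_cons, Bialgebra.counit_mul, smul_mul_smul_comm]
        · simp only [cons_mul_cons, counitAt_succ_cons, ih j (by omega)]

theorem counitAt_one (n j : ℕ) (hj : j ≤ n) : counitAt k H n j 1 = 1 := by
  induction n generalizing j with
  | zero =>
    obtain rfl : j = 0 := by omega
    rw [← cons_one_one, counitAt_zero_cons, Bialgebra.counit_one, one_smul]
  | succ n ih =>
    rw [← cons_one_one]
    rcases j with _ | j
    · rw [counitAt_zero_cons, Bialgebra.counit_one, one_smul]
    · rw [counitAt_succ_cons, ih j (by omega), cons_one_one]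

theorem consFlip_lTensor_mul (n : ℕ) (x y : T k H n) (z w : H ⊗[k] H) :
    cons k H (n + 1) ((consFlip (x * y)).lTensor H (z * w)) =
      cons k H (n + 1) ((consFlip x).lTensor H z) * cons k H (n + 1) ((consFlip y).lTensor H w) := by
  induction z with
  | zero => simp
  | add _ _ h1 h2 => simp only [add_mul, map_add, h1, h2]
  | tmul a b =>
    induction w with
    | zero => simp
    | add _ _ h1 h2 => simp only [mul_add, map_add, h1, h2]
    | tmul c d =>
      simp only [Algebra.TensorProduct.tmul_mul_tmul, LinearMap.lTensor_tmul, consFlip_apply,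
        cons_mul_cons]

theorem comulAt_mul (n i : ℕ) (hi : i < n) (x y : T k H n) :
    comulAt k H n i (x * y) = comulAt k H n i x * comulAt k H n i y := by
  induction n generalizing i with
  | zero => omega
  | succ n ih =>
    induction x using cons_induction with
    | zero => simp
    | add _ _ h1 h2 => simp only [add_mul, map_add, h1, h2]
    | cons a x =>
      induction y using cons_induction with
      | zero => simp
      | add _ _ h1 h2 => simp only [mul_add, map_add, h1, h2]
      | cons b y =>
        rcases i with _ | i
        · rw [cons_mul_cons, comulAt_zero_cons_eq, comulAt_zero_cons_eq, comulAt_zero_cons_eq,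
            Bialgebra.comul_mul, consFlip_lTensor_mul]
        · simp only [cons_mul_cons, comulAt_succ_cons, ih i (by omega)]

theorem comulAt_one (n i : ℕ) (hi : i < n) : comulAt k H n i 1 = 1 := by
  induction n generalizing i with
  | zero => omega
  | succ n ih =>
    rw [← cons_one_one]
    rcases i with _ | i
    · rw [comulAt_zero_cons_eq, Bialgebra.comul_one, Algebra.TensorProduct.one_def,
        LinearMap.lTensor_tmul, consFlip_apply, cons_one_one, cons_one_one]
    · rw [comulAt_succ_cons, ih i (by omega), cons_one_one]

variable (k H) in
/-- `comulAt` as a homomorphism of algebras. -/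
def comulAtHom (n i : ℕ) (hi : i < n) : T k H n →ₐ[k] T k H (n + 1) :=
  AlgHom.ofLinearMap (comulAt k H n i) (comulAt_one n i hi) (comulAt_mul n i hi)

variable (k H) in
/-- `counitAt` as a homomorphism of algebras. -/
def counitAtHom (n j : ℕ) (hj : j ≤ n) : T k H (n + 1) →ₐ[k] T k H n :=
  AlgHom.ofLinearMap (counitAt k H n j) (counitAt_one n j hj) (counitAt_mul n j hj)

theorem toLinearMap_comulAtHom (n i : ℕ) (hi : i < n) :
    (comulAtHom k H n i hi).toLinearMap = comulAt k H n i := rfl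

theorem toLinearMap_counitAtHom (n j : ℕ) (hj : j ≤ n) :
    (counitAtHom k H n j hj).toLinearMap = counitAt k H n j := rfl

section Comp

variable {A : Type*} [AddCommGroup A] [Module k A] [Coalgebra k A]

theorem comulAt_comp_conv {n i : ℕ} (hi : i < n) (f g : A →ₗ[k] T k H n) :
    comulAt k H n i ∘ₗ (f ⧆ g) = (comulAt k H n i ∘ₗ f) ⧆ (comulAt k H n i ∘ₗ g) :=
  comp_conv (comulAtHom k H n i hi) f g

theorem counitAt_comp_conv {n j : ℕ} (hj : j ≤ n) (f g : A →ₗ[k] T k H (n + 1)) :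
    counitAt k H n j ∘ₗ (f ⧆ g) = (counitAt k H n j ∘ₗ f) ⧆ (counitAt k H n j ∘ₗ g) :=
  comp_conv (counitAtHom k H n j hj) f g

theorem counitAt_comp_opConv {n j : ℕ} (hj : j ≤ n) (f g : A →ₗ[k] T k H (n + 1)) :
    counitAt k H n j ∘ₗ (f ⧇ g) = (counitAt k H n j ∘ₗ f) ⧇ (counitAt k H n j ∘ₗ g) :=
  comp_opConv (counitAtHom k H n j hj) f g

end Comp

theorem counitAt_snoc (n j : ℕ) (hj : j ≤ n) (x : T k H (n + 1)) (b : H) :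
    counitAt k H (n + 1) j (snoc k H (n + 1) (x ⊗ₜ b)) = snoc k H n (counitAt k H n j x ⊗ₜ b) := by
  induction n generalizing j with
  | zero =>
    obtain rfl : j = 0 := by omega
    induction x using cons_induction with
    | zero => simp
    | add _ _ h1 h2 => simp only [TensorProduct.add_tmul, map_add, h1, h2]
    | cons a x =>
      rw [← cons_snoc, counitAt_zero_cons, counitAt_zero_cons, ← TensorProduct.smul_tmul', map_smul]
  | succ n ih =>
    induction x using cons_induction with
    | zero => simp
    | add _ _ h1 h2 => simp only [TensorProduct.add_tmul, map_add, h1, h2]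
    | cons a x =>
      rcases j with _ | j
      · rw [← cons_snoc, counitAt_zero_cons, counitAt_zero_cons, ← TensorProduct.smul_tmul',
          map_smul]
      · rw [← cons_snoc, counitAt_succ_cons, counitAt_succ_cons, ih j (by omega), cons_snoc]

theorem counitAt_last_snoc (n : ℕ) (x : T k H n) (b : H) :
    counitAt k H n n (snoc k H n (x ⊗ₜ b)) = counit (R := k) b • x := by
  induction n with
  | zero =>
    have : (counitAt k H 0 0 ∘ₗ (snoc k H 0).toLinearMap) ∘ₗ
        (TensorProduct.mk k (T k H 0) H).flip b = counit (R := k) b • LinearMap.id := by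
      apply ext_zero
      simp only [LinearMap.comp_apply, LinearMap.flip_apply, TensorProduct.mk_apply,
        LinearEquiv.coe_coe]
      rw [← cons_zero_eq_snoc, counitAt_zero_cons]
      rfl
    exact LinearMap.congr_fun this x
  | succ n ih =>
    induction x using cons_induction with
    | zero => simp
    | add _ _ h1 h2 => simp only [TensorProduct.add_tmul, map_add, h1, h2, smul_add]
    | cons a x =>
      rw [← cons_snoc, counitAt_succ_cons, ih, TensorProduct.tmul_smul, map_smul]

theorem comulAt_snoc (n i : ℕ) (hi : i < n) (x : T k H n) (b : H) :
    comulAt k H (n + 1) i (snoc k H n (x ⊗ₜ b)) = snoc k H (n + 1) (comulAt k H n i x ⊗ₜ b) := by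
  induction n generalizing i with
  | zero => omega
  | succ n ih =>
    induction x using cons_induction with
    | zero => simp
    | add _ _ h1 h2 => simp only [TensorProduct.add_tmul, map_add, h1, h2]
    | cons a x =>
      rcases i with _ | i
      · rw [← cons_snoc, comulAt_zero_cons _ (ℛ k a), comulAt_zero_cons _ (ℛ k a)]
        simp only [TensorProduct.sum_tmul, map_sum, cons_snoc]
      · rw [← cons_snoc, comulAt_succ_cons, comulAt_succ_cons, ih i (by omega), cons_snoc]

theorem comulAt_last_snoc (n : ℕ) (x : T k H n) {b : H} {ι : Type*} (r : Coalgebra.Repr k b ι) :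
    comulAt k H (n + 1) n (snoc k H n (x ⊗ₜ b)) =
      ∑ i ∈ r.index, snoc k H (n + 1) (snoc k H n (x ⊗ₜ r.left i) ⊗ₜ r.right i) := by
  induction n with
  | zero =>
    have h := fun (c : H) => cons_zero_eq_snoc (k := k) c
    obtain ⟨c, rfl⟩ : ∃ c : k, x = c • 1 := by
      refine ⟨(PiTensorProduct.isEmptyEquiv (Fin 0)) x, ?_⟩
      apply (PiTensorProduct.isEmptyEquiv (R := k) (s := fun _ => H) (Fin 0)).injective
      rw [map_smul, PiTensorProduct.one_def, PiTensorProduct.isEmptyEquiv_apply_tprod, smul_eq_mul,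
        mul_one]
    simp only [← TensorProduct.smul_tmul', map_smul, ← h, ← cons_snoc]
    rw [comulAt_zero_cons _ r, Finset.smul_sum]
  | succ n ih =>
    induction x using cons_induction with
    | zero => simp
    | add _ _ h1 h2 => simp only [TensorProduct.add_tmul, map_add, h1, h2, Finset.sum_add_distrib]
    | cons a x =>
      rw [← cons_snoc, comulAt_succ_cons, ih]
      simp only [TensorProduct.tmul_sum, map_sum, cons_snoc]

theorem comulAt_snocOne (n i : ℕ) (hi : i < n) (x : T k H n) :
    comulAt k H (n + 1) i (snocOne k H n x) = snocOne k H (n + 1) (comulAt k H n i x) :=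
  comulAt_snoc n i hi x 1

theorem comulAt_lastHom (n i : ℕ) (hi : i < n) (h : H) :
    comulAt k H (n + 1) i (lastHom k H n h) = lastHom k H (n + 1) h := by
  rw [lastHom_apply, comulAt_snoc n i hi, comulAt_one n i hi, lastHom_apply]

theorem comulAt_last_lastHom (n : ℕ) :
    comulAt k H (n + 1) n ∘ₗ (lastHom k H n).toLinearMap =
      ((snocOne k H (n + 1)).toLinearMap ∘ₗ (lastHom k H n).toLinearMap) ⧆
        (lastHom k H (n + 1)).toLinearMap := by
  ext h
  rw [conv_apply (ℛ k h), LinearMap.comp_apply, AlgHom.toLinearMap_apply, lastHom_apply,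
    comulAt_last_snoc _ _ (ℛ k h)]
  refine Finset.sum_congr rfl fun i _ => ?_
  rw [snoc_eq_mul]; rfl

theorem comulAt_last_snocOne (n : ℕ) (x : T k H n) :
    comulAt k H (n + 1) n (snocOne k H n x) = snocOne k H (n + 1) (snocOne k H n x) := by
  let r : Coalgebra.Repr k (1 : H) (Fin 1) :=
    { index := Finset.univ, left := fun _ => 1, right := fun _ => 1, eq := by simp [Algebra.TensorProduct.one_def] }
  rw [snocOne_apply, comulAt_last_snoc _ _ r]
  simp [r, snocOne_apply]

theorem comulAt_succ_consOne (n i : ℕ) (x : T k H n) :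
    comulAt k H (n + 1) (i + 1) (consOne k H n x) = consOne k H (n + 1) (comulAt k H n i x) :=
  comulAt_succ_cons n i 1 x

theorem comulAt_zero_consOne (n : ℕ) (x : T k H n) :
    comulAt k H (n + 1) 0 (consOne k H n x) = consOne k H (n + 1) (consOne k H n x) := by
  rw [consOne_apply, comulAt_zero_cons_eq, Bialgebra.comul_one, Algebra.TensorProduct.one_def,
    LinearMap.lTensor_tmul, consFlip_apply]
  rfl

theorem comulAt_zero_firstHom (n : ℕ) :
    comulAt k H (n + 1) 0 ∘ₗ (firstHom k H n).toLinearMap =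
      (firstHom k H (n + 1)).toLinearMap ⧆
        ((consOne k H (n + 1)).toLinearMap ∘ₗ (firstHom k H n).toLinearMap) := by
  ext h
  rw [conv_apply (ℛ k h), LinearMap.comp_apply, AlgHom.toLinearMap_apply, firstHom_apply,
    comulAt_zero_cons _ (ℛ k h)]
  refine Finset.sum_congr rfl fun i _ => ?_
  rw [cons_eq_mul]; rfl

theorem comulAt_succ_firstHom (n i : ℕ) (hi : i < n) (h : H) :
    comulAt k H (n + 1) (i + 1) (firstHom k H n h) = firstHom k H (n + 1) h := by
  rw [firstHom_apply, comulAt_succ_cons, comulAt_one n i hi, firstHom_apply]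

/-- By coassociativity it does not matter which slot of an iterated coproduct is split further.
Consequently inner cofaces intertwine the diagonal actions; the counit axiom does the same for
codegeneracies in `counitAt_comp_diag`. -/
theorem comulAt_comp_diag (n i : ℕ) (hi : i < n) :
    comulAt k H n i ∘ₗ (diag k H n).toLinearMap = (diag k H (n + 1)).toLinearMap := by
  induction n generalizing i with
  | zero => omega
  | succ n ih =>
    rw [diag_succ n, comulAt_comp_conv hi]
    rcases i with _ | i
    · rw [comulAt_zero_firstHom, conv_assoc, diag_succ (n + 1), diag_succ n, comp_conv]
      congr 2
      ext h
      exact comulAt_zero_consOne n _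
    · rw [diag_succ (n + 1), ← ih i (by omega)]
      congr 1
      · ext h; exact comulAt_succ_firstHom n i (by omega) h
      · ext h; exact comulAt_succ_consOne n i _

theorem counitAt_zero_consOne (n : ℕ) (x : T k H n) :
    counitAt k H n 0 (consOne k H n x) = x := by
  rw [consOne_apply, counitAt_zero_cons, Bialgebra.counit_one, one_smul]

theorem counitAt_last_snocOne (n : ℕ) (x : T k H n) :
    counitAt k H n n (snocOne k H n x) = x := by
  rw [snocOne_apply, counitAt_last_snoc, Bialgebra.counit_one, one_smul]

theorem counitAt_last_lastHom (n : ℕ) :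
    counitAt k H n n ∘ₗ (lastHom k H n).toLinearMap = convUnit k H (T k H n) := by
  ext h
  simp only [LinearMap.comp_apply, AlgHom.toLinearMap_apply]
  rw [lastHom_apply, counitAt_last_snoc, convUnit_apply, Algebra.algebraMap_eq_smul_one]

theorem counitAt_lastHom (n j : ℕ) (hj : j ≤ n) (h : H) :
    counitAt k H (n + 1) j (lastHom k H (n + 1) h) = lastHom k H n h := by
  rw [lastHom_apply, counitAt_snoc n j hj, counitAt_one n j hj, lastHom_apply]

theorem counitAt_snocOne (n j : ℕ) (hj : j ≤ n) (x : T k H (n + 1)) :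
    counitAt k H (n + 1) j (snocOne k H (n + 1) x) = snocOne k H n (counitAt k H n j x) :=
  counitAt_snoc n j hj x 1

theorem counitAt_comp_diag (n j : ℕ) (hj : j ≤ n) :
    counitAt k H n j ∘ₗ (diag k H (n + 1)).toLinearMap = (diag k H n).toLinearMap := by
  induction n generalizing j with
  | zero =>
    obtain rfl : j = 0 := by omega
    rw [diag_one, counitAt_last_lastHom, diag_zero]
  | succ n ih =>
    rcases j with _ | j
    · rw [diag_succ (n + 1), counitAt_comp_conv hj]
      have h1 : counitAt k H (n + 1) 0 ∘ₗ (firstHom k H (n + 1)).toLinearMap = convUnit k H _ := by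
        ext h
        simp only [LinearMap.comp_apply, AlgHom.toLinearMap_apply]
        rw [firstHom_apply, counitAt_zero_cons, convUnit_apply, Algebra.algebraMap_eq_smul_one]
      have h2 : counitAt k H (n + 1) 0 ∘ₗ (consOne k H (n + 1)).toLinearMap ∘ₗ
          (diag k H (n + 1)).toLinearMap = (diag k H (n + 1)).toLinearMap := by
        ext h; exact counitAt_zero_consOne (n + 1) (diag k H (n + 1) h)
      rw [h1, h2, convUnit_conv]
    · rw [diag_succ (n + 1), counitAt_comp_conv hj]
      conv_rhs => rw [diag_succ n, ← ih j (by omega)]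
      congr 1
      · ext h
        simp only [LinearMap.comp_apply, AlgHom.toLinearMap_apply]
        rw [firstHom_apply, counitAt_succ_cons, counitAt_one n j (by omega), firstHom_apply]
      · ext h
        exact counitAt_succ_cons n j 1 (diag k H (n + 1) h)

end AlgebraOperators

end

end GerstenhaberSchack

open scoped TensorProduct
namespace GerstenhaberSchack

noncomputable section

open TensorProduct Coalgebra HopfAlgebra

universe u v

variable {k : Type u} [Field k] {H : Type v} [Ring H] [HopfAlgebra k H]

/-! ### The Connes-Moscovici operator and its period -/

section Rotation

variable (k H) in
/-- `a ⊗ x ↦ S(a) ▹ x`. -/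
def contract (q : ℕ) : T k H (q + 1) →ₗ[k] T k H q :=
  leftAct k H q ∘ₗ (antipode k (A := H)).rTensor (T k H q) ∘ₗ (cons k H q).symm.toLinearMap

theorem leftAct_tmul (q : ℕ) (h : H) (x : T k H q) :
    leftAct k H q (h ⊗ₜ x) = diag k H q h * x := by
  rw [leftAct, ← toLinearMap_diag]; rfl

theorem rightAct_tmul (q : ℕ) (x : T k H q) (h : H) :
    rightAct k H q (x ⊗ₜ h) = x * diag k H q h := by
  rw [rightAct, ← toLinearMap_diag]; rfl

theorem contract_cons (q : ℕ) (a : H) (x : T k H q) :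
    contract k H q (cons k H q (a ⊗ₜ x)) = diag k H q (antipode k a) * x := by
  simp [contract, leftAct_tmul]

theorem contract_mul_consOne (q : ℕ) (y : T k H (q + 1)) (x : T k H q) :
    contract k H q (y * consOne k H q x) = contract k H q y * x := by
  induction y using cons_induction with
  | zero => simp
  | add _ _ h1 h2 => simp only [add_mul, map_add, h1, h2]
  | cons a y => rw [consOne_apply, cons_mul_cons, contract_cons, contract_cons, mul_one, mul_assoc]

theorem contract_mul_firstHom (q : ℕ) (y : T k H (q + 1)) (h : H) :
    contract k H q (y * firstHom k H q h) = diag k H q (antipode k h) * contract k H q y := by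
  induction y using cons_induction with
  | zero => simp
  | add _ _ h1 h2 => simp only [add_mul, map_add, mul_add, h1, h2]
  | cons a y =>
    rw [firstHom_apply, cons_mul_cons, contract_cons, contract_cons, mul_one,
      antipode_mul_antidistrib, map_mul, mul_assoc]

/-- The first slot contributes `S(h₁ a) = S(a) S(h₁)` and the others `h₂`, and `S(h₁) h₂` cancels.
So `contract` does not see the left diagonal action. -/
theorem contract_diag_mul (q : ℕ) (h : H) (y : T k H (q + 1)) :
    contract k H q (diag k H (q + 1) h * y) = counit (R := k) h • contract k H q y := by
  induction y using cons_induction with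
  | zero => simp
  | add _ _ h1 h2 => simp only [map_add, mul_add, smul_add, h1, h2]
  | cons a y =>
    have h1 := LinearMap.congr_fun (diag_succ (k := k) (H := H) q) h
    have h2 := LinearMap.congr_fun (antipode_conv_algHom (diag k H q)) h
    rw [conv_apply (ℛ k h)] at h1 h2
    simp only [AlgHom.toLinearMap_apply, LinearMap.comp_apply] at h1 h2
    have h3 : ∀ b c : H, contract k H q (firstHom k H q b * consOne k H q (diag k H q c) *
        cons k H q (a ⊗ₜ y)) = diag k H q (antipode k a) *
          (diag k H q (antipode k b) * diag k H q c) * y := by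
      intro b c
      rw [← cons_eq_mul, cons_mul_cons, contract_cons, antipode_mul_antidistrib, map_mul]
      simp only [mul_assoc]
    rw [h1, Finset.sum_mul, map_sum]
    simp only [h3]
    rw [← Finset.sum_mul, ← Finset.mul_sum, h2, convUnit_apply, contract_cons, ← Algebra.commutes,
      mul_assoc, ← Algebra.smul_def]

theorem contract_conv_diag_mul (q : ℕ) (α : H →ₗ[k] T k H (q + 1)) (h : H) (y : T k H (q + 1)) :
    contract k H q (((diag k H (q + 1)).toLinearMap ⧆ α) h * y) = contract k H q (α h * y) := by
  rw [conv_apply (ℛ k h), Finset.sum_mul, map_sum]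
  have h1 : ∀ a b : H, contract k H q ((diag k H (q + 1)).toLinearMap a * α b * y) =
      contract k H q (α (counit (R := k) a • b) * y) := by
    intro a b
    rw [AlgHom.toLinearMap_apply, mul_assoc, contract_diag_mul, map_smul, smul_mul_assoc, map_smul]
  simp only [h1]
  rw [← map_sum, ← Finset.sum_mul, ← map_sum, sum_counit_smul]

theorem contract_consOne (q : ℕ) (x : T k H q) : contract k H q (consOne k H q x) = x := by
  rw [consOne_apply, contract_cons, antipode_one, map_one, one_mul]

variable (k H) in
/-- The Connes-Moscovici operator
`x¹ ⊗ ⋯ ⊗ x^{m+1} ↦ S(x¹) ▹ (x² ⊗ ⋯ ⊗ x^{m+1} ⊗ 1)`. -/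
def cmRotate (m : ℕ) : T k H (m + 1) →ₗ[k] T k H (m + 1) :=
  contract k H (m + 1) ∘ₗ (snocOne k H (m + 1)).toLinearMap

theorem cmRotate_apply (m : ℕ) (x : T k H (m + 1)) :
    cmRotate k H m x = contract k H (m + 1) (snocOne k H (m + 1) x) := rfl

theorem cmRotate_mul_consOne (m : ℕ) (x : T k H (m + 1)) (y : T k H m) :
    cmRotate k H m (x * consOne k H m y) = cmRotate k H m x * snocOne k H m y := by
  rw [cmRotate_apply, map_mul, ← consOne_snocOne, contract_mul_consOne, cmRotate_apply]

theorem cmRotate_mul_firstHom (m : ℕ) (x : T k H (m + 1)) (h : H) :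
    cmRotate k H m (x * firstHom k H m h) =
      diag k H (m + 1) (antipode k h) * cmRotate k H m x := by
  rw [cmRotate_apply, map_mul, snocOne_firstHom, contract_mul_firstHom, cmRotate_apply]

theorem snocOne_diag (m : ℕ) : (snocOne k H m).toLinearMap ∘ₗ (diag k H m).toLinearMap =
    (diag k H (m + 1)).toLinearMap ⧆ ((lastHom k H m).toLinearMap ∘ₗ antipode k) := by
  rw [diag_succ', conv_assoc, algHom_conv_antipode, conv_convUnit]

/-- On `m + 1` slots, acting by `h` is acting by `h₁` on all `m + 2` slots and correcting by `S(h₂)`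
in the last one (`snocOne_diag`). The diagonal part is invisible to `contract`; the correction
commutes with `x ⊗ 1` and comes out on the right. -/
theorem cmRotate_diag_mul (m : ℕ) (h : H) (x : T k H (m + 1)) :
    cmRotate k H m (diag k H (m + 1) h * x) =
      cmRotate k H m x * lastHom k H m (antipode k h) := by
  have h1 := LinearMap.congr_fun (snocOne_diag (k := k) (H := H) (m + 1)) h
  simp only [LinearMap.comp_apply, AlgHom.toLinearMap_apply] at h1
  rw [cmRotate_apply, map_mul, h1, contract_conv_diag_mul]
  simp only [LinearMap.comp_apply, AlgHom.toLinearMap_apply]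
  rw [← (commute_snocOne_lastHom (m + 1) x _).eq, ← consOne_lastHom, contract_mul_consOne]
  rfl

theorem cmRotate_consOne (m : ℕ) (x : T k H m) :
    cmRotate k H m (consOne k H m x) = snocOne k H m x := by
  rw [cmRotate_apply, ← consOne_snocOne, consOne_apply, contract_cons, antipode_one, map_one,
    one_mul]

theorem cmRotate_zero_snocOne (x : T k H 0) : cmRotate k H 0 (snocOne k H 0 x) = snocOne k H 0 x := by
  have : (cmRotate k H 0 ∘ₗ (snocOne k H 0).toLinearMap) = (snocOne k H 0).toLinearMap := by
    apply ext_zero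
    simp only [LinearMap.comp_apply, AlgHom.toLinearMap_apply]
    rw [cmRotate_apply, map_one, map_one, ← map_one (consOne k H 1), contract_consOne]
  exact LinearMap.congr_fun this x

variable (k H) in
/-- `a ⊗ x ↦ x ⊗ a`. -/
def rotate (n : ℕ) : T k H (n + 1) →ₗ[k] T k H (n + 1) :=
  (snoc k H n).toLinearMap ∘ₗ (TensorProduct.comm k H (T k H n)).toLinearMap ∘ₗ
    (cons k H n).symm.toLinearMap

theorem rotate_cons (n : ℕ) (a : H) (x : T k H n) :
    rotate k H n (cons k H n (a ⊗ₜ x)) = snoc k H n (x ⊗ₜ a) := by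
  simp [rotate]

theorem rotate_tprod (n : ℕ) (w : Fin (n + 1) → H) :
    rotate k H n (PiTensorProduct.tprod k w) = PiTensorProduct.tprod k (fun i => w (i + 1)) := by
  have : PiTensorProduct.tprod k w = cons k H n (w 0 ⊗ₜ PiTensorProduct.tprod k (Fin.tail w)) := by
    rw [cons_tmul_tprod, Fin.cons_self_tail]
  rw [this, rotate_cons, snoc_tprod_tmul]
  congr 1
  funext i
  refine Fin.lastCases ?_ (fun j => ?_) i
  · simp
  · simp [Fin.tail]

theorem rotate_pow_tprod (n i : ℕ) (w : Fin (n + 1) → H) :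
    (rotate k H n ^ i) (PiTensorProduct.tprod k w) =
      PiTensorProduct.tprod k (fun j => w (j + i • (1 : Fin (n + 1)))) := by
  induction i with
  | zero => simp
  | succ i ih =>
    rw [pow_succ', Module.End.mul_apply, ih, rotate_tprod]
    congr 1
    funext j
    rw [succ_nsmul, add_right_comm, ← add_assoc]

theorem rotate_pow (n : ℕ) : rotate k H n ^ (n + 1) = 1 := by
  refine PiTensorProduct.ext (MultilinearMap.ext fun w => ?_)
  have : (n + 1) • (1 : Fin (n + 1)) = 0 := by
    simpa using card_nsmul_eq_zero (x := (1 : Fin (n + 1)))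
  rw [LinearMap.compMultilinearMap_apply, LinearMap.compMultilinearMap_apply, rotate_pow_tprod,
    this]
  simp only [add_zero, Module.End.one_apply]

/-- The operator on `m + 1` slots is the rotation of `m + 2` slots seen through `contract`: the
leading `S(a)` reappears in the last slot as `S²(a) = a`. -/
theorem cmRotate_contract (hS : ∀ x : H, antipode k (antipode k x) = x) (m : ℕ)
    (y : T k H (m + 2)) :
    cmRotate k H m (contract k H (m + 1) y) = contract k H (m + 1) (rotate k H (m + 1) y) := by
  induction y using cons_induction with
  | zero => simp
  | add _ _ h1 h2 => simp only [map_add, h1, h2]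
  | cons a x =>
    rw [contract_cons, cmRotate_diag_mul, hS, rotate_cons, snoc_eq_mul, ← consOne_lastHom,
      contract_mul_consOne, cmRotate_apply]

theorem cmRotate_pow_contract (hS : ∀ x : H, antipode k (antipode k x) = x) (m i : ℕ)
    (y : T k H (m + 2)) : (cmRotate k H m ^ i) (contract k H (m + 1) y) =
      contract k H (m + 1) ((rotate k H (m + 1) ^ i) y) := by
  induction i with
  | zero => rfl
  | succ i ih =>
    rw [pow_succ', Module.End.mul_apply, ih, cmRotate_contract hS, pow_succ', Module.End.mul_apply]

/-- `contract` is surjective, with section `consOne`, so the period `m + 2` of the rotation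
descends. -/
theorem cmRotate_pow (hS : ∀ x : H, antipode k (antipode k x) = x) (m : ℕ) :
    cmRotate k H m ^ (m + 2) = 1 := by
  refine LinearMap.ext fun x => ?_
  rw [← contract_consOne (m + 1) x, cmRotate_pow_contract hS, rotate_pow]
  rfl

theorem contract_comulAt_succ (q i : ℕ) (hi : i < q) (y : T k H (q + 1)) :
    contract k H (q + 1) (comulAt k H (q + 1) (i + 1) y) =
      comulAt k H q i (contract k H q y) := by
  induction y using cons_induction with
  | zero => simp
  | add _ _ h1 h2 => simp only [map_add, h1, h2]
  | cons a x =>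
    have := LinearMap.congr_fun (comulAt_comp_diag (k := k) (H := H) q i hi) (antipode k a)
    simp only [LinearMap.comp_apply, AlgHom.toLinearMap_apply] at this
    rw [comulAt_succ_cons, contract_cons, contract_cons, comulAt_mul q i hi, this]

/-- Since `S` reverses the coproduct, the first slot of `D(S h₁)` carries the leg of `h₁` adjacent
to `h₂`, and the two cancel there. -/
theorem antipode_diag_conv_firstHom (q : ℕ) :
    ((diag k H (q + 1)).toLinearMap ∘ₗ antipode k) ⧆ (firstHom k H q).toLinearMap =
      (consOne k H q).toLinearMap ∘ₗ (diag k H q).toLinearMap ∘ₗ antipode k := by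
  rw [diag_succ, conv_comp_antipode, opConv_eq_conv_of_commute, conv_assoc, antipode_conv_algHom,
    conv_convUnit, LinearMap.comp_assoc]
  intro u v
  exact commute_firstHom_consOne q _ _

theorem contract_comulAt_zero (q : ℕ) (y : T k H (q + 1)) :
    contract k H (q + 1) (comulAt k H (q + 1) 0 y) = consOne k H q (contract k H q y) := by
  induction y using cons_induction with
  | zero => simp
  | add _ _ h1 h2 => simp only [map_add, h1, h2]
  | cons a x =>
    have h1 := LinearMap.congr_fun (antipode_diag_conv_firstHom (k := k) (H := H) q) a
    rw [conv_apply (ℛ k a)] at h1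
    simp only [LinearMap.comp_apply, AlgHom.toLinearMap_apply] at h1
    rw [comulAt_zero_cons _ (ℛ k a), map_sum]
    simp only [contract_cons]
    simp only [cons_eq_mul, ← mul_assoc]
    rw [← Finset.sum_mul, h1, map_mul]

theorem contract_counitAt_succ (q i : ℕ) (hi : i ≤ q) (y : T k H (q + 2)) :
    contract k H q (counitAt k H (q + 1) (i + 1) y) =
      counitAt k H q i (contract k H (q + 1) y) := by
  induction y using cons_induction with
  | zero => simp
  | add _ _ h1 h2 => simp only [map_add, h1, h2]
  | cons a x =>
    have := LinearMap.congr_fun (counitAt_comp_diag (k := k) (H := H) q i hi) (antipode k a)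
    simp only [LinearMap.comp_apply, AlgHom.toLinearMap_apply] at this
    rw [counitAt_succ_cons, contract_cons, contract_cons, counitAt_mul q i hi, this]

/-- From here on the cyclic relations for `cmRotate` are read off `contract` applied to `x ⊗ 1`.
Operators beyond the first slot pass through with index lowered by one; a coproduct in the first
slot leaves a `1` there. -/
theorem cmRotate_comulAt_zero (m : ℕ) (x : T k H (m + 1)) :
    cmRotate k H (m + 1) (comulAt k H (m + 1) 0 x) = consOne k H (m + 1) (cmRotate k H m x) := by
  rw [cmRotate_apply, ← comulAt_snocOne _ _ (by omega), contract_comulAt_zero, cmRotate_apply]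

theorem cmRotate_comulAt_succ (m i : ℕ) (hi : i < m) (x : T k H (m + 1)) :
    cmRotate k H (m + 1) (comulAt k H (m + 1) (i + 1) x) =
      comulAt k H (m + 1) i (cmRotate k H m x) := by
  rw [cmRotate_apply, ← comulAt_snocOne _ _ (by omega), contract_comulAt_succ _ _ (by omega),
    cmRotate_apply]

theorem cmRotate_snocOne (m : ℕ) (x : T k H (m + 1)) :
    cmRotate k H (m + 1) (snocOne k H (m + 1) x) =
      comulAt k H (m + 1) m (cmRotate k H m x) := by
  rw [cmRotate_apply, ← comulAt_last_snocOne, contract_comulAt_succ _ _ (by omega),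
    cmRotate_apply]

theorem cmRotate_counitAt_succ (m i : ℕ) (hi : i ≤ m) (x : T k H (m + 2)) :
    cmRotate k H m (counitAt k H (m + 1) (i + 1) x) =
      counitAt k H (m + 1) i (cmRotate k H (m + 1) x) := by
  rw [cmRotate_apply, ← counitAt_snocOne _ _ (by omega), contract_counitAt_succ _ _ (by omega),
    cmRotate_apply]

theorem counitAt_last_rotate (m : ℕ) (y : T k H (m + 1)) :
    counitAt k H m m (rotate k H m y) = counitAt k H m 0 y := by
  induction y using cons_induction with
  | zero => simp
  | add _ _ h1 h2 => simp only [map_add, h1, h2]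
  | cons a x => rw [rotate_cons, counitAt_last_snoc, counitAt_zero_cons]

theorem cmRotate_counitAt_zero (hS : ∀ x : H, antipode k (antipode k x) = x) (m : ℕ)
    (x : T k H (m + 2)) :
    cmRotate k H m (counitAt k H (m + 1) 0 x) =
      counitAt k H (m + 1) (m + 1) (cmRotate k H (m + 1) (cmRotate k H (m + 1) x)) := by
  conv_rhs => rw [cmRotate_apply (m + 1) x, cmRotate_contract hS]
  rw [← contract_counitAt_succ _ _ le_rfl, counitAt_last_rotate, counitAt_snocOne _ _ (by omega),
    cmRotate_apply]

theorem counitAt_cmRotate_zero (x : T k H 1) :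
    counitAt k H 0 0 (cmRotate k H 0 x) = counitAt k H 0 0 x := by
  induction x using cons_induction with
  | zero => simp
  | add _ _ h1 h2 => simp only [map_add, h1, h2]
  | cons a x =>
    rw [cmRotate_apply, snocOne_apply, ← cons_snoc, contract_cons, counitAt_mul _ _ le_rfl]
    have := LinearMap.congr_fun (counitAt_comp_diag (k := k) (H := H) 0 0 le_rfl) (antipode k a)
    simp only [LinearMap.comp_apply, AlgHom.toLinearMap_apply] at this
    rw [this, counitAt_last_snoc, counitAt_zero_cons, Bialgebra.counit_one, one_smul,
      ← AlgHom.toLinearMap_apply, diag_zero, convUnit_apply, counit_antipode, ← Algebra.smul_def]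

end Rotation

end

end GerstenhaberSchack

open scoped TensorProduct
namespace GerstenhaberSchack
noncomputable section
open TensorProduct Coalgebra HopfAlgebra
universe u v
variable {k : Type u} [Field k] {H : Type v} [Ring H] [HopfAlgebra k H]

/-! ### Rows: cofaces and cyclic operator over a coalgebra map to `H` -/

section Rows

variable {A : Type*} [AddCommGroup A] [Module k A]

theorem lastHom_comp_succ (m : ℕ) (π : A →ₗ[k] H) : (lastHom k H (m + 1)).toLinearMap ∘ₗ π =
    (consOne k H (m + 1)).toLinearMap ∘ₗ ((lastHom k H m).toLinearMap ∘ₗ π) := by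
  ext u; simp [consOne_lastHom]

theorem firstHom_comp_succ (m : ℕ) (π : A →ₗ[k] H) : (firstHom k H (m + 1)).toLinearMap ∘ₗ π =
    (snocOne k H (m + 1)).toLinearMap ∘ₗ ((firstHom k H m).toLinearMap ∘ₗ π) := by
  ext u; simp [snocOne_firstHom]

theorem comulAt_diag_comp (n i : ℕ) (hi : i < n) (P : A →ₗ[k] H) :
    comulAt k H n i ∘ₗ ((diag k H n).toLinearMap ∘ₗ P) = (diag k H (n + 1)).toLinearMap ∘ₗ P := by
  rw [← LinearMap.comp_assoc, comulAt_comp_diag _ _ hi]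

theorem counitAt_diag_comp (P : A →ₗ[k] H) (n j : ℕ) (hj : j ≤ n) :
    counitAt k H n j ∘ₗ ((diag k H (n + 1)).toLinearMap ∘ₗ P) = (diag k H n).toLinearMap ∘ₗ P := by
  rw [← LinearMap.comp_assoc, counitAt_comp_diag _ _ hj]

variable [Coalgebra k A]

/-- The operator `R` moves a factor to the other side of the value of `f`, while the legs `u₁`, `u₂`
stay with their maps. Hence `⧆` turns into `⧇`, and conversely in the variants below. -/
theorem cmRotate_comp_diag_conv (m : ℕ) (π : A →ₗ[k] H) (f : A →ₗ[k] T k H (m + 1)) :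
    cmRotate k H m ∘ₗ (((diag k H (m + 1)).toLinearMap ∘ₗ π) ⧆ f) =
      (cmRotate k H m ∘ₗ f) ⧇ ((lastHom k H m).toLinearMap ∘ₗ (antipode k ∘ₗ π)) := by
  ext u
  simp [conv_apply (ℛ k u), opConv_apply (ℛ k u), cmRotate_diag_mul]

theorem cmRotate_comp_conv_firstHom (m : ℕ) (f : A →ₗ[k] T k H (m + 1)) (π : A →ₗ[k] H) :
    cmRotate k H m ∘ₗ (f ⧆ ((firstHom k H m).toLinearMap ∘ₗ π)) =
      ((diag k H (m + 1)).toLinearMap ∘ₗ (antipode k ∘ₗ π)) ⧇ (cmRotate k H m ∘ₗ f) := by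
  ext u
  simp [conv_apply (ℛ k u), opConv_apply (ℛ k u), cmRotate_mul_firstHom]

theorem cmRotate_comp_opConv_firstHom (m : ℕ) (f : A →ₗ[k] T k H (m + 1)) (π : A →ₗ[k] H) :
    cmRotate k H m ∘ₗ (f ⧇ ((firstHom k H m).toLinearMap ∘ₗ π)) =
      ((diag k H (m + 1)).toLinearMap ∘ₗ (antipode k ∘ₗ π)) ⧆ (cmRotate k H m ∘ₗ f) := by
  ext u
  simp [conv_apply (ℛ k u), opConv_apply (ℛ k u), cmRotate_mul_firstHom]

theorem cmRotate_comp_conv_consOne (m : ℕ) (f : A →ₗ[k] T k H (m + 1)) (α : A →ₗ[k] T k H m) :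
    cmRotate k H m ∘ₗ (f ⧆ ((consOne k H m).toLinearMap ∘ₗ α)) =
      (cmRotate k H m ∘ₗ f) ⧆ ((snocOne k H m).toLinearMap ∘ₗ α) := by
  ext u
  simp [conv_apply (ℛ k u), cmRotate_mul_consOne]

theorem cmRotate_comp_opConv_consOne (m : ℕ) (f : A →ₗ[k] T k H (m + 1)) (α : A →ₗ[k] T k H m) :
    cmRotate k H m ∘ₗ (f ⧇ ((consOne k H m).toLinearMap ∘ₗ α)) =
      (cmRotate k H m ∘ₗ f) ⧇ ((snocOne k H m).toLinearMap ∘ₗ α) := by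
  ext u
  simp [opConv_apply (ℛ k u), cmRotate_mul_consOne]

theorem diag_antipode_conv (q : ℕ) {P : A →ₗ[k] H} (hP : IsCoalgMap P) :
    ((diag k H q).toLinearMap ∘ₗ (antipode k ∘ₗ P)) ⧆ ((diag k H q).toLinearMap ∘ₗ P) =
      convUnit k A (T k H q) := by
  rw [← LinearMap.comp_assoc, ← hP.conv_comp, antipode_conv_algHom, hP.convUnit_comp]

theorem diag_conv_antipode (q : ℕ) {P : A →ₗ[k] H} (hP : IsCoalgMap P) :
    ((diag k H q).toLinearMap ∘ₗ P) ⧆ ((diag k H q).toLinearMap ∘ₗ (antipode k ∘ₗ P)) =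
      convUnit k A (T k H q) := by
  rw [← LinearMap.comp_assoc, ← hP.conv_comp, algHom_conv_antipode, hP.convUnit_comp]

theorem diag_opConv_antipode (hS : ∀ x : H, antipode k (antipode k x) = x) (q : ℕ)
    {P : A →ₗ[k] H} (hP : IsCoalgMap P) :
    ((diag k H q).toLinearMap ∘ₗ P) ⧇ ((diag k H q).toLinearMap ∘ₗ (antipode k ∘ₗ P)) =
      convUnit k A (T k H q) := by
  rw [← LinearMap.comp_assoc, ← hP.opConv_comp, algHom_opConv_antipode hS, hP.convUnit_comp]

theorem diag_antipode_opConv (hS : ∀ x : H, antipode k (antipode k x) = x) (q : ℕ)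
    {P : A →ₗ[k] H} (hP : IsCoalgMap P) :
    ((diag k H q).toLinearMap ∘ₗ (antipode k ∘ₗ P)) ⧇ ((diag k H q).toLinearMap ∘ₗ P) =
      convUnit k A (T k H q) := by
  rw [← LinearMap.comp_assoc, ← hP.opConv_comp, antipode_opConv_algHom hS, hP.convUnit_comp]

theorem diag_succ_comp (q : ℕ) {P : A →ₗ[k] H} (hP : IsCoalgMap P) :
    (diag k H (q + 1)).toLinearMap ∘ₗ P = ((firstHom k H q).toLinearMap ∘ₗ P) ⧆
      ((consOne k H q).toLinearMap ∘ₗ ((diag k H q).toLinearMap ∘ₗ P)) := by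
  rw [diag_succ, hP.conv_comp]; rfl

theorem diag_succ_comp' (q : ℕ) {P : A →ₗ[k] H} (hP : IsCoalgMap P) :
    (diag k H (q + 1)).toLinearMap ∘ₗ P =
      ((snocOne k H q).toLinearMap ∘ₗ ((diag k H q).toLinearMap ∘ₗ P)) ⧆
        ((lastHom k H q).toLinearMap ∘ₗ P) := by
  rw [diag_succ', hP.conv_comp]; rfl

theorem diag_succ_comp_antipode' (q : ℕ) {P : A →ₗ[k] H} (hP : IsCoalgMap P) :
    (diag k H (q + 1)).toLinearMap ∘ₗ (antipode k ∘ₗ P) =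
      ((snocOne k H q).toLinearMap ∘ₗ ((diag k H q).toLinearMap ∘ₗ (antipode k ∘ₗ P))) ⧇
        ((lastHom k H q).toLinearMap ∘ₗ (antipode k ∘ₗ P)) := by
  rw [diag_succ', ← LinearMap.comp_assoc, conv_comp_antipode, hP.opConv_comp]; rfl

/-- The coface of index `0` of a map `f : A → H ^ ⊗ q`, given `P : A → H`. -/
def coactFirst (P : A →ₗ[k] H) {q : ℕ} (f : A →ₗ[k] T k H q) : A →ₗ[k] T k H (q + 1) :=
  ((firstHom k H q).toLinearMap ∘ₗ P) ⧆ ((consOne k H q).toLinearMap ∘ₗ f)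

/-- The coface of index `q + 1` of a map `f : A → H ^ ⊗ q`, given `P : A → H`. -/
def coactLast (P : A →ₗ[k] H) {q : ℕ} (f : A →ₗ[k] T k H q) : A →ₗ[k] T k H (q + 1) :=
  ((snocOne k H q).toLinearMap ∘ₗ f) ⧆ ((lastHom k H q).toLinearMap ∘ₗ P)

/-- The cofaces of a map `f : A → H ^ ⊗ q`, given `P : A → H`. -/
def rowCoface (P : A →ₗ[k] H) {q : ℕ} (i : ℕ) (f : A →ₗ[k] T k H q) : A →ₗ[k] T k H (q + 1) :=
  if i = 0 then coactFirst P f else if i = q + 1 then coactLast P f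
  else comulAt k H q (i - 1) ∘ₗ f

/-- The cyclic operator on maps `A → H ^ ⊗ q`, given `P : A → H`. -/
def rowCyc (P : A →ₗ[k] H) : ∀ {q : ℕ}, (A →ₗ[k] T k H q) → (A →ₗ[k] T k H q)
  | 0, f => f
  | m + 1, f => ((diag k H (m + 1)).toLinearMap ∘ₗ P) ⧆
      ((cmRotate k H m ∘ₗ f) ⧆ ((lastHom k H m).toLinearMap ∘ₗ P))

theorem rowCoface_zero (P : A →ₗ[k] H) {q : ℕ} (f : A →ₗ[k] T k H q) :
    rowCoface P 0 f = coactFirst P f := if_pos rfl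

theorem rowCoface_last (P : A →ₗ[k] H) {q : ℕ} (f : A →ₗ[k] T k H q) :
    rowCoface P (q + 1) f = coactLast P f := by simp [rowCoface]

theorem rowCoface_inner (P : A →ₗ[k] H) {q i : ℕ} (hi : i < q) (f : A →ₗ[k] T k H q) :
    rowCoface P (i + 1) f = comulAt k H q i ∘ₗ f := by simp [rowCoface, hi.ne]

theorem rowCyc_succ (P : A →ₗ[k] H) {m : ℕ} (f : A →ₗ[k] T k H (m + 1)) :
    rowCyc P f = ((diag k H (m + 1)).toLinearMap ∘ₗ P) ⧆
      ((cmRotate k H m ∘ₗ f) ⧆ ((lastHom k H m).toLinearMap ∘ₗ P)) := rfl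

/-- The first-slot factor commutes with the rest and may be written on the right with `⧇`. Then `R`
brings it to the front as `DSP`, where it cancels the `DP` of the cyclic operator. -/
theorem rowCyc_coactFirst {P : A →ₗ[k] H} (hP : IsCoalgMap P) {q : ℕ} (f : A →ₗ[k] T k H q) :
    rowCyc P (coactFirst P f) = coactLast P f := by
  have h : coactFirst P f = ((consOne k H q).toLinearMap ∘ₗ f) ⧇
      ((firstHom k H q).toLinearMap ∘ₗ P) := by
    rw [coactFirst, opConv_eq_conv_of_commute]
    exact fun u v => (commute_firstHom_consOne q (P v) (f u)).symm
  rw [rowCyc_succ, h, cmRotate_comp_opConv_firstHom,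
    conv_assoc, ← conv_assoc, diag_conv_antipode _ hP, convUnit_conv, coactLast]
  have h2 : cmRotate k H q ∘ₗ ((consOne k H q).toLinearMap ∘ₗ f) =
      (snocOne k H q).toLinearMap ∘ₗ f := by ext u; simp [cmRotate_consOne]
  rw [h2]

/-- The lowest degree is separate: `τ` is the identity on the target side, there is no inner coface,
and the only slot is both first and last. -/
theorem rowCyc_coactLast_zero {P : A →ₗ[k] H} (hP : IsCoalgMap P) (f : A →ₗ[k] T k H 0) :
    rowCyc P (coactLast P f) = coactFirst P f := by
  rw [rowCyc_succ, coactLast, ← firstHom_zero, cmRotate_comp_conv_firstHom, opConv_conv_eq,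
    diag_one, ← firstHom_zero]
  · have h1 := diag_antipode_conv 1 hP
    rw [diag_one, ← firstHom_zero] at h1
    rw [h1, convUnit_opConv, coactFirst]
    congr 1; ext u
    simp only [LinearMap.comp_apply, AlgHom.toLinearMap_apply, cmRotate_zero_snocOne]
    exact LinearMap.congr_fun (ext_zero (f := (snocOne k H 0).toLinearMap)
      (g := (consOne k H 0).toLinearMap) (by simp)) (f u)
  · intro u v
    simp only [LinearMap.comp_apply, AlgHom.toLinearMap_apply, cmRotate_zero_snocOne, firstHom_zero]
    exact commute_snocOne_lastHom _ _ _

theorem rowCyc_comulAt_zero {P : A →ₗ[k] H} (hP : IsCoalgMap P) {m : ℕ} (f : A →ₗ[k] T k H (m + 1)) :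
    rowCyc P (comulAt k H (m + 1) 0 ∘ₗ f) = coactFirst P (rowCyc P f) := by
  have h : cmRotate k H (m + 1) ∘ₗ comulAt k H (m + 1) 0 ∘ₗ f =
      (consOne k H (m + 1)).toLinearMap ∘ₗ cmRotate k H m ∘ₗ f := by
    ext u; simp [cmRotate_comulAt_zero]
  rw [rowCyc_succ, rowCyc_succ, coactFirst, comp_conv, comp_conv, h, diag_succ_comp _ hP,
    ← lastHom_comp_succ, conv_assoc]

theorem rowCyc_comulAt_succ (P : A →ₗ[k] H) {m i : ℕ} (hi : i < m) (f : A →ₗ[k] T k H (m + 1)) :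
    rowCyc P (comulAt k H (m + 1) (i + 1) ∘ₗ f) = comulAt k H (m + 1) i ∘ₗ rowCyc P f := by
  have h : cmRotate k H (m + 1) ∘ₗ comulAt k H (m + 1) (i + 1) ∘ₗ f =
      comulAt k H (m + 1) i ∘ₗ cmRotate k H m ∘ₗ f := by
    ext u; simp [cmRotate_comulAt_succ _ _ hi]
  have h2 : comulAt k H (m + 1) i ∘ₗ ((lastHom k H m).toLinearMap ∘ₗ P) =
      (lastHom k H (m + 1)).toLinearMap ∘ₗ P := by
    ext u; simp [comulAt_lastHom _ _ hi]
  rw [rowCyc_succ, rowCyc_succ, comulAt_comp_conv (by omega), comulAt_comp_conv (by omega), h, h2,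
    comulAt_diag_comp _ _ (by omega)]

/-- The appended slot lies beyond the first one, so `R` merely shifts it. Together with the new `ℓP`
it forms the two halves of a coproduct in the last slot. -/
theorem rowCyc_coactLast_succ {P : A →ₗ[k] H} (hP : IsCoalgMap P) {m : ℕ} (f : A →ₗ[k] T k H (m + 1)) :
    rowCyc P (coactLast P f) = comulAt k H (m + 1) m ∘ₗ rowCyc P f := by
  have h : cmRotate k H (m + 1) ∘ₗ ((snocOne k H (m + 1)).toLinearMap ∘ₗ f) =
      comulAt k H (m + 1) m ∘ₗ cmRotate k H m ∘ₗ f := by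
    ext u; simp [cmRotate_snocOne]
  have h2 : comulAt k H (m + 1) m ∘ₗ ((lastHom k H m).toLinearMap ∘ₗ P) =
      ((snocOne k H (m + 1)).toLinearMap ∘ₗ ((lastHom k H m).toLinearMap ∘ₗ P)) ⧆
        ((lastHom k H (m + 1)).toLinearMap ∘ₗ P) := by
    rw [← LinearMap.comp_assoc, comulAt_last_lastHom, hP.conv_comp]; rfl
  rw [rowCyc_succ, rowCyc_succ, coactLast]
  conv_lhs => rw [lastHom_comp_succ]
  rw [cmRotate_comp_conv_consOne, comulAt_comp_conv (by omega), comulAt_comp_conv (by omega), h,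
    h2, comulAt_diag_comp _ _ (by omega), ← lastHom_comp_succ, conv_assoc]

theorem rowCyc_rowCoface_succ {P : A →ₗ[k] H} (hP : IsCoalgMap P) {q i : ℕ} (hi : i ≤ q) (f : A →ₗ[k] T k H q) :
    rowCyc P (rowCoface P (i + 1) f) = rowCoface P i (rowCyc P f) := by
  rcases q with _ | m
  · obtain rfl : i = 0 := by omega
    rw [rowCoface_last, rowCoface_zero, rowCyc_coactLast_zero hP]; rfl
  rcases hi.eq_or_lt with rfl | hi
  · rw [rowCoface_last, rowCyc_coactLast_succ hP, rowCoface_inner _ (by omega)]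
  rw [rowCoface_inner _ hi]
  rcases i with _ | i
  · rw [rowCyc_comulAt_zero hP, rowCoface_zero]
  · rw [rowCyc_comulAt_succ P (by omega), rowCoface_inner _ (by omega)]

theorem counitAt_last_lastHom_comp {P : A →ₗ[k] H} (hP : IsCoalgMap P) (n : ℕ) :
    counitAt k H n n ∘ₗ ((lastHom k H n).toLinearMap ∘ₗ P) = convUnit k A (T k H n) := by
  rw [← LinearMap.comp_assoc, counitAt_last_lastHom, hP.convUnit_comp]

theorem counitAt_last_lastHom_antipode {P : A →ₗ[k] H} (hP : IsCoalgMap P) (n : ℕ) :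
    counitAt k H n n ∘ₗ ((lastHom k H n).toLinearMap ∘ₗ (antipode k ∘ₗ P)) =
      convUnit k A (T k H n) := by
  rw [← LinearMap.comp_assoc, counitAt_last_lastHom, ← LinearMap.comp_assoc,
    convUnit_comp_antipode, hP.convUnit_comp]

theorem rowCyc_counitAt_succ (P : A →ₗ[k] H) {m i : ℕ} (hi : i ≤ m)
    (f : A →ₗ[k] T k H (m + 2)) :
    rowCyc P (counitAt k H (m + 1) (i + 1) ∘ₗ f) = counitAt k H (m + 1) i ∘ₗ rowCyc P f := by
  have h : cmRotate k H m ∘ₗ counitAt k H (m + 1) (i + 1) ∘ₗ f =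
      counitAt k H (m + 1) i ∘ₗ cmRotate k H (m + 1) ∘ₗ f := by
    ext u; simp [cmRotate_counitAt_succ _ _ hi]
  have h2 : counitAt k H (m + 1) i ∘ₗ ((lastHom k H (m + 1)).toLinearMap ∘ₗ P) =
      (lastHom k H m).toLinearMap ∘ₗ P := by
    ext u; simp [counitAt_lastHom _ _ hi]
  rw [rowCyc_succ, rowCyc_succ, counitAt_comp_conv (by omega), counitAt_comp_conv (by omega), h, h2,
    counitAt_diag_comp P _ _ (by omega)]

theorem counitAt_comp_rowCyc_last {P : A →ₗ[k] H} (hP : IsCoalgMap P) {m : ℕ} (f : A →ₗ[k] T k H (m + 1)) :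
    counitAt k H m m ∘ₗ rowCyc P f = ((diag k H m).toLinearMap ∘ₗ P) ⧆
      (counitAt k H m m ∘ₗ cmRotate k H m ∘ₗ f) := by
  rw [rowCyc_succ, counitAt_comp_conv le_rfl, counitAt_comp_conv le_rfl, counitAt_diag_comp P _ _
    le_rfl, counitAt_last_lastHom_comp hP, conv_convUnit]

/-- The counit of the last slot removes the outer `ℓP` and also the `ℓSP` into which the second `R`
turns the inner `DP`. What remains is `R²`, treated in `cmRotate_counitAt_zero`. -/
theorem rowCyc_counitAt_zero {P : A →ₗ[k] H} (hP : IsCoalgMap P) (hS : ∀ x : H, antipode k (antipode k x) = x) {q : ℕ}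
    (f : A →ₗ[k] T k H (q + 1)) :
    rowCyc P (counitAt k H q 0 ∘ₗ f) = counitAt k H q q ∘ₗ rowCyc P (rowCyc P f) := by
  rcases q with _ | m
  -- In degree `0` the left-hand `τ` is the identity, and `ε` absorbs both operators on the right.
  · have h : ∀ g : A →ₗ[k] T k H 1, counitAt k H 0 0 ∘ₗ rowCyc P g = counitAt k H 0 0 ∘ₗ g := by
      intro g
      rw [counitAt_comp_rowCyc_last hP, diag_zero, hP.convUnit_comp, convUnit_conv]
      ext u; simp [counitAt_cmRotate_zero]
    rw [h, h]; rfl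
  · rw [counitAt_comp_rowCyc_last hP, rowCyc_succ P f, cmRotate_comp_diag_conv]
    conv_rhs => rw [lastHom_comp_succ m P]
    have h : counitAt k H (m + 1) (m + 1) ∘ₗ cmRotate k H (m + 1) ∘ₗ cmRotate k H (m + 1) ∘ₗ f =
        cmRotate k H m ∘ₗ counitAt k H (m + 1) 0 ∘ₗ f := by
      ext u; simp [cmRotate_counitAt_zero hS]
    have h2 : counitAt k H (m + 1) (m + 1) ∘ₗ
        ((snocOne k H (m + 1)).toLinearMap ∘ₗ ((lastHom k H m).toLinearMap ∘ₗ P)) =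
        (lastHom k H m).toLinearMap ∘ₗ P := by
      ext u; simp [counitAt_last_snocOne]
    rw [cmRotate_comp_conv_consOne, counitAt_comp_opConv le_rfl, counitAt_comp_conv le_rfl,
      counitAt_last_lastHom_antipode hP, opConv_convUnit, h, h2, rowCyc_succ]

/-- The extension `u ↦ P u₍₁₎ ⊗ f u₍₂₎ ⊗ P u₍₃₎`, which turns all cofaces into coproducts. -/
def coactBoth (P : A →ₗ[k] H) {q : ℕ} (f : A →ₗ[k] T k H q) : A →ₗ[k] T k H (q + 2) :=
  coactFirst P (coactLast P f)

theorem counitAt_zero_comp_coactFirst {P : A →ₗ[k] H} (hP : IsCoalgMap P) {q : ℕ} (f : A →ₗ[k] T k H q) :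
    counitAt k H q 0 ∘ₗ coactFirst P f = f := by
  have h : counitAt k H q 0 ∘ₗ ((firstHom k H q).toLinearMap ∘ₗ P) = convUnit k A (T k H q) := by
    rw [← hP.convUnit_comp]; ext u
    simp [firstHom_apply, counitAt_zero_cons, convUnit_apply, Algebra.algebraMap_eq_smul_one]
  rw [coactFirst, counitAt_comp_conv (by omega), h, convUnit_conv]
  ext u; simp [counitAt_zero_consOne]

theorem counitAt_last_comp_coactLast {P : A →ₗ[k] H} (hP : IsCoalgMap P) {q : ℕ} (f : A →ₗ[k] T k H q) :
    counitAt k H q q ∘ₗ coactLast P f = f := by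
  rw [coactLast, counitAt_comp_conv le_rfl, counitAt_last_lastHom_comp hP, conv_convUnit]
  ext u; simp [counitAt_last_snocOne]

/-- Counits in the two adjoined slots recover `f`. Cosimplicial identities may therefore be tested
after `coactBoth`. -/
theorem coactBoth_injective {P : A →ₗ[k] H} (hP : IsCoalgMap P) {q : ℕ} {f g : A →ₗ[k] T k H q} (h : coactBoth P f = coactBoth P g) :
    f = g := by
  have := congrArg (fun x => counitAt k H q q ∘ₗ counitAt k H (q + 1) 0 ∘ₗ x) h
  simpa only [coactBoth, counitAt_zero_comp_coactFirst hP, counitAt_last_comp_coactLast hP]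
    using this

theorem comulAt_zero_comp_coactFirst {P : A →ₗ[k] H} (hP : IsCoalgMap P) {q : ℕ} (f : A →ₗ[k] T k H q) :
    comulAt k H (q + 1) 0 ∘ₗ coactFirst P f = coactFirst P (coactFirst P f) := by
  have h : comulAt k H (q + 1) 0 ∘ₗ ((firstHom k H q).toLinearMap ∘ₗ P) =
      ((firstHom k H (q + 1)).toLinearMap ∘ₗ P) ⧆
        ((consOne k H (q + 1)).toLinearMap ∘ₗ ((firstHom k H q).toLinearMap ∘ₗ P)) := by
    rw [← LinearMap.comp_assoc, comulAt_zero_firstHom, hP.conv_comp]; rfl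
  rw [coactFirst, comulAt_comp_conv (by omega), h, conv_assoc, coactFirst, comp_conv]
  congr 2; ext u; simp [comulAt_zero_consOne]

theorem comulAt_last_comp_coactLast {P : A →ₗ[k] H} (hP : IsCoalgMap P) {q : ℕ} (f : A →ₗ[k] T k H q) :
    comulAt k H (q + 1) q ∘ₗ coactLast P f = coactLast P (coactLast P f) := by
  have h : comulAt k H (q + 1) q ∘ₗ ((lastHom k H q).toLinearMap ∘ₗ P) =
      ((snocOne k H (q + 1)).toLinearMap ∘ₗ ((lastHom k H q).toLinearMap ∘ₗ P)) ⧆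
        ((lastHom k H (q + 1)).toLinearMap ∘ₗ P) := by
    rw [← LinearMap.comp_assoc, comulAt_last_lastHom, hP.conv_comp]; rfl
  rw [coactLast, comulAt_comp_conv (by omega), h, ← conv_assoc, coactLast, comp_conv]
  congr 2; ext u; simp [comulAt_last_snocOne]

theorem comulAt_succ_comp_coactFirst (P : A →ₗ[k] H) {q i : ℕ} (hi : i < q) (f : A →ₗ[k] T k H q) :
    comulAt k H (q + 1) (i + 1) ∘ₗ coactFirst P f = coactFirst P (comulAt k H q i ∘ₗ f) := by
  rw [coactFirst, comulAt_comp_conv (by omega), coactFirst]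
  congr 1 <;> ext u
  · simp [comulAt_succ_firstHom _ _ hi]
  · simp [comulAt_succ_consOne]

theorem comulAt_comp_coactLast (P : A →ₗ[k] H) {q i : ℕ} (hi : i < q) (f : A →ₗ[k] T k H q) :
    comulAt k H (q + 1) i ∘ₗ coactLast P f = coactLast P (comulAt k H q i ∘ₗ f) := by
  rw [coactLast, comulAt_comp_conv (by omega), coactLast]
  congr 1 <;> ext u
  · simp [comulAt_snocOne _ _ hi]
  · simp [comulAt_lastHom _ _ hi]

theorem counitAt_succ_comp_coactFirst (P : A →ₗ[k] H) {q i : ℕ} (hi : i ≤ q)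
    (f : A →ₗ[k] T k H (q + 1)) :
    counitAt k H (q + 1) (i + 1) ∘ₗ coactFirst P f = coactFirst P (counitAt k H q i ∘ₗ f) := by
  rw [coactFirst, counitAt_comp_conv (by omega), coactFirst]
  congr 1 <;> ext u
  · simp [firstHom_apply, counitAt_succ_cons, counitAt_one _ _ hi]
  · simp [consOne_apply, counitAt_succ_cons]

theorem counitAt_comp_coactLast (P : A →ₗ[k] H) {q i : ℕ} (hi : i ≤ q)
    (f : A →ₗ[k] T k H (q + 1)) :
    counitAt k H (q + 1) i ∘ₗ coactLast P f = coactLast P (counitAt k H q i ∘ₗ f) := by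
  rw [coactLast, counitAt_comp_conv (by omega), coactLast]
  congr 1 <;> ext u
  · simp [counitAt_snocOne _ _ hi]
  · simp [counitAt_lastHom _ _ hi]

theorem coactLast_coactFirst (P : A →ₗ[k] H) {q : ℕ} (f : A →ₗ[k] T k H q) :
    coactLast P (coactFirst P f) = coactFirst P (coactLast P f) := by
  rw [coactLast, coactFirst, comp_conv, coactFirst, coactLast, comp_conv, ← firstHom_comp_succ,
    ← lastHom_comp_succ, conv_assoc]
  have h : (snocOne k H (q + 1)).toLinearMap ∘ₗ ((consOne k H q).toLinearMap ∘ₗ f) =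
      (consOne k H (q + 1)).toLinearMap ∘ₗ ((snocOne k H q).toLinearMap ∘ₗ f) := by
    ext u; simp [consOne_snocOne]
  rw [h]

/-- As `P` is a coalgebra map, adjoining `P` twice at one end is the same as applying the coproduct
to the slot adjoined once; so the outer cofaces become inner ones. -/
theorem coactBoth_rowCoface {P : A →ₗ[k] H} (hP : IsCoalgMap P) {q i : ℕ} (hi : i ≤ q + 1) (f : A →ₗ[k] T k H q) :
    coactBoth P (rowCoface P i f) = comulAt k H (q + 2) i ∘ₗ coactBoth P f := by
  rcases i with _ | i
  · rw [coactBoth, rowCoface_zero, coactBoth, comulAt_zero_comp_coactFirst hP,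
      coactLast_coactFirst]
  rw [coactBoth, coactBoth, comulAt_succ_comp_coactFirst _ (by omega)]
  rcases (Nat.lt_succ_iff.mp hi).eq_or_lt with rfl | hi
  · rw [rowCoface_last, comulAt_last_comp_coactLast hP]
  · rw [rowCoface_inner _ hi, comulAt_comp_coactLast _ hi]

theorem coactBoth_counitAt (P : A →ₗ[k] H) {q j : ℕ} (hj : j ≤ q) (f : A →ₗ[k] T k H (q + 1)) :
    coactBoth P (counitAt k H q j ∘ₗ f) = counitAt k H (q + 2) (j + 1) ∘ₗ coactBoth P f := by
  rw [coactBoth, coactBoth, counitAt_succ_comp_coactFirst _ (by omega),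
    counitAt_comp_coactLast _ hj]

end Rows
end
end GerstenhaberSchack

open scoped TensorProduct
namespace GerstenhaberSchack
noncomputable section
open TensorProduct Coalgebra HopfAlgebra
universe u v
variable {k : Type u} [Field k] {H : Type v} [Ring H] [HopfAlgebra k H]

/-! ### Powers of the row operator -/

section RowPowers

variable (k H) in
/-- `h ↦ 1 ⊗ ⋯ ⊗ 1 ⊗ h₍₁₎ ⊗ ⋯ ⊗ h₍q₋ⱼ₎`, with `j` factors `1`. -/
def diagTail : ∀ q : ℕ, ℕ → (H →ₗ[k] T k H q)
  | q, 0 => (diag k H q).toLinearMap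
  | 0, _ + 1 => (diag k H 0).toLinearMap
  | q + 1, j + 1 => (consOne k H q).toLinearMap ∘ₗ diagTail q j

theorem diagTail_zero (q : ℕ) : diagTail k H q 0 = (diag k H q).toLinearMap := by
  cases q <;> rfl

theorem diagTail_succ_succ (q j : ℕ) : diagTail k H (q + 1) (j + 1) =
    (consOne k H q).toLinearMap ∘ₗ diagTail k H q j := rfl

theorem diagTail_self (q : ℕ) : diagTail k H q q = convUnit k H (T k H q) := by
  induction q with
  | zero => rfl
  | succ q ih => rw [diagTail_succ_succ, ih, comp_convUnit]

theorem diagTail_succ (m j : ℕ) (hj : j ≤ m) : diagTail k H (m + 1) j =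
    ((snocOne k H m).toLinearMap ∘ₗ diagTail k H m j) ⧆ (lastHom k H m).toLinearMap := by
  induction m generalizing j with
  | zero =>
    obtain rfl : j = 0 := by omega
    rw [diagTail_zero, diagTail_zero, diag_succ']
  | succ m ih =>
    rcases j with _ | j
    · rw [diagTail_zero, diagTail_zero, diag_succ']
    · rw [diagTail_succ_succ, ih j (by omega), comp_conv, diagTail_succ_succ]
      congr 1
      · ext u; simp [consOne_snocOne]
      · ext u; simp [consOne_lastHom]

theorem diagTail_last (m : ℕ) : diagTail k H (m + 1) m = (lastHom k H m).toLinearMap := by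
  rw [diagTail_succ _ _ le_rfl, diagTail_self, comp_convUnit, convUnit_conv]

variable {A : Type*} [AddCommGroup A] [Module k A] [Coalgebra k A]

theorem diagTail_succ_comp {P : A →ₗ[k] H} (hP : IsCoalgMap P) (m j : ℕ) (hj : j ≤ m) :
    diagTail k H (m + 1) j ∘ₗ P =
      ((snocOne k H m).toLinearMap ∘ₗ (diagTail k H m j ∘ₗ P)) ⧆
        ((lastHom k H m).toLinearMap ∘ₗ P) := by
  rw [diagTail_succ _ _ hj, hP.conv_comp]; rfl

theorem diagTail_succ_comp_antipode {P : A →ₗ[k] H} (hP : IsCoalgMap P) (m j : ℕ) (hj : j ≤ m) :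
    diagTail k H (m + 1) j ∘ₗ (antipode k ∘ₗ P) =
      ((snocOne k H m).toLinearMap ∘ₗ (diagTail k H m j ∘ₗ (antipode k ∘ₗ P))) ⧇
        ((lastHom k H m).toLinearMap ∘ₗ (antipode k ∘ₗ P)) := by
  rw [diagTail_succ _ _ hj, ← LinearMap.comp_assoc, conv_comp_antipode, hP.opConv_comp]; rfl

/-- Both factors attached to the last slot are absorbed by those on the other slots. -/
theorem conv_opConv_lastHom_conv_lastHom (m : ℕ) (g : A →ₗ[k] T k H (m + 1))
    (α : A →ₗ[k] T k H m) (π ρ : A →ₗ[k] H) :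
    ((g ⧆ ((snocOne k H m).toLinearMap ∘ₗ α)) ⧇ ((lastHom k H m).toLinearMap ∘ₗ π)) ⧆
        ((lastHom k H m).toLinearMap ∘ₗ ρ) =
      (g ⧇ ((lastHom k H m).toLinearMap ∘ₗ π)) ⧆
        (((snocOne k H m).toLinearMap ∘ₗ α) ⧆ ((lastHom k H m).toLinearMap ∘ₗ ρ)) := by
  have h : ∀ u v, Commute (((lastHom k H m).toLinearMap ∘ₗ π) u)
      (((snocOne k H m).toLinearMap ∘ₗ α) v) :=
    fun u v => (commute_snocOne_lastHom m (α v) (π u)).symm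
  rw [← conv_assoc, ← opConv_conv_right_comm (f := g) h]

/-- One step of the iteration. `R` shifts both tails one slot to the left. The front `DP` becomes an
`ℓSP` completing the antipode tail, and the new `ℓP` completes the other, so each tail grows by one
slot. -/
theorem rowCyc_conv_diagTail {P : A →ₗ[k] H} (hP : IsCoalgMap P) {m j : ℕ} (hj : j < m)
    (g : A →ₗ[k] T k H (m + 1)) :
    rowCyc P (((diag k H (m + 1)).toLinearMap ∘ₗ P) ⧆
        ((g ⧇ (diagTail k H (m + 1) (j + 2) ∘ₗ (antipode k ∘ₗ P))) ⧆
          (diagTail k H (m + 1) (j + 1) ∘ₗ P))) =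
      ((diag k H (m + 1)).toLinearMap ∘ₗ P) ⧆
        (((cmRotate k H m ∘ₗ g) ⧇ (diagTail k H (m + 1) (j + 1) ∘ₗ (antipode k ∘ₗ P))) ⧆
          (diagTail k H (m + 1) j ∘ₗ P)) := by
  rw [rowCyc_succ, cmRotate_comp_diag_conv, diagTail_succ_succ, LinearMap.comp_assoc,
    diagTail_succ_succ, LinearMap.comp_assoc, cmRotate_comp_conv_consOne,
    cmRotate_comp_opConv_consOne, conv_opConv_lastHom_conv_lastHom, opConv_assoc,
    ← diagTail_succ_comp hP _ _ hj.le, ← diagTail_succ_comp_antipode hP _ _ hj]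
  rfl

/-- The wrap-around step: the right-hand tail now occupies every slot, and `R` carries its first
slot to the front as `DSP`. -/
theorem rowCyc_conv_diagTail_zero {P : A →ₗ[k] H} (hP : IsCoalgMap P) {m : ℕ}
    (g : A →ₗ[k] T k H (m + 1)) :
    rowCyc P (((diag k H (m + 1)).toLinearMap ∘ₗ P) ⧆
        ((g ⧇ (diagTail k H (m + 1) 1 ∘ₗ (antipode k ∘ₗ P))) ⧆
          (diagTail k H (m + 1) 0 ∘ₗ P))) =
      ((diag k H (m + 1)).toLinearMap ∘ₗ P) ⧆
        ((((diag k H (m + 1)).toLinearMap ∘ₗ (antipode k ∘ₗ P)) ⧇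
          ((cmRotate k H m ∘ₗ g) ⧇ ((diag k H (m + 1)).toLinearMap ∘ₗ (antipode k ∘ₗ P)))) ⧆
          ((diag k H (m + 1)).toLinearMap ∘ₗ P)) := by
  rw [rowCyc_succ, cmRotate_comp_diag_conv, diagTail_succ_succ, LinearMap.comp_assoc,
    diagTail_zero, diagTail_zero]
  -- Only the inner diagonal, the one under `cmRotate`, has its first slot split off; the outer `DP`
  -- stays intact.
  nth_rewrite 2 [diag_succ_comp _ hP]
  rw [← conv_assoc (g ⧇ _), cmRotate_comp_conv_consOne, cmRotate_comp_conv_firstHom,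
    cmRotate_comp_opConv_consOne, conv_opConv_lastHom_conv_lastHom, opConv_assoc, opConv_assoc,
    ← diag_succ_comp' _ hP, ← diag_succ_comp_antipode' _ hP]

/-- Here `j` counts the slots that the right-hand tail has not yet reached. The antipode tail starts
one slot later, because each `ℓSP` arises from the `DP` of the preceding application. -/
theorem rowCyc_iterate {P : A →ₗ[k] H} (hP : IsCoalgMap P) {m : ℕ} (i j : ℕ) (h : i + j = m)
    (f : A →ₗ[k] T k H (m + 1)) :
    (rowCyc P)^[i + 1] f = ((diag k H (m + 1)).toLinearMap ∘ₗ P) ⧆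
      ((((cmRotate k H m ^ (i + 1)) ∘ₗ f) ⧇
        (diagTail k H (m + 1) (j + 1) ∘ₗ (antipode k ∘ₗ P))) ⧆
          (diagTail k H (m + 1) j ∘ₗ P)) := by
  induction i generalizing j with
  | zero =>
    obtain rfl : j = m := by omega
    rw [diagTail_self, ← LinearMap.comp_assoc, convUnit_comp_antipode, hP.convUnit_comp,
      opConv_convUnit, diagTail_last, zero_add, pow_one, Function.iterate_one, rowCyc_succ]
  | succ i ih =>
    rw [Function.iterate_succ_apply', ih (j + 1) (by omega), rowCyc_conv_diagTail hP (by omega),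
      pow_succ' _ (i + 1)]
    rfl

/-- After `q + 1` steps both tails are complete and `R^(q+1) = 1`. With Sweedler legs the value is
`DP(u₁) DSP(u₄) f(u₃) DSP(u₂) DP(u₅)`. -/
theorem rowCyc_iterate_succ (hS : ∀ x : H, antipode k (antipode k x) = x) {P : A →ₗ[k] H}
    (hP : IsCoalgMap P) (q : ℕ) (f : A →ₗ[k] T k H q) :
    (rowCyc P)^[q + 1] f = ((diag k H q).toLinearMap ∘ₗ P) ⧆
      ((((diag k H q).toLinearMap ∘ₗ (antipode k ∘ₗ P)) ⧇
        (f ⧇ ((diag k H q).toLinearMap ∘ₗ (antipode k ∘ₗ P)))) ⧆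
          ((diag k H q).toLinearMap ∘ₗ P)) := by
  rcases q with _ | m
  · rw [diag_zero, ← LinearMap.comp_assoc, convUnit_comp_antipode, hP.convUnit_comp,
      convUnit_conv, convUnit_opConv, opConv_convUnit, conv_convUnit]
    rfl
  · rw [Function.iterate_succ_apply', rowCyc_iterate hP m 0 (by omega),
      rowCyc_conv_diagTail_zero hP, ← LinearMap.comp_assoc f, ← Module.End.mul_eq_comp,
      ← pow_succ', cmRotate_pow hS]
    rfl

end RowPowers

/-! ### The rows are para-cocyclic -/

section RowStructure

theorem cofaceHFirst_apply (p q : ℕ) (f : GS k H p q) :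
    cofaceHFirst k H p q f = coactFirst (prod k H p) f := by
  have h : (cons k H q).toLinearMap ∘ₗ TensorProduct.map (prod k H p) f =
      LinearMap.mul' k _ ∘ₗ TensorProduct.map ((firstHom k H q).toLinearMap ∘ₗ prod k H p)
        ((consOne k H q).toLinearMap ∘ₗ f) := by
    ext; simp [cons_eq_mul]
  rw [coactFirst, conv, ← h]; rfl

theorem cofaceHLast_apply (p q : ℕ) (f : GS k H p q) :
    cofaceHLast k H p q f = coactLast (prod k H p) f := by
  have h : (snoc k H q).toLinearMap ∘ₗ TensorProduct.map f (prod k H p) =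
      LinearMap.mul' k _ ∘ₗ TensorProduct.map ((snocOne k H q).toLinearMap ∘ₗ f)
        ((lastHom k H q).toLinearMap ∘ₗ prod k H p) := by
    ext; simp [snoc_eq_mul]
  rw [coactLast, conv, ← h]; rfl

theorem cofaceH_apply (p q i : ℕ) (f : GS k H p q) :
    cofaceH k H p q i f = rowCoface (prod k H p) i f := by
  rw [cofaceH, rowCoface]
  split_ifs
  · exact cofaceHFirst_apply p q f
  · exact cofaceHLast_apply p q f
  · rfl

theorem codegH_apply (p q j : ℕ) (f : GS k H p (q + 1)) :
    codegH k H p q j f = counitAt k H q j ∘ₗ f := rfl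

theorem tauCoalgCore_apply (m : ℕ) (h : H) (x : T k H (m + 1)) (g : H) :
    tauCoalgCore k H m (h ⊗ₜ (x ⊗ₜ g)) =
      diag k H (m + 1) h * (cmRotate k H m x * lastHom k H m g) := by
  induction x using cons_induction with
  | zero => simp
  | add _ _ h1 h2 => simp only [TensorProduct.add_tmul, TensorProduct.tmul_add, map_add, h1, h2,
      add_mul, mul_add]
  | cons a x =>
    rw [cmRotate_apply, snocOne_apply, ← cons_snoc, contract_cons]
    simp [tauCoalgCore, leftAct_tmul, mul_assoc, snoc_eq_mul]

theorem tauCoalg_apply (p q : ℕ) (f : GS k H p q) :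
    tauCoalg k H p q f = rowCyc (prod k H p) f := by
  rcases q with _ | m
  · rfl
  have h : tauCoalgCore k H m ∘ₗ TensorProduct.map (prod k H p)
      (TensorProduct.map f (prod k H p)) = LinearMap.mul' k _ ∘ₗ
        TensorProduct.map ((diag k H (m + 1)).toLinearMap ∘ₗ prod k H p)
          (LinearMap.mul' k _ ∘ₗ TensorProduct.map (cmRotate k H m ∘ₗ f)
            ((lastHom k H m).toLinearMap ∘ₗ prod k H p)) := by
    ext; simp [tauCoalgCore_apply]
  rw [rowCyc_succ, conv.eq_def (cmRotate k H m ∘ₗ f), conv_comul_right, ← h]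
  rfl

theorem tauCoalg_pow_apply (p q n : ℕ) (f : GS k H p q) :
    (tauCoalg k H p q ^ n) f = (rowCyc (prod k H p))^[n] f := by
  rw [Module.End.pow_apply, show ⇑(tauCoalg k H p q) = rowCyc (prod k H p) from
    funext (tauCoalg_apply p q)]

theorem isParaCocyclic_row (hS : ∀ x : H, antipode k (antipode k x) = x) (p : ℕ) :
    Cocyclic.IsParaCocyclic (k := k) (GS k H p) (cofaceH k H p) (codegH k H p)
      (tauCoalg k H p) where
  coface_coface n i j hij hj := by
    refine LinearMap.ext fun f => coactBoth_injective (isCoalgMap_prod p) ?_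
    simp only [LinearMap.comp_apply, cofaceH_apply]
    rw [coactBoth_rowCoface (isCoalgMap_prod p) (by omega),
      coactBoth_rowCoface (isCoalgMap_prod p) (by omega),
      coactBoth_rowCoface (isCoalgMap_prod p) (by omega),
      coactBoth_rowCoface (isCoalgMap_prod p) (by omega), ← LinearMap.comp_assoc,
      comulAt_comp_comulAt _ _ _ hij (by omega), LinearMap.comp_assoc]
  codeg_codeg n i j hij hj := by
    refine LinearMap.ext fun f => ?_
    simp only [LinearMap.comp_apply, codegH_apply]
    rw [← LinearMap.comp_assoc, counitAt_comp_counitAt _ _ _ hij hj, LinearMap.comp_assoc]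
  codeg_coface_lt n i j hij hj := by
    refine LinearMap.ext fun f => coactBoth_injective (isCoalgMap_prod p) ?_
    simp only [LinearMap.comp_apply, cofaceH_apply, codegH_apply]
    rw [coactBoth_counitAt _ (by omega), coactBoth_rowCoface (isCoalgMap_prod p) (by omega),
      coactBoth_rowCoface (isCoalgMap_prod p) (by omega), coactBoth_counitAt _ (by omega),
      ← LinearMap.comp_assoc, counitAt_comp_comulAt_lt _ _ _ (by omega) (by omega),
      LinearMap.comp_assoc]
  codeg_coface_self n j hj := by
    refine LinearMap.ext fun f => coactBoth_injective (isCoalgMap_prod p) ?_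
    simp only [LinearMap.comp_apply, cofaceH_apply, codegH_apply]
    -- Under `coactBoth` a coface keeps its index while a codegeneracy index rises by one, because
    -- of the slot adjoined in front. Hence the relation for `j` and `j` becomes the one for `j` and
    -- `j + 1`, and vice versa in the next field.
    rw [coactBoth_counitAt _ (by omega), coactBoth_rowCoface (isCoalgMap_prod p) (by omega),
      ← LinearMap.comp_assoc, counitAt_comp_comulAt_succ _ _ (by omega)]
    rfl
  codeg_coface_succ n j hj := by
    refine LinearMap.ext fun f => coactBoth_injective (isCoalgMap_prod p) ?_
    simp only [LinearMap.comp_apply, cofaceH_apply, codegH_apply]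
    rw [coactBoth_counitAt _ (by omega), coactBoth_rowCoface (isCoalgMap_prod p) (by omega),
      ← LinearMap.comp_assoc, counitAt_comp_comulAt_self _ _ (by omega)]
    rfl
  codeg_coface_gt n i j hij hi := by
    refine LinearMap.ext fun f => coactBoth_injective (isCoalgMap_prod p) ?_
    simp only [LinearMap.comp_apply, cofaceH_apply, codegH_apply]
    rw [coactBoth_counitAt _ (by omega), coactBoth_rowCoface (isCoalgMap_prod p) (by omega),
      coactBoth_rowCoface (isCoalgMap_prod p) (by omega), coactBoth_counitAt _ (by omega),
      ← LinearMap.comp_assoc, counitAt_comp_comulAt_gt _ _ _ (by omega) (by omega),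
      LinearMap.comp_assoc]
  cyc_coface_zero n := by
    refine LinearMap.ext fun f => ?_
    simp only [LinearMap.comp_apply, cofaceH_apply, tauCoalg_apply]
    rw [rowCoface_zero, rowCoface_last, rowCyc_coactFirst (isCoalgMap_prod p)]
  cyc_coface_succ n i hi := by
    refine LinearMap.ext fun f => ?_
    simp only [LinearMap.comp_apply, cofaceH_apply, tauCoalg_apply]
    rw [rowCyc_rowCoface_succ (isCoalgMap_prod p) hi]
  cyc_codeg_zero n := by
    refine LinearMap.ext fun f => ?_
    simp only [LinearMap.comp_apply, codegH_apply, tauCoalg_apply]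
    rw [rowCyc_counitAt_zero (isCoalgMap_prod p) hS]
  cyc_codeg_succ n i hi := by
    refine LinearMap.ext fun f => ?_
    obtain ⟨m, rfl⟩ : ∃ m, n = m + 1 := ⟨n - 1, by omega⟩
    simp only [LinearMap.comp_apply, codegH_apply, tauCoalg_apply]
    rw [rowCyc_counitAt_succ _ (by omega)]

end RowStructure
end
end GerstenhaberSchack

open scoped TensorProduct
namespace GerstenhaberSchack
noncomputable section
open TensorProduct Coalgebra HopfAlgebra
universe u v

/-! ### Cocommuting maps, the dual of commuting slots -/

section Cocommute

variable {k : Type*} [CommRing k] {A : Type*} [AddCommGroup A] [Module k A] [Coalgebra k A]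
  {M N : Type*} [AddCommGroup M] [Module k M] [AddCommGroup N] [Module k N]
  {B : Type*} [Ring B] [Algebra k B]

/-- `f u₍₁₎ ⊗ g u₍₂₎ = f u₍₂₎ ⊗ g u₍₁₎`. -/
def Cocommute (f : A →ₗ[k] M) (g : A →ₗ[k] N) : Prop :=
  TensorProduct.map f g ∘ₗ comul =
    TensorProduct.map f g ∘ₗ (TensorProduct.comm k A A).toLinearMap ∘ₗ comul

theorem Cocommute.postcomp {f : A →ₗ[k] M} {g : A →ₗ[k] N} (h : Cocommute f g)
    {M' N' : Type*} [AddCommGroup M'] [Module k M'] [AddCommGroup N'] [Module k N']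
    (f' : M →ₗ[k] M') (g' : N →ₗ[k] N') : Cocommute (f' ∘ₗ f) (g' ∘ₗ g) := by
  rw [Cocommute, TensorProduct.map_comp, LinearMap.comp_assoc, h]; rfl

theorem Cocommute.precomp {f : A →ₗ[k] M} {g : A →ₗ[k] N} (h : Cocommute f g)
    {A' : Type*} [AddCommGroup A'] [Module k A'] [Coalgebra k A'] {s : A' →ₗ[k] A}
    (hs : IsCoalgMap s) : Cocommute (f ∘ₗ s) (g ∘ₗ s) := by
  have h1 : TensorProduct.map s s ∘ₗ (TensorProduct.comm k A' A').toLinearMap =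
    (TensorProduct.comm k A A).toLinearMap ∘ₗ TensorProduct.map s s := by ext; simp
  rw [Cocommute, TensorProduct.map_comp, LinearMap.comp_assoc, LinearMap.comp_assoc,
    ← LinearMap.comp_assoc comul _ (TensorProduct.map s s), h1, LinearMap.comp_assoc,
    ← hs.comul_comp, ← LinearMap.comp_assoc, h]
  rfl

theorem Cocommute.symm {f : A →ₗ[k] M} {g : A →ₗ[k] N} (h : Cocommute f g) : Cocommute g f := by
  have h1 : TensorProduct.map g f = (TensorProduct.comm k M N).toLinearMap ∘ₗ
      TensorProduct.map f g ∘ₗ (TensorProduct.comm k A A).toLinearMap := by ext; simp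
  have h2 : (TensorProduct.comm k A A).toLinearMap ∘ₗ (TensorProduct.comm k A A).toLinearMap =
      LinearMap.id := by ext; simp
  rw [Cocommute, h1, LinearMap.comp_assoc, LinearMap.comp_assoc, ← h, LinearMap.comp_assoc,
    LinearMap.comp_assoc, ← LinearMap.comp_assoc comul (TensorProduct.comm k A A).toLinearMap, h2,
    LinearMap.id_comp]

theorem Cocommute.opConv_eq {f g : A →ₗ[k] B} (h : Cocommute f g) : f ⧇ g = f ⧆ g := by
  rw [opConv, conv, LinearMap.comp_assoc, LinearMap.comp_assoc, LinearMap.comp_assoc, ← h]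

/-- The two sides are `f(u₁) y(u₃) g(u₂)` and `f(u₂) y(u₃) g(u₁)`. The map `W` sends `b ⊗ c ⊗ a` to
`b y(a) c`, so both factor through `f ⊗ g` on the coproduct, where the legs may be exchanged. -/
theorem Cocommute.conv_opConv_assoc {f g : A →ₗ[k] B} (h : Cocommute f g) (y : A →ₗ[k] B) :
    f ⧆ (y ⧇ g) = (f ⧆ y) ⧇ g := by
  let W : (B ⊗[k] B) ⊗[k] A →ₗ[k] B := LinearMap.mul' k B ∘ₗ
    (LinearMap.mul' k B ∘ₗ (TensorProduct.comm k B B).toLinearMap).lTensor B ∘ₗ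
    (TensorProduct.assoc k B B B).toLinearMap ∘ₗ y.lTensor (B ⊗[k] B)
  have h1 : f ⧆ (y ⧇ g) = W ∘ₗ (TensorProduct.map f g ∘ₗ comul).rTensor A ∘ₗ comul := by
    rw [opConv, conv_comul_right, ← coassoc, LinearMap.rTensor_comp]
    simp only [← LinearMap.comp_assoc]
    congr 2
    refine TensorProduct.ext_threefold fun a b c => ?_
    simp [W]
  have h2 : (f ⧆ y) ⧇ g = W ∘ₗ (TensorProduct.map f g ∘ₗ
      (TensorProduct.comm k A A).toLinearMap ∘ₗ comul).rTensor A ∘ₗ comul := by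
    rw [conv, opConv_comul_left, ← coassoc, LinearMap.rTensor_comp, LinearMap.rTensor_comp]
    simp only [← LinearMap.comp_assoc]
    congr 2
    refine TensorProduct.ext_threefold fun a b c => ?_
    simp [W, mul_assoc]
  rw [h1, h2, h]

variable {C : Type*} [AddCommGroup C] [Module k C] [Coalgebra k C]

variable (k A C) in
/-- `id ⊗ ε : A ⊗ C → A`. -/
def fstCoalg : A ⊗[k] C →ₗ[k] A :=
  (TensorProduct.rid k A).toLinearMap ∘ₗ (counit (R := k) (A := C)).lTensor A

variable (k A C) in
/-- `ε ⊗ id : A ⊗ C → C`. -/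
def sndCoalg : A ⊗[k] C →ₗ[k] C :=
  (TensorProduct.lid k C).toLinearMap ∘ₗ (counit (R := k) (A := A)).rTensor C

theorem isCoalgMap_fstCoalg : IsCoalgMap (fstCoalg k A C) :=
  IsCoalgMap.rid.comp IsCoalgMap.counit.lTensor

theorem isCoalgMap_sndCoalg : IsCoalgMap (sndCoalg k A C) :=
  IsCoalgMap.lid.comp IsCoalgMap.counit.rTensor

theorem map_fstCoalg_sndCoalg_comul :
    TensorProduct.map (fstCoalg k A C) (sndCoalg k A C) ∘ₗ comul = LinearMap.id := by
  have h : TensorProduct.map (fstCoalg k A C) (sndCoalg k A C) ∘ₗ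
      (TensorProduct.tensorTensorTensorComm k A A C C).toLinearMap =
      TensorProduct.map (fstCoalg k A A) (sndCoalg k C C) := by
    ext a b c d
    simp [fstCoalg, sndCoalg, TensorProduct.smul_tmul', TensorProduct.tmul_smul, smul_smul, mul_comm]
  have h1 : fstCoalg k A A ∘ₗ comul = LinearMap.id := by
    rw [fstCoalg, LinearMap.comp_assoc, lTensor_counit_comp_comul]; ext; simp
  have h2 : sndCoalg k C C ∘ₗ comul = LinearMap.id := by
    rw [sndCoalg, LinearMap.comp_assoc, rTensor_counit_comp_comul]; ext; simp
  rw [TensorProduct.comul_def, ← LinearMap.comp_assoc]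
  erw [h]
  rw [TensorProduct.AlgebraTensorModule.map_eq, ← TensorProduct.map_comp, h1, h2,
    TensorProduct.map_id]

theorem map_fstCoalg_sndCoalg_comm_comul :
    TensorProduct.map (fstCoalg k A C) (sndCoalg k A C) ∘ₗ
      (TensorProduct.comm k _ _).toLinearMap ∘ₗ comul = LinearMap.id := by
  have h : TensorProduct.map (fstCoalg k A C) (sndCoalg k A C) ∘ₗ
      (TensorProduct.comm k _ _).toLinearMap ∘ₗ
      (TensorProduct.tensorTensorTensorComm k A A C C).toLinearMap =
      TensorProduct.map (sndCoalg k A A) (fstCoalg k C C) := by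
    ext a b c d
    simp [fstCoalg, sndCoalg, TensorProduct.smul_tmul', TensorProduct.tmul_smul, smul_smul, mul_comm]
  have h1 : fstCoalg k C C ∘ₗ comul = LinearMap.id := by
    rw [fstCoalg, LinearMap.comp_assoc, lTensor_counit_comp_comul]; ext; simp
  have h2 : sndCoalg k A A ∘ₗ comul = LinearMap.id := by
    rw [sndCoalg, LinearMap.comp_assoc, rTensor_counit_comp_comul]; ext; simp
  rw [TensorProduct.comul_def, ← LinearMap.comp_assoc, ← LinearMap.comp_assoc]
  erw [h]
  rw [TensorProduct.AlgebraTensorModule.map_eq, ← TensorProduct.map_comp, h1, h2,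
    TensorProduct.map_id]

/-- The two factors of a tensor product coalgebra have independent coproducts: either order of the
legs recovers the original tensor after applying the counits. -/
theorem cocommute_fstCoalg_sndCoalg : Cocommute (fstCoalg k A C) (sndCoalg k A C) := by
  rw [Cocommute, map_fstCoalg_sndCoalg_comul, map_fstCoalg_sndCoalg_comm_comul]

theorem conv_fstCoalg_sndCoalg (f : A →ₗ[k] B) (g : C →ₗ[k] B) :
    (f ∘ₗ fstCoalg k A C) ⧆ (g ∘ₗ sndCoalg k A C) =
      LinearMap.mul' k B ∘ₗ TensorProduct.map f g := by
  rw [conv, TensorProduct.map_comp, LinearMap.comp_assoc, LinearMap.comp_assoc,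
    map_fstCoalg_sndCoalg_comul, LinearMap.comp_id]

end Cocommute

/-! ### Convolution products along `u ↦ S(P u₂) ⊗ u₁` -/

section Twist

variable {k : Type*} [CommRing k] {H : Type*} [Ring H] [HopfAlgebra k H]
  {A : Type*} [AddCommGroup A] [Module k A] [Coalgebra k A]
  {B : Type*} [Ring B] [Algebra k B]

/-- `u ↦ S(P u₍₂₎) ⊗ u₍₁₎`. -/
def twist (P : A →ₗ[k] H) : A →ₗ[k] H ⊗[k] A :=
  (TensorProduct.map (antipode k ∘ₗ P) LinearMap.id ∘ₗ (TensorProduct.comm k A A).toLinearMap) ∘ₗ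
    comul

theorem comp_twist {N : Type*} [AddCommGroup N] [Module k N] (P : A →ₗ[k] H)
    (f : H ⊗[k] A →ₗ[k] N) : f ∘ₗ twist P = (f ∘ₗ TensorProduct.map (antipode k ∘ₗ P) LinearMap.id ∘ₗ
      (TensorProduct.comm k A A).toLinearMap) ∘ₗ comul := rfl

theorem map_comul_comul_comp_comul :
    TensorProduct.map (comul (R := k) (A := A)) (comul (R := k) (A := A)) ∘ₗ comul =
      (TensorProduct.assoc k A A (A ⊗[k] A)).symm.toLinearMap ∘ₗ
        ((comul (R := k) (A := A)).lTensor A ∘ₗ comul).lTensor A ∘ₗ comul := by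
  have h : TensorProduct.map (comul (R := k) (A := A)) (comul (R := k) (A := A)) =
      (comul (R := k) (A := A)).lTensor (A ⊗[k] A) ∘ₗ (comul (R := k) (A := A)).rTensor A := by
    ext; simp
  have h2 : (comul (R := k) (A := A)).lTensor (A ⊗[k] A) =
      (TensorProduct.assoc k A A (A ⊗[k] A)).symm.toLinearMap ∘ₗ
        ((comul (R := k) (A := A)).lTensor A).lTensor A ∘ₗ
          (TensorProduct.assoc k A A A).toLinearMap := by
    refine TensorProduct.ext_threefold fun a b c => ?_
    simp only [LinearMap.lTensor_tmul, LinearMap.comp_apply, LinearEquiv.coe_coe,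
      TensorProduct.assoc_tmul]
    induction comul (R := k) c using TensorProduct.induction_on with
    | zero => simp
    | tmul x y => simp
    | add x y hx hy => simp only [TensorProduct.tmul_add, map_add, hx, hy]
  rw [h, h2, LinearMap.comp_assoc, LinearMap.comp_assoc, LinearMap.comp_assoc, coassoc,
    LinearMap.lTensor_comp, LinearMap.comp_assoc]

variable (A) in
/-- `u ⊗ v ⊗ w ⊗ z ↦ (S(P z) ⊗ u) ⊗ (S(P w) ⊗ v)`. -/
def twistShuffle (P : A →ₗ[k] H) :
    A ⊗[k] (A ⊗[k] (A ⊗[k] A)) →ₗ[k] (H ⊗[k] A) ⊗[k] (H ⊗[k] A) :=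
  (TensorProduct.tensorTensorTensorComm k H H A A).toLinearMap ∘ₗ
    (TensorProduct.comm k (A ⊗[k] A) (H ⊗[k] H)).toLinearMap ∘ₗ
    (TensorProduct.map (antipode k ∘ₗ P) (antipode k ∘ₗ P) ∘ₗ
      (TensorProduct.comm k A A).toLinearMap).lTensor (A ⊗[k] A) ∘ₗ
    (TensorProduct.assoc k A A (A ⊗[k] A)).symm.toLinearMap

@[simp]
theorem twistShuffle_tmul {M : Type*} [AddCommGroup M] [Module k M] (P : M →ₗ[k] H)
    (a b c d : M) :
    twistShuffle M P (a ⊗ₜ (b ⊗ₜ (c ⊗ₜ d))) =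
      (antipode k (P d) ⊗ₜ a) ⊗ₜ (antipode k (P c) ⊗ₜ b) := by
  simp [twistShuffle]

/-- The twist is in general not a coalgebra map: since `S` reverses coproducts, its coproduct is
`(S(P u₄) ⊗ u₁) ⊗ (S(P u₃) ⊗ u₂)`. The rules below evaluate convolution products on these four legs.
-/
theorem comul_comp_twist {P : A →ₗ[k] H} (hP : IsCoalgMap P) :
    comul ∘ₗ twist P = twistShuffle A P ∘ₗ
      ((comul (R := k) (A := A)).lTensor A ∘ₗ comul).lTensor A ∘ₗ comul := by
  have h1 : comul ∘ₗ antipode k ∘ₗ P = (TensorProduct.map (antipode k ∘ₗ P) (antipode k ∘ₗ P) ∘ₗ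
      (TensorProduct.comm k A A).toLinearMap) ∘ₗ comul := by
    rw [← LinearMap.comp_assoc, comul_comp_antipode, LinearMap.comp_assoc, LinearMap.comp_assoc,
      hP.comul_comp, TensorProduct.map_comp]
    simp only [← LinearMap.comp_assoc]
    congr 1
    ext; simp
  have h2 : (TensorProduct.map (comul ∘ₗ antipode k ∘ₗ P) (comul (R := k) (A := A))) ∘ₗ
      (TensorProduct.comm k A A).toLinearMap =
      (TensorProduct.comm k (A ⊗[k] A) (H ⊗[k] H)).toLinearMap ∘ₗ
      (TensorProduct.map (antipode k ∘ₗ P) (antipode k ∘ₗ P) ∘ₗ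
        (TensorProduct.comm k A A).toLinearMap).lTensor (A ⊗[k] A) ∘ₗ
      TensorProduct.map (comul (R := k) (A := A)) (comul (R := k) (A := A)) := by
    rw [h1]; ext a b; simp
  rw [twistShuffle]
  simp only [LinearMap.comp_assoc]
  rw [← map_comul_comul_comp_comul]
  have h3 : TensorProduct.map (comul (R := k) (A := H)) (comul (R := k) (A := A)) ∘ₗ
      TensorProduct.map (antipode k ∘ₗ P) LinearMap.id =
      TensorProduct.map (comul ∘ₗ antipode k ∘ₗ P) comul := by
    rw [← TensorProduct.map_comp, LinearMap.comp_id]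
  rw [TensorProduct.comul_def, twist, TensorProduct.AlgebraTensorModule.map_eq]
  have h4 := congrArg (fun x => (TensorProduct.tensorTensorTensorComm k H H A A).toLinearMap ∘ₗ
    x ∘ₗ comul) h2
  simp only [LinearMap.comp_assoc] at h4 ⊢
  rw [← h4, ← h3]
  rfl

theorem lTensor_lTensor_fstCoalg_comp :
    ((fstCoalg k A A).lTensor A).lTensor A ∘ₗ
      ((comul (R := k) (A := A)).lTensor A ∘ₗ comul).lTensor A ∘ₗ comul =
      (comul (R := k) (A := A)).lTensor A ∘ₗ comul := by
  have h1 : fstCoalg k A A ∘ₗ comul = LinearMap.id := by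
    rw [fstCoalg, LinearMap.comp_assoc, lTensor_counit_comp_comul]; ext; simp
  rw [← LinearMap.comp_assoc, ← LinearMap.lTensor_comp, ← LinearMap.comp_assoc,
    ← LinearMap.lTensor_comp, h1, LinearMap.lTensor_id, LinearMap.id_comp]

theorem sndCoalg_comp :
    sndCoalg k A (A ⊗[k] (A ⊗[k] A)) ∘ₗ
      ((comul (R := k) (A := A)).lTensor A ∘ₗ comul).lTensor A ∘ₗ comul =
      (comul (R := k) (A := A)).lTensor A ∘ₗ comul := by
  have h2 : sndCoalg k A A ∘ₗ comul = LinearMap.id := by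
    rw [sndCoalg, LinearMap.comp_assoc, rTensor_counit_comp_comul]; ext; simp
  have h : sndCoalg k A (A ⊗[k] (A ⊗[k] A)) ∘ₗ
      ((comul (R := k) (A := A)).lTensor A ∘ₗ comul).lTensor A =
      ((comul (R := k) (A := A)).lTensor A ∘ₗ comul) ∘ₗ sndCoalg k A A := by
    ext; simp [sndCoalg]
  rw [← LinearMap.comp_assoc, h, LinearMap.comp_assoc, h2, LinearMap.comp_id]

theorem conv_comp_twist {P : A →ₗ[k] H} (hP : IsCoalgMap P) (f g : H ⊗[k] A →ₗ[k] B) :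
    (f ⧆ g) ∘ₗ twist P = (LinearMap.mul' k B ∘ₗ TensorProduct.map f g ∘ₗ twistShuffle A P) ∘ₗ
      ((comul (R := k) (A := A)).lTensor A ∘ₗ comul).lTensor A ∘ₗ comul := by
  rw [conv, LinearMap.comp_assoc, comul_comp_twist hP]; rfl

theorem opConv_comp_twist {P : A →ₗ[k] H} (hP : IsCoalgMap P) (f g : H ⊗[k] A →ₗ[k] B) :
    (f ⧇ g) ∘ₗ twist P = (LinearMap.mul' k B ∘ₗ TensorProduct.map f g ∘ₗ
      (TensorProduct.comm k _ _).toLinearMap ∘ₗ twistShuffle A P) ∘ₗ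
      ((comul (R := k) (A := A)).lTensor A ∘ₗ comul).lTensor A ∘ₗ comul := by
  rw [opConv, LinearMap.comp_assoc, comul_comp_twist hP]; rfl

/-- With the next two lemmas, the three ways in which four legs collapse: an outer leg meets a
counit, or the two middle legs cancel through the antipode. -/
theorem comp_iterated_comul_of_counit_last {N : Type*} [AddCommGroup N] [Module k N]
    {W : A ⊗[k] (A ⊗[k] (A ⊗[k] A)) →ₗ[k] N} (V : A ⊗[k] (A ⊗[k] A) →ₗ[k] N)
    (h : ∀ a b c d, W (a ⊗ₜ (b ⊗ₜ (c ⊗ₜ d))) = counit (R := k) d • V (a ⊗ₜ (b ⊗ₜ c))) :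
    W ∘ₗ ((comul (R := k) (A := A)).lTensor A ∘ₗ comul).lTensor A ∘ₗ comul =
      V ∘ₗ (comul (R := k) (A := A)).lTensor A ∘ₗ comul := by
  have hW : W = V ∘ₗ ((fstCoalg k A A).lTensor A).lTensor A := by
    ext a b c d
    simp [h, fstCoalg, TensorProduct.tmul_smul]
  rw [hW, LinearMap.comp_assoc, lTensor_lTensor_fstCoalg_comp]

theorem comp_iterated_comul_of_counit_first {N : Type*} [AddCommGroup N] [Module k N]
    {W : A ⊗[k] (A ⊗[k] (A ⊗[k] A)) →ₗ[k] N} (V : A ⊗[k] (A ⊗[k] A) →ₗ[k] N)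
    (h : ∀ a b c d, W (a ⊗ₜ (b ⊗ₜ (c ⊗ₜ d))) = counit (R := k) a • V (b ⊗ₜ (c ⊗ₜ d))) :
    W ∘ₗ ((comul (R := k) (A := A)).lTensor A ∘ₗ comul).lTensor A ∘ₗ comul =
      V ∘ₗ (comul (R := k) (A := A)).lTensor A ∘ₗ comul := by
  have hW : W = V ∘ₗ sndCoalg k A (A ⊗[k] (A ⊗[k] A)) := by
    ext a b c d
    simp [h, sndCoalg]
  rw [hW, LinearMap.comp_assoc, sndCoalg_comp]

/-- The middle legs enter in the order `S(P u₃) P(u₂)`, opposite to the antipode axiom; the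
cancellation therefore needs `S² = id`. -/
theorem comp_iterated_comul_of_antipode (hS : ∀ x : H, antipode k (antipode k x) = x)
    {P : A →ₗ[k] H} (hP : IsCoalgMap P) {N : Type*} [AddCommGroup N] [Module k N]
    {W : A ⊗[k] (A ⊗[k] (A ⊗[k] A)) →ₗ[k] N} (V : A ⊗[k] (H ⊗[k] A) →ₗ[k] N)
    (h : ∀ a b c d, W (a ⊗ₜ (b ⊗ₜ (c ⊗ₜ d))) = V (a ⊗ₜ ((antipode k (P c) * P b) ⊗ₜ d))) :
    W ∘ₗ ((comul (R := k) (A := A)).lTensor A ∘ₗ comul).lTensor A ∘ₗ comul =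
      (V ∘ₗ (TensorProduct.mk k H A 1).lTensor A) ∘ₗ comul := by
  let m : A ⊗[k] A →ₗ[k] H := LinearMap.mul' k H ∘ₗ TensorProduct.map (antipode k ∘ₗ P) P ∘ₗ
    (TensorProduct.comm k A A).toLinearMap
  have hm : m ∘ₗ comul = convUnit k A H := by
    rw [← hP.convUnit_comp, ← antipode_opConv_algHom hS (AlgHom.id k H), hP.opConv_comp]
    rfl
  have hW : W = V ∘ₗ (m.rTensor A ∘ₗ (TensorProduct.assoc k A A A).symm.toLinearMap).lTensor A := by
    ext a b c d
    simp [h, m]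
  have h1 : m.rTensor A ∘ₗ (TensorProduct.assoc k A A A).symm.toLinearMap ∘ₗ
      (comul (R := k) (A := A)).lTensor A ∘ₗ comul = TensorProduct.mk k H A 1 := by
    rw [← coassoc, ← LinearMap.comp_assoc _ (TensorProduct.assoc k A A A).toLinearMap]
    have : (TensorProduct.assoc k A A A).symm.toLinearMap ∘ₗ
      (TensorProduct.assoc k A A A).toLinearMap = LinearMap.id := by ext; simp
    rw [this, LinearMap.id_comp, ← LinearMap.comp_assoc, ← LinearMap.rTensor_comp, hm, convUnit,
      LinearMap.rTensor_comp, LinearMap.comp_assoc, rTensor_counit_comp_comul]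
    ext; simp
  rw [hW, LinearMap.comp_assoc, ← LinearMap.comp_assoc comul, ← LinearMap.lTensor_comp,
    LinearMap.comp_assoc _ _ (m.rTensor A), h1, LinearMap.comp_assoc]

/-- `α` reads the outermost leg `u₁` while `u₄` dies under the counit, so the product order is
unchanged. -/
theorem conv_sndCoalg_comp_twist {P : A →ₗ[k] H} (hP : IsCoalgMap P) (α : A →ₗ[k] B)
    (f : H ⊗[k] A →ₗ[k] B) :
    ((α ∘ₗ sndCoalg k H A) ⧆ f) ∘ₗ twist P = α ⧆ (f ∘ₗ twist P) := by
  have hc : ∀ d, counit (R := k) (P d) = counit (R := k) d := LinearMap.congr_fun hP.counit_comp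
  rw [conv_comp_twist hP, comp_twist, conv_comul_right]
  refine comp_iterated_comul_of_counit_last _ fun a b c d => ?_
  simp [sndCoalg, hc]

theorem opConv_sndCoalg_comp_twist {P : A →ₗ[k] H} (hP : IsCoalgMap P) (α : A →ₗ[k] B)
    (f : H ⊗[k] A →ₗ[k] B) :
    (f ⧇ (α ∘ₗ sndCoalg k H A)) ∘ₗ twist P = (f ∘ₗ twist P) ⧇ α := by
  have hc : ∀ d, counit (R := k) (P d) = counit (R := k) d := LinearMap.congr_fun hP.counit_comp
  rw [opConv_comp_twist hP, comp_twist, opConv_comul_left]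
  refine comp_iterated_comul_of_counit_last _ fun a b c d => ?_
  simp [sndCoalg, hc]

/-- `β` reads `S(P u₄)`, the last leg, although it stands on the left; this is why `⧆` turns into
`⧇`. -/
theorem conv_fstCoalg_comp_twist {P : A →ₗ[k] H} (hP : IsCoalgMap P) (β : H →ₗ[k] B)
    (f : H ⊗[k] A →ₗ[k] B) :
    ((β ∘ₗ fstCoalg k H A) ⧆ f) ∘ₗ twist P = (β ∘ₗ (antipode k ∘ₗ P)) ⧇ (f ∘ₗ twist P) := by
  rw [conv_comp_twist hP, comp_twist, opConv_comul_right]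
  refine comp_iterated_comul_of_counit_first _ fun a b c d => ?_
  simp [fstCoalg]

theorem opConv_fstCoalg_comp_twist {P : A →ₗ[k] H} (hP : IsCoalgMap P) (β : H →ₗ[k] B)
    (f : H ⊗[k] A →ₗ[k] B) :
    (f ⧇ (β ∘ₗ fstCoalg k H A)) ∘ₗ twist P = (f ∘ₗ twist P) ⧆ (β ∘ₗ (antipode k ∘ₗ P)) := by
  rw [opConv_comp_twist hP, comp_twist, conv_comul_left]
  refine comp_iterated_comul_of_counit_first _ fun a b c d => ?_
  simp [fstCoalg]

theorem conv_mul_comp_twist (hS : ∀ x : H, antipode k (antipode k x) = x)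
    {P : A →ₗ[k] H} (hP : IsCoalgMap P) (ρ : H →ₗ[k] B) (hρ : ρ 1 = 1)
    (f : H ⊗[k] A →ₗ[k] B) :
    (f ⧆ (ρ ∘ₗ (LinearMap.mul' k H ∘ₗ P.lTensor H))) ∘ₗ twist P = f ∘ₗ twist P := by
  rw [conv_comp_twist hP, comp_twist]
  refine (comp_iterated_comul_of_antipode hS hP (LinearMap.mul' k B ∘ₗ TensorProduct.map
    (f ∘ₗ TensorProduct.map (antipode k ∘ₗ P) LinearMap.id ∘ₗ
      (TensorProduct.comm k A A).toLinearMap) ρ ∘ₗ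
      (TensorProduct.assoc k A A H).symm.toLinearMap ∘ₗ
        (TensorProduct.comm k H A).toLinearMap.lTensor A) fun a b c d => ?_).trans ?_
  · simp
  · congr 1; ext; simp [hρ]

theorem mul_opConv_comp_twist (hS : ∀ x : H, antipode k (antipode k x) = x)
    {P : A →ₗ[k] H} (hP : IsCoalgMap P) (ρ : H →ₗ[k] B) (hρ : ρ 1 = 1)
    (f : H ⊗[k] A →ₗ[k] B) :
    ((ρ ∘ₗ (LinearMap.mul' k H ∘ₗ P.lTensor H)) ⧇ f) ∘ₗ twist P = f ∘ₗ twist P := by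
  rw [opConv_comp_twist hP, comp_twist]
  refine (comp_iterated_comul_of_antipode hS hP (LinearMap.mul' k B ∘ₗ
    (TensorProduct.comm k B B).toLinearMap ∘ₗ TensorProduct.map
    (f ∘ₗ TensorProduct.map (antipode k ∘ₗ P) LinearMap.id ∘ₗ
      (TensorProduct.comm k A A).toLinearMap) ρ ∘ₗ
      (TensorProduct.assoc k A A H).symm.toLinearMap ∘ₗ
        (TensorProduct.comm k H A).toLinearMap.lTensor A) fun a b c d => ?_).trans ?_
  · simp
  · congr 1; ext; simp [hρ]

theorem sndCoalg_comp_twist {P : A →ₗ[k] H} (hP : IsCoalgMap P) :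
    sndCoalg k H A ∘ₗ twist P = LinearMap.id := by
  have h2 : fstCoalg k A A ∘ₗ comul = LinearMap.id := by
    rw [fstCoalg, LinearMap.comp_assoc, lTensor_counit_comp_comul]; ext; simp
  have hc : ∀ d, counit (R := k) (P d) = counit (R := k) d := LinearMap.congr_fun hP.counit_comp
  rw [comp_twist, ← h2]
  congr 1; ext; simp [sndCoalg, fstCoalg, hc]

end Twist
end
end GerstenhaberSchack

open scoped TensorProduct
namespace GerstenhaberSchack
noncomputable section
open TensorProduct Coalgebra HopfAlgebra
universe u v
variable {k : Type u} [Field k] {H : Type v} [Ring H] [HopfAlgebra k H]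

/-! ### Projections to the first and last tensor factors -/

section Factors

variable (k H) in
/-- The first factor of an element of `H ^ ⊗ (n + 1)`, the other ones being killed by `ε`. -/
def firstFactor (n : ℕ) : T k H (n + 1) →ₗ[k] H :=
  fstCoalg k H (T k H n) ∘ₗ (cons k H n).symm.toLinearMap

variable (k H) in
/-- The last factor of an element of `H ^ ⊗ (n + 1)`, the other ones being killed by `ε`. -/
def lastFactor (n : ℕ) : T k H (n + 1) →ₗ[k] H :=
  sndCoalg k (T k H n) H ∘ₗ (snoc k H n).symm.toLinearMap

theorem counitAt_zero_eq (n : ℕ) : counitAt k H n 0 =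
    sndCoalg k H (T k H n) ∘ₗ (cons k H n).symm.toLinearMap :=
  ext_cons fun a x => by simp [counitAt_zero_cons, sndCoalg]

theorem counitAt_last_eq (n : ℕ) : counitAt k H n n =
    fstCoalg k (T k H n) H ∘ₗ (snoc k H n).symm.toLinearMap :=
  ext_snoc fun x a => by simp [counitAt_last_snoc, fstCoalg]

theorem counit_cons (n : ℕ) (a : H) (x : T k H n) :
    counit (R := k) (cons k H n (a ⊗ₜ x)) = counit (R := k) a * counit (R := k) x := by
  simp [counit_eq_counit_prod, prod_cons]

theorem firstFactor_cons (n : ℕ) (a : H) (x : T k H n) :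
    firstFactor k H n (cons k H n (a ⊗ₜ x)) = counit (R := k) x • a := by
  simp [firstFactor, fstCoalg]

theorem lastFactor_snoc (n : ℕ) (x : T k H n) (a : H) :
    lastFactor k H n (snoc k H n (x ⊗ₜ a)) = counit (R := k) x • a := by
  simp [lastFactor, sndCoalg]

theorem isCoalgMap_cons_symm (n : ℕ) : IsCoalgMap (cons k H n).symm.toLinearMap :=
  (isCoalgMap_cons n).symm

theorem isCoalgMap_snoc_symm (n : ℕ) : IsCoalgMap (snoc k H n).symm.toLinearMap :=
  (isCoalgMap_snoc n).symm

theorem isCoalgMap_counitAt_zero (n : ℕ) : IsCoalgMap (counitAt k H n 0) := by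
  rw [counitAt_zero_eq]; exact isCoalgMap_sndCoalg.comp (isCoalgMap_cons_symm n)

theorem isCoalgMap_counitAt_last (n : ℕ) : IsCoalgMap (counitAt k H n n) := by
  rw [counitAt_last_eq]; exact isCoalgMap_fstCoalg.comp (isCoalgMap_snoc_symm n)

theorem isCoalgMap_firstFactor (n : ℕ) : IsCoalgMap (firstFactor k H n) :=
  isCoalgMap_fstCoalg.comp (isCoalgMap_cons_symm n)

theorem isCoalgMap_lastFactor (n : ℕ) : IsCoalgMap (lastFactor k H n) :=
  isCoalgMap_sndCoalg.comp (isCoalgMap_snoc_symm n)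

theorem cocommute_firstFactor_counitAt (n : ℕ) :
    Cocommute (firstFactor k H n) (counitAt k H n 0) := by
  rw [counitAt_zero_eq]
  exact cocommute_fstCoalg_sndCoalg.precomp (isCoalgMap_cons_symm n)

theorem cocommute_counitAt_lastFactor (n : ℕ) :
    Cocommute (counitAt k H n n) (lastFactor k H n) := by
  rw [counitAt_last_eq]
  exact cocommute_fstCoalg_sndCoalg.precomp (isCoalgMap_snoc_symm n)

variable {B : Type*} [Ring B] [Algebra k B]

/-- Dual to `cons_eq_mul`: a map defined factor by factor is a convolution product of maps that each
see only one part of the tensor. -/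
theorem conv_firstFactor_counitAt (n : ℕ) (β : H →ₗ[k] B) (f : T k H n →ₗ[k] B) :
    (β ∘ₗ firstFactor k H n) ⧆ (f ∘ₗ counitAt k H n 0) =
      LinearMap.mul' k B ∘ₗ TensorProduct.map β f ∘ₗ (cons k H n).symm.toLinearMap := by
  rw [counitAt_zero_eq, firstFactor, ← LinearMap.comp_assoc, ← LinearMap.comp_assoc,
    ← (isCoalgMap_cons_symm n).conv_comp, conv_fstCoalg_sndCoalg, LinearMap.comp_assoc]

theorem conv_counitAt_lastFactor (n : ℕ) (f : T k H n →ₗ[k] B) (β : H →ₗ[k] B) :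
    (f ∘ₗ counitAt k H n n) ⧆ (β ∘ₗ lastFactor k H n) =
      LinearMap.mul' k B ∘ₗ TensorProduct.map f β ∘ₗ (snoc k H n).symm.toLinearMap := by
  rw [counitAt_last_eq, lastFactor, ← LinearMap.comp_assoc, ← LinearMap.comp_assoc,
    ← (isCoalgMap_snoc_symm n).conv_comp, conv_fstCoalg_sndCoalg, LinearMap.comp_assoc]

theorem prod_succ (n : ℕ) :
    prod k H (n + 1) = firstFactor k H n ⧆ (prod k H n ∘ₗ counitAt k H n 0) := by
  rw [← LinearMap.id_comp (firstFactor k H n), conv_firstFactor_counitAt]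
  exact ext_cons fun a x => by simp [prod_cons]

theorem prod_succ' (n : ℕ) :
    prod k H (n + 1) = (prod k H n ∘ₗ counitAt k H n n) ⧆ lastFactor k H n := by
  rw [← LinearMap.id_comp (lastFactor k H n), conv_counitAt_lastFactor]
  exact ext_snoc fun x a => by simp [prod_snoc]

theorem lastFactor_succ (n : ℕ) :
    lastFactor k H (n + 1) = lastFactor k H n ∘ₗ counitAt k H (n + 1) 0 := by
  refine ext_cons fun a x => ?_
  induction x using snoc_induction with
  | zero => simp
  | add _ _ h1 h2 => simp only [TensorProduct.tmul_add, map_add, h1, h2]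
  | snoc x b =>
    rw [cons_snoc, lastFactor_snoc, ← cons_snoc]
    simp [counitAt_zero_cons, lastFactor_snoc, counit_cons, mul_smul]

theorem firstFactor_succ (n : ℕ) :
    firstFactor k H (n + 1) = firstFactor k H n ∘ₗ counitAt k H (n + 1) (n + 1) := by
  refine ext_cons fun a x => ?_
  rw [firstFactor_cons, LinearMap.comp_apply, counitAt_succ_cons, firstFactor_cons]
  congr 1
  exact (LinearMap.congr_fun (isCoalgMap_counitAt_last n).counit_comp x).symm

theorem antipode_comp_conv {A : Type*} [AddCommGroup A] [Module k A] [Coalgebra k A]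
    (f g : A →ₗ[k] H) :
    antipode k ∘ₗ (f ⧆ g) = (antipode k ∘ₗ g) ⧇ (antipode k ∘ₗ f) := by
  ext u
  simp [conv_apply (ℛ k u), opConv_apply (ℛ k u), antipode_mul_antidistrib]

end Factors

/-! ### The map `antipodeCons`, dual to `contract` -/

section AntipodeCons

variable (k H) in
/-- `u ↦ S(u¹₍₂₎ ⋯ uⁿ₍₂₎) ⊗ u₍₁₎`. -/
def antipodeCons (n : ℕ) : T k H n →ₗ[k] T k H (n + 1) :=
  (cons k H n).toLinearMap ∘ₗ twist (prod k H n)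

theorem antipodeCons_eq_opConv (n : ℕ) : antipodeCons k H n =
    ((firstHom k H n).toLinearMap ∘ₗ (antipode k ∘ₗ prod k H n)) ⧇
      (consOne k H n).toLinearMap := by
  have h : (cons k H n).toLinearMap ∘ₗ TensorProduct.map (antipode k ∘ₗ prod k H n) LinearMap.id =
      LinearMap.mul' k _ ∘ₗ TensorProduct.map
        ((firstHom k H n).toLinearMap ∘ₗ (antipode k ∘ₗ prod k H n))
          (consOne k H n).toLinearMap := by
    ext; simp [cons_eq_mul]
  rw [opConv, ← LinearMap.comp_assoc (TensorProduct.comm k _ _).toLinearMap, ← h]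
  rfl

variable {B : Type*} [Ring B] [Algebra k B]

theorem comp_antipodeCons (n : ℕ) (f : T k H (n + 1) →ₗ[k] B) : f ∘ₗ antipodeCons k H n =
    (f ∘ₗ (cons k H n).toLinearMap) ∘ₗ twist (prod k H n) := rfl

theorem counitAt_zero_comp_cons (n : ℕ) :
    counitAt k H n 0 ∘ₗ (cons k H n).toLinearMap = sndCoalg k H (T k H n) := by
  rw [counitAt_zero_eq]; ext; simp

theorem firstFactor_comp_cons (n : ℕ) :
    firstFactor k H n ∘ₗ (cons k H n).toLinearMap = fstCoalg k H (T k H n) := by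
  rw [firstFactor]; ext; simp

theorem prod_comp_cons (n : ℕ) : prod k H (n + 1) ∘ₗ (cons k H n).toLinearMap =
    LinearMap.mul' k H ∘ₗ (prod k H n).lTensor H := by
  ext; simp [prod_cons]

theorem conv_counitAt_comp_antipodeCons (n : ℕ) (α : T k H n →ₗ[k] B)
    (f : T k H (n + 1) →ₗ[k] B) :
    ((α ∘ₗ counitAt k H n 0) ⧆ f) ∘ₗ antipodeCons k H n = α ⧆ (f ∘ₗ antipodeCons k H n) := by
  rw [comp_antipodeCons, (isCoalgMap_cons n).conv_comp, LinearMap.comp_assoc,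
    counitAt_zero_comp_cons, conv_sndCoalg_comp_twist (isCoalgMap_prod n), comp_antipodeCons]

theorem opConv_counitAt_comp_antipodeCons (n : ℕ) (α : T k H n →ₗ[k] B)
    (f : T k H (n + 1) →ₗ[k] B) :
    (f ⧇ (α ∘ₗ counitAt k H n 0)) ∘ₗ antipodeCons k H n = (f ∘ₗ antipodeCons k H n) ⧇ α := by
  rw [comp_antipodeCons, (isCoalgMap_cons n).opConv_comp, LinearMap.comp_assoc _ _ α,
    counitAt_zero_comp_cons, opConv_sndCoalg_comp_twist (isCoalgMap_prod n), comp_antipodeCons]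

theorem conv_firstFactor_comp_antipodeCons (n : ℕ) (β : H →ₗ[k] B)
    (f : T k H (n + 1) →ₗ[k] B) :
    ((β ∘ₗ firstFactor k H n) ⧆ f) ∘ₗ antipodeCons k H n =
      (β ∘ₗ (antipode k ∘ₗ prod k H n)) ⧇ (f ∘ₗ antipodeCons k H n) := by
  rw [comp_antipodeCons, (isCoalgMap_cons n).conv_comp, LinearMap.comp_assoc,
    firstFactor_comp_cons, conv_fstCoalg_comp_twist (isCoalgMap_prod n), comp_antipodeCons]

theorem opConv_firstFactor_comp_antipodeCons (n : ℕ) (β : H →ₗ[k] B)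
    (f : T k H (n + 1) →ₗ[k] B) :
    (f ⧇ (β ∘ₗ firstFactor k H n)) ∘ₗ antipodeCons k H n =
      (f ∘ₗ antipodeCons k H n) ⧆ (β ∘ₗ (antipode k ∘ₗ prod k H n)) := by
  rw [comp_antipodeCons, (isCoalgMap_cons n).opConv_comp, LinearMap.comp_assoc _ _ β,
    firstFactor_comp_cons, opConv_fstCoalg_comp_twist (isCoalgMap_prod n), comp_antipodeCons]

/-- Multiplying all factors of `S(P u₂) ⊗ u₁` gives `S(P u₂) P(u₁)`, which is trivial. So a full
`DP` may be inserted or deleted in front of `antipodeCons`. -/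
theorem conv_prod_comp_antipodeCons (hS : ∀ x : H, antipode k (antipode k x) = x) (n : ℕ)
    (D : H →ₐ[k] B) (f : T k H (n + 1) →ₗ[k] B) :
    (f ⧆ (D.toLinearMap ∘ₗ prod k H (n + 1))) ∘ₗ antipodeCons k H n = f ∘ₗ antipodeCons k H n := by
  rw [comp_antipodeCons, (isCoalgMap_cons n).conv_comp, LinearMap.comp_assoc _ _ D.toLinearMap,
    prod_comp_cons, conv_mul_comp_twist hS (isCoalgMap_prod n) _ (map_one D), comp_antipodeCons]

theorem prod_opConv_comp_antipodeCons (hS : ∀ x : H, antipode k (antipode k x) = x) (n : ℕ)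
    (D : H →ₐ[k] B) (f : T k H (n + 1) →ₗ[k] B) :
    ((D.toLinearMap ∘ₗ prod k H (n + 1)) ⧇ f) ∘ₗ antipodeCons k H n = f ∘ₗ antipodeCons k H n := by
  rw [comp_antipodeCons, (isCoalgMap_cons n).opConv_comp, LinearMap.comp_assoc,
    prod_comp_cons, mul_opConv_comp_twist hS (isCoalgMap_prod n) _ (map_one D), comp_antipodeCons]

theorem counitAt_zero_comp_antipodeCons (n : ℕ) :
    counitAt k H n 0 ∘ₗ antipodeCons k H n = LinearMap.id := by
  rw [antipodeCons, ← LinearMap.comp_assoc, counitAt_zero_comp_cons,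
    sndCoalg_comp_twist (isCoalgMap_prod n)]

theorem shift_comp_antipodeCons {a b : ℕ} {g : T k H a →ₗ[k] T k H b} (hg : IsCoalgMap g)
    (hP : prod k H b ∘ₗ g = prod k H a) :
    shift g ∘ₗ antipodeCons k H a = antipodeCons k H b ∘ₗ g := by
  have h : TensorProduct.map (antipode k ∘ₗ prod k H b) LinearMap.id ∘ₗ
      (TensorProduct.comm k _ _).toLinearMap ∘ₗ TensorProduct.map g g =
      g.lTensor H ∘ₗ TensorProduct.map (antipode k ∘ₗ prod k H a) LinearMap.id ∘ₗ
        (TensorProduct.comm k _ _).toLinearMap := by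
    rw [← hP]; ext; simp
  have h2 : shift g ∘ₗ (cons k H a).toLinearMap = (cons k H b).toLinearMap ∘ₗ g.lTensor H := by
    ext; simp [shift]
  rw [antipodeCons, antipodeCons, twist, twist, ← LinearMap.comp_assoc, h2]
  have h3 := congrArg (fun x => (cons k H b).toLinearMap ∘ₗ x ∘ₗ comul) h
  simp only [LinearMap.comp_assoc] at h3 ⊢
  rw [hg.comul_comp]
  exact h3.symm

theorem algHom_conv_antipode_comp {A : Type*} [AddCommGroup A] [Module k A] [Coalgebra k A]
    (D : H →ₐ[k] B) {P : A →ₗ[k] H} (hP : IsCoalgMap P) :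
    (D.toLinearMap ∘ₗ P) ⧆ (D.toLinearMap ∘ₗ (antipode k ∘ₗ P)) = convUnit k A B := by
  rw [← LinearMap.comp_assoc, ← hP.conv_comp, algHom_conv_antipode, hP.convUnit_comp]

theorem algHom_opConv_antipode_comp {A : Type*} [AddCommGroup A] [Module k A] [Coalgebra k A]
    (hS : ∀ x : H, antipode k (antipode k x) = x)
    (D : H →ₐ[k] B) {P : A →ₗ[k] H} (hP : IsCoalgMap P) :
    (D.toLinearMap ∘ₗ P) ⧇ (D.toLinearMap ∘ₗ (antipode k ∘ₗ P)) = convUnit k A B := by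
  rw [← LinearMap.comp_assoc, ← hP.opConv_comp, algHom_opConv_antipode hS, hP.convUnit_comp]

theorem antipode_opConv_algHom_comp {A : Type*} [AddCommGroup A] [Module k A] [Coalgebra k A]
    (hS : ∀ x : H, antipode k (antipode k x) = x)
    (D : H →ₐ[k] B) {P : A →ₗ[k] H} (hP : IsCoalgMap P) :
    (D.toLinearMap ∘ₗ (antipode k ∘ₗ P)) ⧇ (D.toLinearMap ∘ₗ P) = convUnit k A B := by
  rw [← LinearMap.comp_assoc, ← hP.opConv_comp, antipode_opConv_algHom hS, hP.convUnit_comp]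

/-- A factor `P` in the first slot is inserted for free and cancels the `SP` of the outer map,
leaving `1` there. -/
theorem antipodeCons_comp_antipodeCons (hS : ∀ x : H, antipode k (antipode k x) = x) (n : ℕ) :
    antipodeCons k H (n + 1) ∘ₗ antipodeCons k H n =
      (consOne k H (n + 1)).toLinearMap ∘ₗ antipodeCons k H n := by
  rw [← prod_opConv_comp_antipodeCons hS n (firstHom k H (n + 1)), antipodeCons_eq_opConv (n + 1),
    ← opConv_assoc, algHom_opConv_antipode_comp hS _ (isCoalgMap_prod _), convUnit_opConv]

end AntipodeCons
end
end GerstenhaberSchack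

open scoped TensorProduct
namespace GerstenhaberSchack
noncomputable section
open TensorProduct Coalgebra HopfAlgebra
universe u v
variable {k : Type u} [Field k] {H : Type v} [Ring H] [HopfAlgebra k H]

/-! ### Products and units seen from the last factor -/

section SnocSimplicial

theorem mulAt_snoc (n i : ℕ) (hi : i < n) (x : T k H (n + 1)) (b : H) :
    mulAt k H (n + 1) i (snoc k H (n + 1) (x ⊗ₜ b)) = snoc k H n (mulAt k H n i x ⊗ₜ b) := by
  induction n generalizing i with
  | zero => omega
  | succ n ih =>
    induction x using cons_induction with
    | zero => simp
    | add _ _ h1 h2 => simp only [TensorProduct.add_tmul, map_add, h1, h2]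
    | cons a x =>
      rcases i with _ | i
      · induction x using cons_induction with
        | zero => simp
        | add _ _ h1 h2 => simp only [TensorProduct.tmul_add, TensorProduct.add_tmul, map_add, h1, h2]
        | cons c x =>
          rw [← cons_snoc, ← cons_snoc, mulAt_zero_cons, mulAt_zero_cons, cons_snoc]
      · rw [← cons_snoc, mulAt_succ_cons, ih i (by omega), mulAt_succ_cons, cons_snoc]

theorem mulAt_last_snoc (n : ℕ) (x : T k H n) (a b : H) :
    mulAt k H (n + 1) n (snoc k H (n + 1) (snoc k H n (x ⊗ₜ a) ⊗ₜ b)) =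
      snoc k H n (x ⊗ₜ (a * b)) := by
  induction n with
  | zero =>
    have h := LinearMap.congr_fun (ext_zero (f := mulAt k H 1 0 ∘ₗ (snoc k H 1).toLinearMap ∘ₗ
      (TensorProduct.mk k _ H).flip b ∘ₗ (snoc k H 0).toLinearMap ∘ₗ
      (TensorProduct.mk k _ H).flip a)
      (g := (snoc k H 0).toLinearMap ∘ₗ (TensorProduct.mk k _ H).flip (a * b)) ?_) x
    · simpa using h
    · simp only [LinearMap.comp_apply, LinearMap.flip_apply, TensorProduct.mk_apply,
        LinearEquiv.coe_coe]
      rw [← cons_zero_eq_snoc, ← cons_snoc, ← cons_zero_eq_snoc, mulAt_zero_cons,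
        cons_zero_eq_snoc]
  | succ n ih =>
    induction x using cons_induction with
    | zero => simp
    | add _ _ h1 h2 => simp only [TensorProduct.add_tmul, map_add, h1, h2]
    | cons c x => rw [← cons_snoc, ← cons_snoc, mulAt_succ_cons, ih, cons_snoc]

theorem oneAt_snoc (n j : ℕ) (hj : j ≤ n) (x : T k H n) (b : H) :
    oneAt k H (n + 1) j (snoc k H n (x ⊗ₜ b)) = snoc k H (n + 1) (oneAt k H n j x ⊗ₜ b) := by
  induction n generalizing j with
  | zero =>
    obtain rfl : j = 0 := by omega
    rw [oneAt_zero, oneAt_zero, cons_snoc]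
  | succ n ih =>
    rcases j with _ | j
    · rw [oneAt_zero, oneAt_zero, cons_snoc]
    induction x using cons_induction with
    | zero => simp
    | add _ _ h1 h2 => simp only [TensorProduct.add_tmul, map_add, h1, h2]
    | cons c x => rw [← cons_snoc, oneAt_succ_cons, ih j (by omega), oneAt_succ_cons, cons_snoc]

theorem oneAt_last (n : ℕ) : oneAt k H n n = (snocOne k H n).toLinearMap := by
  induction n with
  | zero =>
    refine ext_zero ?_
    rw [oneAt_zero, cons_zero_eq_snoc]; rfl
  | succ n ih =>
    refine ext_cons fun a x => ?_
    rw [oneAt_succ_cons, ih, AlgHom.toLinearMap_apply, AlgHom.toLinearMap_apply, snocOne_apply,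
      snocOne_apply, cons_snoc]

theorem prod_comp_mulAt (n i : ℕ) (hi : i < n) :
    prod k H n ∘ₗ mulAt k H n i = prod k H (n + 1) := by
  induction n generalizing i with
  | zero => omega
  | succ n ih =>
    refine ext_cons fun a x => ?_
    rcases i with _ | i
    · induction x using cons_induction with
      | zero => simp
      | add _ _ h1 h2 => simp only [TensorProduct.tmul_add, map_add, h1, h2]
      | cons c x => simp [mulAt_zero_cons, prod_cons, mul_assoc]
    · have := LinearMap.congr_fun (ih i (by omega)) x
      simp only [LinearMap.comp_apply] at this
      simp [mulAt_succ_cons, prod_cons, this]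

theorem prod_comp_oneAt (n j : ℕ) (hj : j ≤ n) :
    prod k H (n + 1) ∘ₗ oneAt k H n j = prod k H n := by
  induction n generalizing j with
  | zero =>
    obtain rfl : j = 0 := by omega
    refine LinearMap.ext fun x => ?_
    rw [LinearMap.comp_apply, oneAt_zero, prod_cons, one_mul]
  | succ n ih =>
    rcases j with _ | j
    · refine LinearMap.ext fun x => ?_
      rw [LinearMap.comp_apply, oneAt_zero, prod_cons, one_mul]
    refine ext_cons fun a x => ?_
    have := LinearMap.congr_fun (ih j (by omega)) x
    simp only [LinearMap.comp_apply] at this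
    simp [oneAt_succ_cons, prod_cons, this]

end SnocSimplicial

/-! ### Columns: cofaces and cyclic operator over an algebra map from `H` -/

section Columns

variable {B : Type*} [Ring B] [Algebra k B] (D : H →ₐ[k] B)

/-- The coface of index `0` of a map `f : H ^ ⊗ n → B`, given `D : H → B`. -/
def actFirst {n : ℕ} (f : T k H n →ₗ[k] B) : T k H (n + 1) →ₗ[k] B :=
  LinearMap.mul' k B ∘ₗ TensorProduct.map D.toLinearMap f ∘ₗ (cons k H n).symm.toLinearMap

/-- The coface of index `n + 1` of a map `f : H ^ ⊗ n → B`, given `D : H → B`. -/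
def actLast {n : ℕ} (f : T k H n →ₗ[k] B) : T k H (n + 1) →ₗ[k] B :=
  LinearMap.mul' k B ∘ₗ TensorProduct.map f D.toLinearMap ∘ₗ (snoc k H n).symm.toLinearMap

/-- The cofaces of a map `f : H ^ ⊗ n → B`, given `D : H → B`. -/
def colCoface {n : ℕ} (i : ℕ) (f : T k H n →ₗ[k] B) : T k H (n + 1) →ₗ[k] B :=
  if i = 0 then actFirst D f else if i = n + 1 then actLast D f
  else f ∘ₗ mulAt k H n (i - 1)

/-- The cyclic operator on maps `H ^ ⊗ n → B`, given `D : H → B`. -/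
def colCyc {n : ℕ} (f : T k H n →ₗ[k] B) : T k H n →ₗ[k] B :=
  (D.toLinearMap ∘ₗ prod k H n) ⧇ (actLast D f ∘ₗ antipodeCons k H n)

theorem colCoface_zero {n : ℕ} (f : T k H n →ₗ[k] B) : colCoface D 0 f = actFirst D f := if_pos rfl

theorem colCoface_last {n : ℕ} (f : T k H n →ₗ[k] B) : colCoface D (n + 1) f = actLast D f := by
  simp [colCoface]

theorem colCoface_inner {n i : ℕ} (hi : i < n) (f : T k H n →ₗ[k] B) :
    colCoface D (i + 1) f = f ∘ₗ mulAt k H n i := by simp [colCoface, hi.ne]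

theorem actFirst_cons {n : ℕ} (f : T k H n →ₗ[k] B) (a : H) (x : T k H n) :
    actFirst D f (cons k H n (a ⊗ₜ x)) = D a * f x := by simp [actFirst]

theorem actLast_snoc {n : ℕ} (f : T k H n →ₗ[k] B) (x : T k H n) (a : H) :
    actLast D f (snoc k H n (x ⊗ₜ a)) = f x * D a := by simp [actLast]

theorem actFirst_eq_conv {n : ℕ} (f : T k H n →ₗ[k] B) : actFirst D f =
    (D.toLinearMap ∘ₗ firstFactor k H n) ⧆ (f ∘ₗ counitAt k H n 0) :=
  (conv_firstFactor_counitAt n _ _).symm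

theorem actFirst_eq_opConv {n : ℕ} (f : T k H n →ₗ[k] B) : actFirst D f =
    (D.toLinearMap ∘ₗ firstFactor k H n) ⧇ (f ∘ₗ counitAt k H n 0) := by
  rw [actFirst_eq_conv, Cocommute.opConv_eq]
  exact (cocommute_firstFactor_counitAt n).postcomp _ _

theorem actLast_eq_conv {n : ℕ} (f : T k H n →ₗ[k] B) : actLast D f =
    (f ∘ₗ counitAt k H n n) ⧆ (D.toLinearMap ∘ₗ lastFactor k H n) :=
  (conv_counitAt_lastFactor n _ _).symm

theorem actLast_eq_opConv {n : ℕ} (f : T k H n →ₗ[k] B) : actLast D f =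
    (f ∘ₗ counitAt k H n n) ⧇ (D.toLinearMap ∘ₗ lastFactor k H n) := by
  rw [actLast_eq_conv, Cocommute.opConv_eq]
  exact (cocommute_counitAt_lastFactor n).postcomp _ _

theorem actLast_actFirst {n : ℕ} (f : T k H n →ₗ[k] B) :
    actLast D (actFirst D f) = actFirst D (actLast D f) := by
  refine ext_cons fun a x => ?_
  induction x using snoc_induction with
  | zero => simp
  | add _ _ h1 h2 => simp only [TensorProduct.tmul_add, map_add, h1, h2]
  | snoc x b =>
    rw [actFirst_cons, actLast_snoc, cons_snoc, actLast_snoc, actFirst_cons, mul_assoc]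

theorem actFirst_comp_mulAt_zero {n : ℕ} (f : T k H n →ₗ[k] B) :
    actFirst D f ∘ₗ mulAt k H (n + 1) 0 = actFirst D (actFirst D f) := by
  refine ext_cons fun a x => ?_
  induction x using cons_induction with
  | zero => simp
  | add _ _ h1 h2 => simp only [TensorProduct.tmul_add, map_add, h1, h2]
  | cons b x =>
    rw [LinearMap.comp_apply, mulAt_zero_cons, actFirst_cons, actFirst_cons, actFirst_cons,
      map_mul, mul_assoc]

theorem actFirst_comp_mulAt_succ {n : ℕ} (i : ℕ) (f : T k H n →ₗ[k] B) :
    actFirst D f ∘ₗ mulAt k H (n + 1) (i + 1) = actFirst D (f ∘ₗ mulAt k H n i) :=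
  ext_cons fun a x => by
    rw [LinearMap.comp_apply, mulAt_succ_cons, actFirst_cons, actFirst_cons, LinearMap.comp_apply]

theorem actFirst_comp_oneAt_succ {n : ℕ} (j : ℕ) (f : T k H (n + 1) →ₗ[k] B) :
    actFirst D f ∘ₗ oneAt k H (n + 1) (j + 1) = actFirst D (f ∘ₗ oneAt k H n j) :=
  ext_cons fun a x => by
    rw [LinearMap.comp_apply, oneAt_succ_cons, actFirst_cons, actFirst_cons, LinearMap.comp_apply]

theorem actLast_comp_mulAt {n i : ℕ} (hi : i < n) (f : T k H n →ₗ[k] B) :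
    actLast D f ∘ₗ mulAt k H (n + 1) i = actLast D (f ∘ₗ mulAt k H n i) :=
  ext_snoc fun x a => by
    rw [LinearMap.comp_apply, mulAt_snoc _ _ hi, actLast_snoc, actLast_snoc, LinearMap.comp_apply]

theorem actLast_comp_mulAt_last {n : ℕ} (f : T k H n →ₗ[k] B) :
    actLast D f ∘ₗ mulAt k H (n + 1) n = actLast D (actLast D f) := by
  refine ext_snoc fun x b => ?_
  induction x using snoc_induction with
  | zero => simp
  | add _ _ h1 h2 => simp only [TensorProduct.add_tmul, map_add, h1, h2]
  | snoc x a =>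
    rw [LinearMap.comp_apply, mulAt_last_snoc, actLast_snoc, actLast_snoc, actLast_snoc,
      map_mul, mul_assoc]

theorem actLast_comp_oneAt {n j : ℕ} (hj : j ≤ n) (f : T k H (n + 1) →ₗ[k] B) :
    actLast D f ∘ₗ oneAt k H (n + 1) j = actLast D (f ∘ₗ oneAt k H n j) :=
  ext_snoc fun x a => by
    rw [LinearMap.comp_apply, oneAt_snoc _ _ hj, actLast_snoc, actLast_snoc, LinearMap.comp_apply]

theorem actLast_colCoface_succ {n i : ℕ} (hi : i ≤ n) (f : T k H n →ₗ[k] B) :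
    actLast D (colCoface D (i + 1) f) = actLast D f ∘ₗ mulAt k H (n + 1) i := by
  rcases hi.eq_or_lt with rfl | hi
  · rw [colCoface_last, actLast_comp_mulAt_last]
  · rw [colCoface_inner _ hi, actLast_comp_mulAt _ hi]

/-- The extension `a ⊗ x ⊗ b ↦ D a f(x) D b`, which turns all cofaces into products. -/
def actBoth {n : ℕ} (f : T k H n →ₗ[k] B) : T k H (n + 2) →ₗ[k] B :=
  actFirst D (actLast D f)

/-- As `D` is multiplicative, an outer action by two successive arguments is the action by their
product; so the outer cofaces become inner ones. -/
theorem actBoth_colCoface {n i : ℕ} (hi : i ≤ n + 1) (f : T k H n →ₗ[k] B) :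
    actBoth D (colCoface D i f) = actBoth D f ∘ₗ mulAt k H (n + 2) i := by
  rcases i with _ | i
  · rw [actBoth, actBoth, colCoface_zero, actLast_actFirst, actFirst_comp_mulAt_zero]
  · rw [actBoth, actBoth, actLast_colCoface_succ _ (by omega), actFirst_comp_mulAt_succ]

theorem actBoth_oneAt {n j : ℕ} (hj : j ≤ n) (f : T k H (n + 1) →ₗ[k] B) :
    actBoth D (f ∘ₗ oneAt k H n j) = actBoth D f ∘ₗ oneAt k H (n + 2) (j + 1) := by
  rw [actBoth, actBoth, actFirst_comp_oneAt_succ, actLast_comp_oneAt _ hj]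

theorem actFirst_comp_consOne {n : ℕ} (f : T k H n →ₗ[k] B) :
    actFirst D f ∘ₗ (consOne k H n).toLinearMap = f := by
  refine LinearMap.ext fun x => ?_
  simp [consOne_apply, actFirst_cons]

theorem actLast_comp_snocOne {n : ℕ} (f : T k H n →ₗ[k] B) :
    actLast D f ∘ₗ (snocOne k H n).toLinearMap = f := by
  refine LinearMap.ext fun x => ?_
  simp [snocOne_apply, actLast_snoc]

/-- The value `1` in the two adjoined arguments recovers `f`, so the cosimplicial identities may be
tested after `actBoth`. -/
theorem actBoth_injective {n : ℕ} {f g : T k H n →ₗ[k] B} (h : actBoth D f = actBoth D g) :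
    f = g := by
  have := congrArg (fun x => (x ∘ₗ (consOne k H (n + 1)).toLinearMap) ∘ₗ
    (snocOne k H n).toLinearMap) h
  simpa only [actBoth, actFirst_comp_consOne, actLast_comp_snocOne] using this

theorem actFirst_comp_opConv {n : ℕ} {A : Type*} [AddCommGroup A] [Module k A] [Coalgebra k A]
    (f : T k H n →ₗ[k] B) (π : A →ₗ[k] H) (y : A →ₗ[k] T k H n) :
    actFirst D f ∘ₗ (((firstHom k H n).toLinearMap ∘ₗ π) ⧇ ((consOne k H n).toLinearMap ∘ₗ y)) =
      (D.toLinearMap ∘ₗ π) ⧇ (f ∘ₗ y) := by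
  ext u
  simp [opConv_apply (ℛ k u), ← cons_eq_mul, actFirst_cons]

theorem actFirst_comp_antipodeCons {n : ℕ} (f : T k H n →ₗ[k] B) :
    actFirst D f ∘ₗ antipodeCons k H n = (D.toLinearMap ∘ₗ (antipode k ∘ₗ prod k H n)) ⧇ f := by
  rw [antipodeCons_eq_opConv, ← LinearMap.comp_id (consOne k H n).toLinearMap,
    actFirst_comp_opConv, LinearMap.comp_id]

/-- The action by the new first argument `S(P u₂)` contributes `DSP`, which the outer `DP` cancels
for `⧇`. -/
theorem colCyc_actFirst (hS : ∀ x : H, antipode k (antipode k x) = x) {n : ℕ}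
    (f : T k H n →ₗ[k] B) : colCyc D (actFirst D f) = actLast D f := by
  rw [colCyc, actLast_actFirst, actFirst_comp_antipodeCons, ← opConv_assoc,
    algHom_opConv_antipode_comp hS D (isCoalgMap_prod _), convUnit_opConv]

theorem mulAt_zero_comp_opConv {n : ℕ} {A : Type*} [AddCommGroup A] [Module k A] [Coalgebra k A]
    (π : A →ₗ[k] H) (y : A →ₗ[k] T k H (n + 1)) :
    mulAt k H (n + 1) 0 ∘ₗ (((firstHom k H (n + 1)).toLinearMap ∘ₗ π) ⧇
      ((consOne k H (n + 1)).toLinearMap ∘ₗ y)) = ((firstHom k H n).toLinearMap ∘ₗ π) ⧇ y := by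
  have h : ∀ (a : H) (y : T k H (n + 1)), mulAt k H (n + 1) 0 (cons k H (n + 1) (a ⊗ₜ y)) =
      firstHom k H n a * y := by
    intro a y
    induction y using cons_induction with
    | zero => simp
    | add _ _ h1 h2 => simp only [TensorProduct.tmul_add, map_add, h1, h2, mul_add]
    | cons b y => rw [mulAt_zero_cons, firstHom_apply, cons_mul_cons, one_mul]
  ext u
  simp [opConv_apply (ℛ k u), ← cons_eq_mul, h]

/-- The antipode of the full product ends in `S(u¹₍₂₎)`, which meets `u¹₍₁₎` and cancels because `S²
= id`; the first factor disappears. -/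
theorem mulAt_zero_comp_antipodeCons (hS : ∀ x : H, antipode k (antipode k x) = x) (n : ℕ) :
    mulAt k H (n + 1) 0 ∘ₗ antipodeCons k H (n + 1) =
      antipodeCons k H n ∘ₗ counitAt k H n 0 := by
  have h1 : (LinearMap.id : T k H (n + 1) →ₗ[k] T k H (n + 1)) =
      ((firstHom k H n).toLinearMap ∘ₗ firstFactor k H n) ⧇
        ((consOne k H n).toLinearMap ∘ₗ counitAt k H n 0) := by
    rw [Cocommute.opConv_eq ((cocommute_firstFactor_counitAt n).postcomp _ _),
      conv_firstFactor_counitAt]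
    exact ext_cons fun a x => by simp [← cons_eq_mul]
  have h2 : (firstHom k H n).toLinearMap ∘ₗ (antipode k ∘ₗ prod k H (n + 1)) =
      (((firstHom k H n).toLinearMap ∘ₗ (antipode k ∘ₗ prod k H n)) ∘ₗ counitAt k H n 0) ⧇
        ((firstHom k H n).toLinearMap ∘ₗ (antipode k ∘ₗ firstFactor k H n)) := by
    rw [prod_succ, antipode_comp_conv, comp_opConv]; rfl
  rw [antipodeCons_eq_opConv, ← LinearMap.comp_id (consOne k H (n + 1)).toLinearMap,
    mulAt_zero_comp_opConv, h2]
  conv_lhs => rw [h1]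
  rw [opConv_assoc, ← opConv_assoc _ _ ((consOne k H n).toLinearMap ∘ₗ counitAt k H n 0),
    antipode_opConv_algHom_comp hS _ (isCoalgMap_firstFactor n), convUnit_opConv,
    ← (isCoalgMap_counitAt_zero n).opConv_comp, antipodeCons_eq_opConv]

theorem colCyc_colCoface_succ (hS : ∀ x : H, antipode k (antipode k x) = x) {n i : ℕ} (hi : i ≤ n)
    (f : T k H n →ₗ[k] B) : colCyc D (colCoface D (i + 1) f) = colCoface D i (colCyc D f) := by
  rw [colCyc, actLast_colCoface_succ _ hi, LinearMap.comp_assoc]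
  rcases i with _ | i
  -- For `i = 0` the first argument survives only in the outer `DP`, from which it splits off as the
  -- left action of `δ₀`.
  · rw [mulAt_zero_comp_antipodeCons hS, prod_succ, comp_conv, ← Cocommute.opConv_eq,
      opConv_assoc, ← LinearMap.comp_assoc, ← LinearMap.comp_assoc,
      ← (isCoalgMap_counitAt_zero n).opConv_comp, colCoface_zero, actFirst_eq_opConv, colCyc]
    exact (cocommute_firstFactor_counitAt n).postcomp D.toLinearMap (D.toLinearMap ∘ₗ prod k H n)
  · have h := shift_comp_antipodeCons (isCoalgMap_mulAt (k := k) (H := H) n i (by omega))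
      (prod_comp_mulAt n i (by omega))
    rw [mulAt, h, ← prod_comp_mulAt n i (by omega), ← LinearMap.comp_assoc, ← LinearMap.comp_assoc,
      ← (isCoalgMap_mulAt n i (by omega)).opConv_comp, colCoface_inner _ (by omega), colCyc]

theorem colCyc_oneAt_succ {m i : ℕ} (hi : i ≤ m) (f : T k H (m + 2) →ₗ[k] B) :
    colCyc D (f ∘ₗ oneAt k H (m + 1) (i + 1)) = colCyc D f ∘ₗ oneAt k H (m + 1) i := by
  have h := shift_comp_antipodeCons (isCoalgMap_oneAt (k := k) (H := H) (m + 1) i (by omega))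
      (prod_comp_oneAt (m + 1) i (by omega))
  rw [colCyc, ← actLast_comp_oneAt _ (by omega), oneAt, LinearMap.comp_assoc, h,
    ← prod_comp_oneAt (m + 1) i (by omega), ← LinearMap.comp_assoc, ← LinearMap.comp_assoc,
      ← (isCoalgMap_oneAt (m + 1) i (by omega)).opConv_comp, colCyc]

/-- With last argument `1`, the operator simplifies to `DP ⧇ (g ∘ antipodeCons)`. Applied twice, the
inner `DP` is absorbed and the composite of the two copies of `antipodeCons` inserts a `1` in front.
-/
theorem colCyc_oneAt_zero (hS : ∀ x : H, antipode k (antipode k x) = x) {n : ℕ}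
    (f : T k H (n + 1) →ₗ[k] B) :
    colCyc D (f ∘ₗ oneAt k H n 0) = colCyc D (colCyc D f) ∘ₗ oneAt k H n n := by
  have h := shift_comp_antipodeCons (isCoalgMap_oneAt (k := k) (H := H) n n le_rfl)
      (prod_comp_oneAt n n le_rfl)
  have h1 : ∀ g : T k H (n + 1) →ₗ[k] B, colCyc D g ∘ₗ oneAt k H n n =
      (D.toLinearMap ∘ₗ prod k H n) ⧇ (g ∘ₗ antipodeCons k H n) := by
    intro g
    rw [colCyc, (isCoalgMap_oneAt n n le_rfl).opConv_comp, LinearMap.comp_assoc,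
      prod_comp_oneAt n n le_rfl, LinearMap.comp_assoc, ← h, ← oneAt, oneAt_last,
      ← LinearMap.comp_assoc, actLast_comp_snocOne]
  have h2 : oneAt k H (n + 1) 0 = (consOne k H (n + 1)).toLinearMap := by
    refine LinearMap.ext fun x => ?_
    simp [oneAt_zero, consOne_apply]
  rw [h1, colCyc.eq_def D f, prod_opConv_comp_antipodeCons hS, LinearMap.comp_assoc,
    antipodeCons_comp_antipodeCons hS, colCyc, ← actLast_comp_oneAt _ (Nat.zero_le n), h2,
    LinearMap.comp_assoc]

end Columns
end
end GerstenhaberSchack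

open scoped TensorProduct
namespace GerstenhaberSchack
noncomputable section
open TensorProduct Coalgebra HopfAlgebra
universe u v
variable {k : Type u} [Field k] {H : Type v} [Ring H] [HopfAlgebra k H]

/-! ### The corotation, dual to the Connes-Moscovici operator -/

section Corotation

variable (k H) in
/-- The operator `u ↦ S(u¹₍₂₎ ⋯ uᵐ⁺¹₍₂₎) ⊗ u¹₍₁₎ ⊗ ⋯ ⊗ uᵐ₍₁₎`. -/
def corotate (m : ℕ) : T k H (m + 1) →ₗ[k] T k H (m + 1) :=
  counitAt k H (m + 1) (m + 1) ∘ₗ antipodeCons k H (m + 1)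

variable {B : Type*} [Ring B] [Algebra k B]

theorem comp_corotate (m : ℕ) (f : T k H (m + 1) →ₗ[k] B) : f ∘ₗ corotate k H m =
    (f ∘ₗ counitAt k H (m + 1) (m + 1)) ∘ₗ antipodeCons k H (m + 1) := rfl

theorem cocommute_comp_counitAt_lastFactor {M N : Type*} [AddCommGroup M] [Module k M]
    [AddCommGroup N] [Module k N] (n : ℕ) (f : T k H n →ₗ[k] M) (g : H →ₗ[k] N) :
    Cocommute (f ∘ₗ counitAt k H n n) (g ∘ₗ lastFactor k H n) :=
  (cocommute_counitAt_lastFactor n).postcomp f g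

theorem algHom_prod_comp_counitAt (hS : ∀ x : H, antipode k (antipode k x) = x) (D : H →ₐ[k] B)
    (n : ℕ) : (D.toLinearMap ∘ₗ prod k H n) ∘ₗ counitAt k H n n =
      (D.toLinearMap ∘ₗ prod k H (n + 1)) ⧇
        (D.toLinearMap ∘ₗ (antipode k ∘ₗ lastFactor k H n)) := by
  rw [prod_succ', ← ((cocommute_counitAt_lastFactor n).postcomp (prod k H n)
    LinearMap.id).opConv_eq (f := prod k H n ∘ₗ counitAt k H n n) (g := lastFactor k H n),
    comp_opConv, opConv_assoc,
    algHom_opConv_antipode_comp hS D (isCoalgMap_lastFactor n), opConv_convUnit]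
  rfl

/-- The full product is trivial on `antipodeCons`, and `corotate` drops only the last factor, so the
product of the remaining ones behaves like the antipode of that factor. This is dual to
`cmRotate_diag_mul`. -/
theorem prod_opConv_comp_corotate (hS : ∀ x : H, antipode k (antipode k x) = x) (D : H →ₐ[k] B)
    (m : ℕ) (f : T k H (m + 1) →ₗ[k] B) :
    ((D.toLinearMap ∘ₗ prod k H (m + 1)) ⧇ f) ∘ₗ corotate k H m =
      (D.toLinearMap ∘ₗ (antipode k ∘ₗ lastFactor k H m)) ⧆ (f ∘ₗ corotate k H m) := by
  have hc : Cocommute (D.toLinearMap ∘ₗ (antipode k ∘ₗ lastFactor k H (m + 1)))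
      (f ∘ₗ counitAt k H (m + 1) (m + 1)) :=
    (cocommute_comp_counitAt_lastFactor _ _ (D.toLinearMap ∘ₗ antipode k)).symm
  rw [comp_corotate, (isCoalgMap_counitAt_last (m + 1)).opConv_comp,
    algHom_prod_comp_counitAt hS, opConv_assoc, prod_opConv_comp_antipodeCons hS, hc.opConv_eq,
    lastFactor_succ, ← LinearMap.comp_assoc, ← LinearMap.comp_assoc,
    conv_counitAt_comp_antipodeCons, comp_corotate, LinearMap.comp_assoc (lastFactor k H m)]

theorem conv_prod_comp_corotate (hS : ∀ x : H, antipode k (antipode k x) = x) (D : H →ₐ[k] B)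
    (m : ℕ) (f : T k H (m + 1) →ₗ[k] B) :
    (f ⧆ (D.toLinearMap ∘ₗ prod k H (m + 1))) ∘ₗ corotate k H m =
      (f ∘ₗ corotate k H m) ⧇ (D.toLinearMap ∘ₗ (antipode k ∘ₗ lastFactor k H m)) := by
  have hc : Cocommute (f ∘ₗ counitAt k H (m + 1) (m + 1))
      (D.toLinearMap ∘ₗ (antipode k ∘ₗ lastFactor k H (m + 1))) :=
    cocommute_comp_counitAt_lastFactor _ _ (D.toLinearMap ∘ₗ antipode k)
  rw [comp_corotate, (isCoalgMap_counitAt_last (m + 1)).conv_comp,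
    algHom_prod_comp_counitAt hS, hc.conv_opConv_assoc,
    lastFactor_succ, ← LinearMap.comp_assoc, ← LinearMap.comp_assoc,
    opConv_counitAt_comp_antipodeCons, conv_prod_comp_antipodeCons hS, comp_corotate,
    LinearMap.comp_assoc (lastFactor k H m)]

theorem counitAt_zero_comp_counitAt_last (m : ℕ) :
    counitAt k H m 0 ∘ₗ counitAt k H (m + 1) (m + 1) =
      counitAt k H m m ∘ₗ counitAt k H (m + 1) 0 :=
  (counitAt_comp_counitAt m 0 m (Nat.zero_le m) le_rfl).symm

theorem conv_counitAt_comp_corotate (m : ℕ) (α : T k H m →ₗ[k] B) (f : T k H (m + 1) →ₗ[k] B) :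
    ((α ∘ₗ counitAt k H m 0) ⧆ f) ∘ₗ corotate k H m =
      (α ∘ₗ counitAt k H m m) ⧆ (f ∘ₗ corotate k H m) := by
  rw [comp_corotate, (isCoalgMap_counitAt_last (m + 1)).conv_comp, LinearMap.comp_assoc,
    counitAt_zero_comp_counitAt_last, ← LinearMap.comp_assoc, conv_counitAt_comp_antipodeCons,
    comp_corotate]

theorem opConv_counitAt_comp_corotate (m : ℕ) (α : T k H m →ₗ[k] B) (f : T k H (m + 1) →ₗ[k] B) :
    (f ⧇ (α ∘ₗ counitAt k H m 0)) ∘ₗ corotate k H m =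
      (f ∘ₗ corotate k H m) ⧇ (α ∘ₗ counitAt k H m m) := by
  rw [comp_corotate, (isCoalgMap_counitAt_last (m + 1)).opConv_comp, LinearMap.comp_assoc _ _ α,
    counitAt_zero_comp_counitAt_last, ← LinearMap.comp_assoc, opConv_counitAt_comp_antipodeCons,
    comp_corotate]

theorem conv_firstFactor_comp_corotate (m : ℕ) (β : H →ₗ[k] B) (f : T k H (m + 1) →ₗ[k] B) :
    ((β ∘ₗ firstFactor k H m) ⧆ f) ∘ₗ corotate k H m =
      (β ∘ₗ (antipode k ∘ₗ prod k H (m + 1))) ⧇ (f ∘ₗ corotate k H m) := by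
  rw [comp_corotate, (isCoalgMap_counitAt_last (m + 1)).conv_comp, LinearMap.comp_assoc,
    ← firstFactor_succ, conv_firstFactor_comp_antipodeCons, comp_corotate]

theorem opConv_firstFactor_comp_corotate (m : ℕ) (β : H →ₗ[k] B) (f : T k H (m + 1) →ₗ[k] B) :
    (f ⧇ (β ∘ₗ firstFactor k H m)) ∘ₗ corotate k H m =
      (f ∘ₗ corotate k H m) ⧆ (β ∘ₗ (antipode k ∘ₗ prod k H (m + 1))) := by
  rw [comp_corotate, (isCoalgMap_counitAt_last (m + 1)).opConv_comp, LinearMap.comp_assoc _ _ β,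
    ← firstFactor_succ, opConv_firstFactor_comp_antipodeCons, comp_corotate]

variable (k H) in
/-- The rotation `x ⊗ a ↦ a ⊗ x`. -/
def rotateInv (n : ℕ) : T k H (n + 1) →ₗ[k] T k H (n + 1) :=
  (cons k H n).toLinearMap ∘ₗ (TensorProduct.comm k (T k H n) H).toLinearMap ∘ₗ
    (snoc k H n).symm.toLinearMap

theorem rotate_mul_rotateInv (n : ℕ) : rotate k H n * rotateInv k H n = 1 :=
  ext_snoc fun x a => by simp [rotate, rotateInv]

theorem rotateInv_mul_rotate (n : ℕ) : rotateInv k H n * rotate k H n = 1 :=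
  ext_cons fun a x => by simp [rotate, rotateInv]

theorem rotateInv_pow (n : ℕ) : rotateInv k H n ^ (n + 1) = 1 := by
  have h : Commute (rotate k H n) (rotateInv k H n) := by
    rw [Commute, SemiconjBy, rotate_mul_rotateInv, rotateInv_mul_rotate]
  have h2 := h.mul_pow (n + 1)
  rw [rotate_mul_rotateInv, one_pow, rotate_pow, one_mul] at h2
  exact h2.symm

theorem rotateInv_eq_conv (n : ℕ) : rotateInv k H n =
    ((firstHom k H n).toLinearMap ∘ₗ lastFactor k H n) ⧆
      ((consOne k H n).toLinearMap ∘ₗ counitAt k H n n) := by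
  rw [← Cocommute.opConv_eq (cocommute_comp_counitAt_lastFactor _ _ _).symm,
    opConv_eq_conv_of_commute, conv_counitAt_lastFactor]
  · refine ext_snoc fun x a => ?_
    simp [rotateInv, cons_eq_mul, (commute_firstHom_consOne n a x).eq]
  · exact fun u v => commute_firstHom_consOne n (lastFactor k H n u) (counitAt k H n n v)

/-- The first factor of the left side is `S` of a product equivalent to `S(uᵐ⁺¹)`, that is `uᵐ⁺¹`
itself: `corotate` is a rotation of `m + 2` factors seen through `antipodeCons`. -/
theorem antipodeCons_comp_corotate (hS : ∀ x : H, antipode k (antipode k x) = x) (m : ℕ) :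
    antipodeCons k H (m + 1) ∘ₗ corotate k H m =
      rotateInv k H (m + 1) ∘ₗ antipodeCons k H (m + 1) := by
  have h := prod_opConv_comp_corotate hS (firstHom k H (m + 1)) m (antipodeCons k H (m + 1))
  have h2 : ((firstHom k H (m + 1)).toLinearMap ∘ₗ prod k H (m + 1)) ⧇ antipodeCons k H (m + 1) =
      (consOne k H (m + 1)).toLinearMap := by
    rw [antipodeCons_eq_opConv, ← opConv_assoc, algHom_opConv_antipode_comp hS _ (isCoalgMap_prod _),
      convUnit_opConv]
  have h3 := congrArg (fun x => ((firstHom k H (m + 1)).toLinearMap ∘ₗ lastFactor k H m) ⧆ x) h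
  rw [h2] at h3
  simp only [← conv_assoc] at h3
  rw [algHom_conv_antipode_comp _ (isCoalgMap_lastFactor m), convUnit_conv] at h3
  rw [← h3, rotateInv_eq_conv, lastFactor_succ, ← LinearMap.comp_assoc,
    conv_counitAt_comp_antipodeCons, comp_corotate]

/-- `antipodeCons` is injective, the counit of the first slot being a left inverse, so the period of
the rotation is inherited. -/
theorem corotate_pow (hS : ∀ x : H, antipode k (antipode k x) = x) (m : ℕ) :
    corotate k H m ^ (m + 2) = 1 := by
  have h : ∀ i, antipodeCons k H (m + 1) ∘ₗ (corotate k H m ^ i) =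
      (rotateInv k H (m + 1) ^ i) ∘ₗ antipodeCons k H (m + 1) := by
    intro i
    induction i with
    | zero => rfl
    | succ i ih =>
      rw [pow_succ, Module.End.mul_eq_comp, ← LinearMap.comp_assoc, ih, LinearMap.comp_assoc,
        antipodeCons_comp_corotate hS, pow_succ]
      rfl
  have h1 := congrArg (fun x => counitAt k H (m + 1) 0 ∘ₗ x) (h (m + 2))
  simp only [← LinearMap.comp_assoc] at h1
  rw [counitAt_zero_comp_antipodeCons, rotateInv_pow, LinearMap.id_comp] at h1
  rw [h1]
  exact counitAt_zero_comp_antipodeCons (m + 1)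

end Corotation

/-! ### Powers of the column operator -/

section ColumnPowers

variable (k H) in
/-- `u ↦ uʲ⁺¹ ⋯ uᵖ`, the first `j` factors being killed by `ε`. -/
def prodTail : ∀ p : ℕ, ℕ → (T k H p →ₗ[k] H)
  | p, 0 => prod k H p
  | 0, _ + 1 => prod k H 0
  | p + 1, j + 1 => prodTail p j ∘ₗ counitAt k H p 0

theorem prodTail_zero (p : ℕ) : prodTail k H p 0 = prod k H p := by cases p <;> rfl

theorem prodTail_succ_succ (p j : ℕ) :
    prodTail k H (p + 1) (j + 1) = prodTail k H p j ∘ₗ counitAt k H p 0 := rfl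

theorem prodTail_self (p : ℕ) : prodTail k H p p = convUnit k (T k H p) H := by
  induction p with
  | zero => rw [prodTail_zero, prod_zero]; rfl
  | succ p ih => rw [prodTail_succ_succ, ih, (isCoalgMap_counitAt_zero p).convUnit_comp]

theorem prodTail_succ (m j : ℕ) (hj : j ≤ m) : prodTail k H (m + 1) j =
    (prodTail k H m j ∘ₗ counitAt k H m m) ⧆ lastFactor k H m := by
  induction m generalizing j with
  | zero =>
    obtain rfl : j = 0 := by omega
    rw [prodTail_zero, prodTail_zero, prod_succ']
  | succ m ih =>
    rcases j with _ | j
    · rw [prodTail_zero, prodTail_zero, prod_succ']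
    · rw [prodTail_succ_succ, ih j (by omega), (isCoalgMap_counitAt_zero _).conv_comp,
        ← lastFactor_succ, prodTail_succ_succ, LinearMap.comp_assoc, LinearMap.comp_assoc,
        counitAt_zero_comp_counitAt_last]

theorem prodTail_last (m : ℕ) : prodTail k H (m + 1) m = lastFactor k H m := by
  rw [prodTail_succ _ _ le_rfl, prodTail_self, (isCoalgMap_counitAt_last m).convUnit_comp,
    convUnit_conv]

variable {B : Type*} [Ring B] [Algebra k B] (D : H →ₐ[k] B)

theorem algHom_prodTail_succ (m j : ℕ) (hj : j ≤ m) :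
    D.toLinearMap ∘ₗ prodTail k H (m + 1) j =
      ((D.toLinearMap ∘ₗ prodTail k H m j) ∘ₗ counitAt k H m m) ⧇
        (D.toLinearMap ∘ₗ lastFactor k H m) := by
  rw [(cocommute_comp_counitAt_lastFactor _ _ _).opConv_eq, prodTail_succ _ _ hj, comp_conv]; rfl

theorem algHom_antipode_prodTail_succ (m j : ℕ) (hj : j ≤ m) :
    D.toLinearMap ∘ₗ (antipode k ∘ₗ prodTail k H (m + 1) j) =
      (D.toLinearMap ∘ₗ (antipode k ∘ₗ lastFactor k H m)) ⧆
      ((D.toLinearMap ∘ₗ (antipode k ∘ₗ prodTail k H m j)) ∘ₗ counitAt k H m m) := by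
  rw [prodTail_succ _ _ hj, antipode_comp_conv, comp_opConv]
  exact (cocommute_comp_counitAt_lastFactor m (D.toLinearMap ∘ₗ antipode k ∘ₗ prodTail k H m j)
    (D.toLinearMap ∘ₗ antipode k)).symm.opConv_eq

theorem colCyc_succ {m : ℕ} (f : T k H (m + 1) →ₗ[k] B) :
    colCyc D f = (D.toLinearMap ∘ₗ prod k H (m + 1)) ⧇
      ((f ∘ₗ corotate k H m) ⧇ (D.toLinearMap ∘ₗ lastFactor k H m)) := by
  rw [colCyc, actLast_eq_opConv, lastFactor_succ, ← LinearMap.comp_assoc,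
    opConv_counitAt_comp_antipodeCons, comp_corotate]

theorem conv_lastFactor_opConv_opConv (m : ℕ) (π ρ : H →ₗ[k] B) (y : T k H (m + 1) →ₗ[k] B)
    (α : T k H m →ₗ[k] B) :
    ((π ∘ₗ lastFactor k H m) ⧆ (y ⧇ (α ∘ₗ counitAt k H m m))) ⧇ (ρ ∘ₗ lastFactor k H m) =
      ((π ∘ₗ lastFactor k H m) ⧆ y) ⧇
        ((α ∘ₗ counitAt k H m m) ⧇ (ρ ∘ₗ lastFactor k H m)) := by
  rw [(cocommute_comp_counitAt_lastFactor m α π).symm.conv_opConv_assoc, opConv_assoc]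

/-- The dual of `rowCyc_conv_diagTail`: precomposition with `corotate` shifts both tails by one
factor, and the outer `DP` and the new last factor each complete one of them. -/
theorem colCyc_conv_prodTail (hS : ∀ x : H, antipode k (antipode k x) = x) {m j : ℕ} (hj : j < m)
    (g : T k H (m + 1) →ₗ[k] B) :
    colCyc D ((D.toLinearMap ∘ₗ prod k H (m + 1)) ⧇
        (((D.toLinearMap ∘ₗ (antipode k ∘ₗ prodTail k H (m + 1) (j + 2))) ⧆ g) ⧇
          (D.toLinearMap ∘ₗ prodTail k H (m + 1) (j + 1)))) =
      (D.toLinearMap ∘ₗ prod k H (m + 1)) ⧇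
        (((D.toLinearMap ∘ₗ (antipode k ∘ₗ prodTail k H (m + 1) (j + 1))) ⧆
          (g ∘ₗ corotate k H m)) ⧇ (D.toLinearMap ∘ₗ prodTail k H (m + 1) j)) := by
  rw [colCyc_succ, prod_opConv_comp_corotate hS, prodTail_succ_succ m (j + 1),
    prodTail_succ_succ m j, ← LinearMap.comp_assoc (counitAt k H m 0),
    ← LinearMap.comp_assoc (counitAt k H m 0), ← LinearMap.comp_assoc (counitAt k H m 0),
    opConv_counitAt_comp_corotate, conv_counitAt_comp_corotate,
    ← LinearMap.comp_assoc (lastFactor k H m), conv_lastFactor_opConv_opConv,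
    ← algHom_prodTail_succ _ _ _ hj.le, ← conv_assoc, LinearMap.comp_assoc (lastFactor k H m),
    ← algHom_antipode_prodTail_succ _ _ _ hj]
  rfl

theorem colCyc_conv_prodTail_zero (hS : ∀ x : H, antipode k (antipode k x) = x) {m : ℕ}
    (g : T k H (m + 1) →ₗ[k] B) :
    colCyc D ((D.toLinearMap ∘ₗ prod k H (m + 1)) ⧇
        (((D.toLinearMap ∘ₗ (antipode k ∘ₗ prodTail k H (m + 1) 1)) ⧆ g) ⧇
          (D.toLinearMap ∘ₗ prodTail k H (m + 1) 0))) =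
      (D.toLinearMap ∘ₗ prod k H (m + 1)) ⧇
        (((D.toLinearMap ∘ₗ (antipode k ∘ₗ prod k H (m + 1))) ⧆
          ((g ∘ₗ corotate k H m) ⧆ (D.toLinearMap ∘ₗ (antipode k ∘ₗ prod k H (m + 1))))) ⧇
            (D.toLinearMap ∘ₗ prod k H (m + 1))) := by
  have h : D.toLinearMap ∘ₗ prodTail k H (m + 1) 0 = (D.toLinearMap ∘ₗ firstFactor k H m) ⧇
      ((D.toLinearMap ∘ₗ prodTail k H m 0) ∘ₗ counitAt k H m 0) := by
    rw [((cocommute_firstFactor_counitAt m).postcomp _ _).opConv_eq, prodTail_zero, prodTail_zero,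
      prod_succ, comp_conv]; rfl
  rw [colCyc_succ, prod_opConv_comp_corotate hS, h, ← opConv_assoc _ (D.toLinearMap ∘ₗ firstFactor k H m),
    opConv_counitAt_comp_corotate, opConv_firstFactor_comp_corotate, prodTail_succ_succ,
    ← LinearMap.comp_assoc (counitAt k H m 0), ← LinearMap.comp_assoc (counitAt k H m 0),
    conv_counitAt_comp_corotate,
    ← LinearMap.comp_assoc (lastFactor k H m), conv_lastFactor_opConv_opConv,
    ← algHom_prodTail_succ _ _ _ (Nat.zero_le m), conv_assoc, ← conv_assoc,
    LinearMap.comp_assoc (lastFactor k H m)]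
  rw [← algHom_antipode_prodTail_succ _ _ _ (Nat.zero_le m), prodTail_zero]

theorem algHom_antipode_convUnit {A : Type*} [AddCommGroup A] [Module k A] [Coalgebra k A] :
    D.toLinearMap ∘ₗ (antipode k ∘ₗ convUnit k A H) = convUnit k A B := by
  refine LinearMap.ext fun u => ?_
  simp [convUnit_apply, Algebra.algebraMap_eq_smul_one]

theorem colCyc_zero (f : T k H 0 →ₗ[k] B) : colCyc D f = f := by
  have h : prod k H 0 = convUnit k (T k H 0) H := prod_zero
  have h1 : (consOne k H 0).toLinearMap = (snocOne k H 0).toLinearMap := ext_zero (by simp)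
  rw [colCyc, antipodeCons_eq_opConv, h, algHom_antipode_convUnit, comp_convUnit, convUnit_opConv,
    convUnit_opConv, h1, actLast_comp_snocOne]

theorem colCyc_iterate (hS : ∀ x : H, antipode k (antipode k x) = x) {m : ℕ} (i j : ℕ)
    (h : i + j = m) (f : T k H (m + 1) →ₗ[k] B) :
    (colCyc D)^[i + 1] f = (D.toLinearMap ∘ₗ prod k H (m + 1)) ⧇
      (((D.toLinearMap ∘ₗ (antipode k ∘ₗ prodTail k H (m + 1) (j + 1))) ⧆
        (f ∘ₗ (corotate k H m ^ (i + 1)))) ⧇ (D.toLinearMap ∘ₗ prodTail k H (m + 1) j)) := by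
  induction i generalizing j with
  | zero =>
    obtain rfl : j = m := by omega
    rw [prodTail_self, algHom_antipode_convUnit, convUnit_conv, prodTail_last, zero_add, pow_one, Function.iterate_one,
      colCyc_succ]
  | succ i ih =>
    rw [Function.iterate_succ_apply', ih (j + 1) (by omega), colCyc_conv_prodTail _ hS (by omega),
      pow_succ _ (i + 1)]
    rfl

/-- Once the tails are complete and `R'^(p+1) = 1`, the value is `DP(u₅) DSP(u₂) f(u₃) DSP(u₄)
DP(u₁)`, the conjugation inverse to that of `rowCyc_iterate_succ`. -/
theorem colCyc_iterate_succ (hS : ∀ x : H, antipode k (antipode k x) = x) (p : ℕ)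
    (f : T k H p →ₗ[k] B) :
    (colCyc D)^[p + 1] f = (D.toLinearMap ∘ₗ prod k H p) ⧇
      (((D.toLinearMap ∘ₗ (antipode k ∘ₗ prod k H p)) ⧆
        (f ⧆ (D.toLinearMap ∘ₗ (antipode k ∘ₗ prod k H p)))) ⧇ (D.toLinearMap ∘ₗ prod k H p)) := by
  rcases p with _ | m
  · have h : prod k H 0 = convUnit k (T k H 0) H := prod_zero
    rw [h, algHom_antipode_convUnit, comp_convUnit, convUnit_conv, conv_convUnit, convUnit_opConv,
      opConv_convUnit, zero_add, Function.iterate_one, colCyc_zero]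
  · rw [Function.iterate_succ_apply', colCyc_iterate D hS m 0 (by omega),
      colCyc_conv_prodTail_zero D hS, LinearMap.comp_assoc, ← Module.End.mul_eq_comp,
      ← pow_succ, corotate_pow hS]
    rfl

end ColumnPowers

/-! ### The columns are para-cocyclic -/

section ColumnStructure

theorem cofaceV_apply (p q i : ℕ) (f : GS k H p q) :
    cofaceV k H p q i f = colCoface (diag k H q) i f := by
  rw [cofaceV, colCoface]
  split_ifs
  · refine ext_cons fun a x => ?_
    rw [actFirst_cons]
    simp [cofaceVFirst, leftAct_tmul]
  · refine ext_snoc fun x a => ?_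
    rw [actLast_snoc]
    simp [cofaceVLast, rightAct_tmul]
  · rfl

theorem codegV_apply (p q j : ℕ) (f : GS k H (p + 1) q) :
    codegV k H p q j f = f ∘ₗ oneAt k H p j := rfl

theorem antipodeInv_eq (hS : ∀ x : H, antipode k (antipode k x) = x) :
    antipodeInv k H = antipode k := by
  have h : (antipode k : Module.End k H) * antipode k = 1 := LinearMap.ext hS
  exact Ring.inverse_unit ⟨antipode k, antipode k, h, h⟩

theorem tauAlgCore_apply (m q : ℕ) (f : GS k H (m + 1) q) (x : T k H (m + 1)) (s h : H) :
    tauAlgCore k H m q f ((snoc k H m).symm x ⊗ₜ (s ⊗ₜ h)) =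
      diag k H q h * actLast (diag k H q) f (cons k H (m + 1) (s ⊗ₜ x)) := by
  induction x using snoc_induction with
  | zero => simp
  | add _ _ h1 h2 => simp only [TensorProduct.add_tmul, TensorProduct.tmul_add, map_add, h1, h2,
      mul_add]
  | snoc x a =>
    rw [cons_snoc, actLast_snoc]
    simp [tauAlgCore, leftAct_tmul, rightAct_tmul]

/-- The legs `u₍₃₎`, `u₍₂₎`, `u₍₁₎` in the explicit formula are those of `DP ⧇ (· ∘ twist)`, and the
right action by the last factor is `actLast`. -/
theorem tauAlg_apply (hS : ∀ x : H, antipode k (antipode k x) = x) (p q : ℕ) (f : GS k H p q) :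
    tauAlg k H p q f = colCyc (diag k H q) f := by
  rcases p with _ | m
  · exact (colCyc_zero _ f).symm
  have h : tauAlgCore k H m q f ∘ₗ TensorProduct.map (snoc k H m).symm.toLinearMap
      (TensorProduct.map (antipodeInv k H ∘ₗ prod k H (m + 1)) (prod k H (m + 1))) =
      LinearMap.mul' k _ ∘ₗ TensorProduct.map ((diag k H q).toLinearMap ∘ₗ prod k H (m + 1))
        ((actLast (diag k H q) f ∘ₗ (cons k H (m + 1)).toLinearMap) ∘ₗ
          TensorProduct.map (antipode k ∘ₗ prod k H (m + 1)) LinearMap.id ∘ₗ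
          (TensorProduct.comm k _ _).toLinearMap) ∘ₗ
        (TensorProduct.comm k _ _).toLinearMap ∘ₗ
          (TensorProduct.assoc k _ _ _).symm.toLinearMap := by
    rw [antipodeInv_eq hS]
    refine TensorProduct.ext (LinearMap.ext fun x => TensorProduct.ext' fun y z => ?_)
    simp [tauAlgCore_apply]
  rw [colCyc, comp_antipodeCons, comp_twist, opConv_comul_right, ← h]
  rfl

theorem tauAlg_pow_apply (hS : ∀ x : H, antipode k (antipode k x) = x) (p q n : ℕ)
    (f : GS k H p q) : (tauAlg k H p q ^ n) f = (colCyc (diag k H q))^[n] f := by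
  rw [Module.End.pow_apply, show ⇑(tauAlg k H p q) = colCyc (diag k H q) from
    funext (tauAlg_apply hS p q)]

theorem isParaCocyclic_column (hS : ∀ x : H, antipode k (antipode k x) = x) (q : ℕ) :
    Cocyclic.IsParaCocyclic (k := k) (fun p => GS k H p q) (fun p => cofaceV k H p q)
      (fun p => codegV k H p q) (fun p => tauAlg k H p q) where
  coface_coface n i j hij hj := by
    refine LinearMap.ext fun f => actBoth_injective (diag k H q) ?_
    simp only [LinearMap.comp_apply, cofaceV_apply]
    rw [actBoth_colCoface _ (by omega), actBoth_colCoface _ (by omega),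
      actBoth_colCoface _ (by omega), actBoth_colCoface _ (by omega), LinearMap.comp_assoc,
      mulAt_comp_mulAt _ _ _ hij (by omega), LinearMap.comp_assoc]
  codeg_codeg n i j hij hj := by
    refine LinearMap.ext fun f => ?_
    simp only [LinearMap.comp_apply, codegV_apply]
    rw [LinearMap.comp_assoc, oneAt_comp_oneAt _ _ _ hij hj, LinearMap.comp_assoc]
  codeg_coface_lt n i j hij hj := by
    refine LinearMap.ext fun f => actBoth_injective (diag k H q) ?_
    simp only [LinearMap.comp_apply, cofaceV_apply, codegV_apply]
    rw [actBoth_oneAt _ (by omega), actBoth_colCoface _ (by omega),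
      actBoth_colCoface _ (by omega), actBoth_oneAt _ (by omega), LinearMap.comp_assoc,
      mulAt_comp_oneAt_lt _ _ _ (by omega) (by omega), LinearMap.comp_assoc]
  codeg_coface_self n j hj := by
    refine LinearMap.ext fun f => actBoth_injective (diag k H q) ?_
    simp only [LinearMap.comp_apply, cofaceV_apply, codegV_apply]
    rw [actBoth_oneAt _ (by omega), actBoth_colCoface _ (by omega), LinearMap.comp_assoc,
      mulAt_comp_oneAt_succ _ _ (by omega)]
    rfl
  codeg_coface_succ n j hj := by
    refine LinearMap.ext fun f => actBoth_injective (diag k H q) ?_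
    simp only [LinearMap.comp_apply, cofaceV_apply, codegV_apply]
    rw [actBoth_oneAt _ (by omega), actBoth_colCoface _ (by omega), LinearMap.comp_assoc,
      mulAt_comp_oneAt_self _ _ (by omega)]
    rfl
  codeg_coface_gt n i j hij hi := by
    refine LinearMap.ext fun f => actBoth_injective (diag k H q) ?_
    simp only [LinearMap.comp_apply, cofaceV_apply, codegV_apply]
    rw [actBoth_oneAt _ (by omega), actBoth_colCoface _ (by omega),
      actBoth_colCoface _ (by omega), actBoth_oneAt _ (by omega), LinearMap.comp_assoc,
      mulAt_comp_oneAt_gt _ _ _ (by omega) (by omega), LinearMap.comp_assoc]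
  cyc_coface_zero n := by
    refine LinearMap.ext fun f => ?_
    simp only [LinearMap.comp_apply, cofaceV_apply, tauAlg_apply hS]
    rw [colCoface_zero, colCoface_last, colCyc_actFirst _ hS]
  cyc_coface_succ n i hi := by
    refine LinearMap.ext fun f => ?_
    simp only [LinearMap.comp_apply, cofaceV_apply, tauAlg_apply hS]
    rw [colCyc_colCoface_succ _ hS hi]
  cyc_codeg_zero n := by
    refine LinearMap.ext fun f => ?_
    simp only [LinearMap.comp_apply, codegV_apply, tauAlg_apply hS]
    rw [colCyc_oneAt_zero _ hS]
  cyc_codeg_succ n i hi := by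
    refine LinearMap.ext fun f => ?_
    obtain ⟨m, rfl⟩ : ∃ m, n = m + 1 := ⟨n - 1, by omega⟩
    simp only [LinearMap.comp_apply, codegV_apply, tauAlg_apply hS]
    rw [colCyc_oneAt_succ _ (by omega)]

end ColumnStructure
end
end GerstenhaberSchack

open scoped TensorProduct
namespace GerstenhaberSchack
noncomputable section
open TensorProduct Coalgebra HopfAlgebra
universe u v
variable {k : Type u} [Field k] {H : Type v} [Ring H] [HopfAlgebra k H]

/-! ### Naturality of the row and column operators -/

section Naturality

variable {A A' : Type*} [AddCommGroup A] [Module k A] [Coalgebra k A]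
  [AddCommGroup A'] [Module k A'] [Coalgebra k A']

/-- Inner vertical operators are precomposition with coalgebra maps that preserve the product, so
they commute with all row operators. The `colCoface_comp` and `colCyc_comp` lemmas are the dual
statements for algebra maps preserving `D`. -/
theorem rowCoface_comp {P : A →ₗ[k] H} {P' : A' →ₗ[k] H} {s : A' →ₗ[k] A} (hs : IsCoalgMap s)
    (hP : P ∘ₗ s = P') {q : ℕ} (j : ℕ) (f : A →ₗ[k] T k H q) :
    rowCoface P' j (f ∘ₗ s) = rowCoface P j f ∘ₗ s := by
  subst hP
  rw [rowCoface, rowCoface]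
  split_ifs
  · rw [coactFirst, coactFirst, hs.conv_comp]; rfl
  · rw [coactLast, coactLast, hs.conv_comp]; rfl
  · rfl

theorem rowCyc_comp {P : A →ₗ[k] H} {P' : A' →ₗ[k] H} {s : A' →ₗ[k] A} (hs : IsCoalgMap s)
    (hP : P ∘ₗ s = P') {q : ℕ} (f : A →ₗ[k] T k H q) :
    rowCyc P' (f ∘ₗ s) = rowCyc P f ∘ₗ s := by
  subst hP
  rcases q with _ | m
  · rfl
  · rw [rowCyc_succ, rowCyc_succ, hs.conv_comp, hs.conv_comp]; rfl

variable {B B' : Type*} [Ring B] [Algebra k B] [Ring B'] [Algebra k B']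

theorem colCoface_comp {D : H →ₐ[k] B} {D' : H →ₐ[k] B'} (e : B →ₐ[k] B') (hD : e.comp D = D')
    {p : ℕ} (i : ℕ) (f : T k H p →ₗ[k] B) :
    colCoface D' i (e.toLinearMap ∘ₗ f) = e.toLinearMap ∘ₗ colCoface D i f := by
  subst hD
  rw [colCoface, colCoface]
  split_ifs
  · exact ext_cons fun a x => by simp [actFirst_cons]
  · exact ext_snoc fun x a => by simp [actLast_snoc]
  · rfl

theorem colCyc_comp {D : H →ₐ[k] B} {D' : H →ₐ[k] B'} (e : B →ₐ[k] B') (hD : e.comp D = D')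
    {p : ℕ} (f : T k H p →ₗ[k] B) :
    colCyc D' (e.toLinearMap ∘ₗ f) = e.toLinearMap ∘ₗ colCyc D f := by
  subst hD
  have h : actLast (e.comp D) (e.toLinearMap ∘ₗ f) = e.toLinearMap ∘ₗ actLast D f :=
    ext_snoc fun x a => by simp [actLast_snoc]
  rw [colCyc, colCyc, comp_opConv, h]
  rfl

theorem comulAtHom_comp_diag (q i : ℕ) (hi : i < q) :
    (comulAtHom k H q i hi).comp (diag k H q) = diag k H (q + 1) :=
  AlgHom.ext (LinearMap.congr_fun (comulAt_comp_diag q i hi))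

theorem counitAtHom_comp_diag (q j : ℕ) (hj : j ≤ q) :
    (counitAtHom k H q j hj).comp (diag k H (q + 1)) = diag k H q :=
  AlgHom.ext (LinearMap.congr_fun (counitAt_comp_diag q j hj))

end Naturality

/-! ### Commutation of the outer and cyclic operators -/

section Mixed

theorem algHom_prod_succ {B : Type*} [Ring B] [Algebra k B] (D : H →ₐ[k] B) (p : ℕ) :
    D.toLinearMap ∘ₗ prod k H (p + 1) = (D.toLinearMap ∘ₗ firstFactor k H p) ⧆
      ((D.toLinearMap ∘ₗ prod k H p) ∘ₗ counitAt k H p 0) := by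
  rw [prod_succ, comp_conv]; rfl

/-- The last slot of `D(u⁰)` passes the value of `f`: the slots commute, and the factor `u⁰`
cocommutes with the remaining ones. It then joins the last slot of the product. -/
theorem actFirst_coactLast (p q : ℕ) (f : GS k H p q) :
    actFirst (diag k H (q + 1)) (coactLast (prod k H p) f) =
      coactLast (prod k H (p + 1)) (actFirst (diag k H q) f) := by
  have h : ((lastHom k H q).toLinearMap ∘ₗ firstFactor k H p) ⧆
      ((snocOne k H q).toLinearMap ∘ₗ (f ∘ₗ counitAt k H p 0)) =
      ((snocOne k H q).toLinearMap ∘ₗ (f ∘ₗ counitAt k H p 0)) ⧆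
        ((lastHom k H q).toLinearMap ∘ₗ firstFactor k H p) := by
    have hc : Cocommute ((snocOne k H q).toLinearMap ∘ₗ (f ∘ₗ counitAt k H p 0))
        ((lastHom k H q).toLinearMap ∘ₗ firstFactor k H p) :=
      (cocommute_firstFactor_counitAt p).symm.postcomp ((snocOne k H q).toLinearMap ∘ₗ f) _
    rw [← hc.opConv_eq, opConv_eq_conv_of_commute]
    exact fun u v => commute_snocOne_lastHom q (f (counitAt k H p 0 u)) (firstFactor k H p v)
  rw [actFirst_eq_conv, diag_succ_comp' _ (isCoalgMap_firstFactor p), coactLast,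
    (isCoalgMap_counitAt_zero p).conv_comp, coactLast, algHom_prod_succ, actFirst_eq_conv,
    comp_conv, LinearMap.comp_assoc _ f, conv_assoc, ← conv_assoc _ _ ((_ ∘ₗ _) ∘ₗ counitAt k H p 0),
    h, conv_assoc, conv_assoc]

/-- `R` turns `D(u⁰)` into `ℓ(S u⁰)`, which cancels the share of `u⁰` in `ℓP`; the share in the
leading `DP` is the left action. -/
theorem actFirst_rowCyc (p q : ℕ) (f : GS k H p q) :
    actFirst (diag k H q) (rowCyc (prod k H p) f) =
      rowCyc (prod k H (p + 1)) (actFirst (diag k H q) f) := by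
  rcases q with _ | m
  · rfl
  have hc : Cocommute (cmRotate k H m ∘ₗ (f ∘ₗ counitAt k H p 0))
      ((lastHom k H m).toLinearMap ∘ₗ (antipode k ∘ₗ firstFactor k H p)) :=
    (cocommute_firstFactor_counitAt p).symm.postcomp (cmRotate k H m ∘ₗ f)
      ((lastHom k H m).toLinearMap ∘ₗ antipode k)
  have h : ((lastHom k H m).toLinearMap ∘ₗ (antipode k ∘ₗ firstFactor k H p)) ⧆
      ((lastHom k H m).toLinearMap ∘ₗ firstFactor k H p) = convUnit k _ _ := by
    rw [← LinearMap.comp_assoc, ← (isCoalgMap_firstFactor p).conv_comp, antipode_conv_algHom,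
      (isCoalgMap_firstFactor p).convUnit_comp]
  rw [rowCyc_succ (prod k H (p + 1)), actFirst_eq_conv, actFirst_eq_conv, cmRotate_comp_diag_conv,
    hc.opConv_eq, algHom_prod_succ (lastHom k H m), conv_assoc (cmRotate k H m ∘ₗ _),
    ← conv_assoc (_ ∘ₗ (antipode k ∘ₗ firstFactor k H p)), h, convUnit_conv, algHom_prod_succ,
    rowCyc_succ, (isCoalgMap_counitAt_zero p).conv_comp, (isCoalgMap_counitAt_zero p).conv_comp,
    conv_assoc]
  rfl

/-- `ℓ(S h₍₂₎) D h₍₁₎` is the diagonal on all slots but the last one `ℓ`. -/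
theorem lastHom_antipode_opConv_diag (hS : ∀ x : H, antipode k (antipode k x) = x) (q : ℕ)
    {A : Type*} [AddCommGroup A] [Module k A] [Coalgebra k A] {π : A →ₗ[k] H} (hπ : IsCoalgMap π) :
    ((lastHom k H q).toLinearMap ∘ₗ (antipode k ∘ₗ π)) ⧇ ((diag k H (q + 1)).toLinearMap ∘ₗ π) =
      (snocOne k H q).toLinearMap ∘ₗ ((diag k H q).toLinearMap ∘ₗ π) := by
  rw [diag_succ_comp' _ hπ, ← conv_opConv_left_comm, antipode_opConv_algHom_comp hS _ hπ,
    conv_convUnit]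
  exact fun u v => commute_snocOne_lastHom q (diag k H q (π u)) (antipode k (π v))

/-- Through `corotate` the adjoined `ℓP` becomes `ℓ(S uᵖ)`, which strips the last slot from the
right action by `uᵖ`. The last slot of the outer `DP` is then the adjoined one. -/
theorem colCyc_coactLast (hS : ∀ x : H, antipode k (antipode k x) = x) (p q : ℕ) (f : GS k H p q) :
    colCyc (diag k H (q + 1)) (coactLast (prod k H p) f) =
      coactLast (prod k H p) (colCyc (diag k H q) f) := by
  rcases p with _ | m
  · rw [colCyc_zero, colCyc_zero]
  rw [colCyc_succ, coactLast, conv_prod_comp_corotate hS, opConv_assoc,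
    lastHom_antipode_opConv_diag hS q (isCoalgMap_lastFactor m), coactLast, colCyc_succ, comp_opConv,
    opConv_conv_eq, ← diag_succ_comp' _ (isCoalgMap_prod _), comp_opConv]
  · rfl
  · exact fun u v => commute_snocOne_lastHom q _ (prod k H (m + 1) v)

theorem cmRotate_comp_opConv_diag (m : ℕ) {A : Type*} [AddCommGroup A] [Module k A] [Coalgebra k A]
    (f : A →ₗ[k] T k H (m + 1)) {π : A →ₗ[k] H} (hπ : IsCoalgMap π) :
    cmRotate k H m ∘ₗ (f ⧇ ((diag k H (m + 1)).toLinearMap ∘ₗ π)) =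
      ((diag k H (m + 1)).toLinearMap ∘ₗ (antipode k ∘ₗ π)) ⧆ ((cmRotate k H m ∘ₗ f) ⧇
        ((snocOne k H m).toLinearMap ∘ₗ ((diag k H m).toLinearMap ∘ₗ π))) := by
  rw [diag_succ_comp _ hπ, ← opConv_eq_conv_of_commute, ← opConv_assoc,
    cmRotate_comp_opConv_firstHom, cmRotate_comp_opConv_consOne]
  exact fun u v => (commute_firstHom_consOne m (π v) (diag k H m (π u))).symm

theorem cmRotate_comp_diag_opConv (m : ℕ) {A : Type*} [AddCommGroup A] [Module k A] [Coalgebra k A]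
    (π : A →ₗ[k] H) (f : A →ₗ[k] T k H (m + 1)) :
    cmRotate k H m ∘ₗ (((diag k H (m + 1)).toLinearMap ∘ₗ π) ⧇ f) =
      (cmRotate k H m ∘ₗ f) ⧆ ((lastHom k H m).toLinearMap ∘ₗ (antipode k ∘ₗ π)) := by
  ext u
  simp [conv_apply (ℛ k u), opConv_apply (ℛ k u), cmRotate_diag_mul]

theorem conv_prod_antipode_lastFactor {B : Type*} [Ring B] [Algebra k B] (D : H →ₐ[k] B) (m : ℕ) :
    (D.toLinearMap ∘ₗ prod k H (m + 1)) ⧆ (D.toLinearMap ∘ₗ (antipode k ∘ₗ lastFactor k H m)) =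
      (D.toLinearMap ∘ₗ prod k H m) ∘ₗ counitAt k H m m := by
  rw [prod_succ', comp_conv, conv_assoc, algHom_conv_antipode_comp D (isCoalgMap_lastFactor m),
    conv_convUnit]
  rfl

/-- Both composites reduce to `R ∘ f ∘ R'` with `D(u¹ ⋯ uᵐ)` on the left and the diagonal of `uᵐ⁺¹`
on all slots but the last on the right. -/
theorem colCyc_rowCyc (hS : ∀ x : H, antipode k (antipode k x) = x) (p q : ℕ) (f : GS k H p q) :
    colCyc (diag k H q) (rowCyc (prod k H p) f) = rowCyc (prod k H p) (colCyc (diag k H q) f) := by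
  rcases p with _ | m
  · rw [colCyc_zero, colCyc_zero]
  rcases q with _ | n
  · rfl
  have hl : ((lastHom k H n).toLinearMap ∘ₗ (antipode k ∘ₗ prod k H (m + 1))) ⧆
      ((lastHom k H n).toLinearMap ∘ₗ prod k H (m + 1)) = convUnit k _ _ := by
    rw [← LinearMap.comp_assoc, ← (isCoalgMap_prod _).conv_comp, antipode_conv_algHom,
      (isCoalgMap_prod _).convUnit_comp]
  -- `R` turns the outer `DP` into `ℓSP`, cancelling `ℓP`, and brings the first slot of the
  -- right-hand diagonal to the front, where it removes `uᵐ⁺¹` from `DP`.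
  have h1 : rowCyc (prod k H (m + 1)) (colCyc (diag k H (n + 1)) f) =
      (((diag k H (n + 1)).toLinearMap ∘ₗ prod k H m) ∘ₗ counitAt k H m m) ⧆
        ((cmRotate k H n ∘ₗ f ∘ₗ corotate k H m) ⧇
          ((snocOne k H n).toLinearMap ∘ₗ ((diag k H n).toLinearMap ∘ₗ lastFactor k H m))) := by
    rw [rowCyc_succ, colCyc_succ, cmRotate_comp_diag_opConv, conv_assoc (cmRotate k H n ∘ₗ _), hl,
      conv_convUnit, cmRotate_comp_opConv_diag _ _ (isCoalgMap_lastFactor m), ← conv_assoc,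
      conv_prod_antipode_lastFactor]
  -- Under `corotate` the first factor of `DP` becomes `DSP`, the other factors become `u¹, …, uᵐ`,
  -- and `ℓP` becomes `ℓ(S uᵐ⁺¹)`.
  have h2 : rowCyc (prod k H (m + 1)) f ∘ₗ corotate k H m =
      ((diag k H (n + 1)).toLinearMap ∘ₗ (antipode k ∘ₗ prod k H (m + 1))) ⧇
        ((((diag k H (n + 1)).toLinearMap ∘ₗ prod k H m) ∘ₗ counitAt k H m m) ⧆
          ((cmRotate k H n ∘ₗ f ∘ₗ corotate k H m) ⧇
            ((lastHom k H n).toLinearMap ∘ₗ (antipode k ∘ₗ lastFactor k H m)))) := by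
    rw [rowCyc_succ, algHom_prod_succ, conv_assoc, conv_firstFactor_comp_corotate,
      conv_counitAt_comp_corotate, conv_prod_comp_corotate hS, LinearMap.comp_assoc _ f]
  rw [h1, colCyc_succ, h2, opConv_assoc, ← opConv_assoc, algHom_opConv_antipode_comp hS _
    (isCoalgMap_prod _), convUnit_opConv,
    ← Cocommute.conv_opConv_assoc (cocommute_comp_counitAt_lastFactor m _ _), opConv_assoc,
    lastHom_antipode_opConv_diag hS n (isCoalgMap_lastFactor m)]

theorem colCyc_iterate_rowCyc_iterate (hS : ∀ x : H, antipode k (antipode k x) = x) (p q : ℕ)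
    (f : GS k H p q) :
    (colCyc (diag k H q))^[p + 1] ((rowCyc (prod k H p))^[q + 1] f) = f := by
  have hP := isCoalgMap_prod (k := k) (H := H) p
  rw [colCyc_iterate_succ _ hS, rowCyc_iterate_succ hS hP, conv_assoc,
    ← conv_assoc _ _ (_ ⧆ _), diag_antipode_conv _ hP, convUnit_conv, conv_assoc,
    diag_conv_antipode _ hP, conv_convUnit, opConv_assoc, opConv_assoc, diag_antipode_opConv hS _ hP,
    opConv_convUnit, ← opConv_assoc, diag_opConv_antipode hS _ hP, convUnit_opConv]

end Mixed
end
end GerstenhaberSchack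

open scoped TensorProduct
namespace GerstenhaberSchack
noncomputable section
open TensorProduct Coalgebra HopfAlgebra
universe u v
variable {k : Type u} [Field k] {H : Type v} [Ring H] [HopfAlgebra k H]

/-! ### The cylindrical structure -/

section Cylindrical

/-- The cylindrical identity gives a left inverse to a power of the row operator. -/
theorem rowCyc_injective (hS : ∀ x : H, antipode k (antipode k x) = x) (p q : ℕ) {f g : GS k H p q}
    (h : rowCyc (prod k H p) f = rowCyc (prod k H p) g) : f = g := by
  rw [← colCyc_iterate_rowCyc_iterate hS p q f, ← colCyc_iterate_rowCyc_iterate hS p q g,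
    Function.iterate_succ_apply _ q f, Function.iterate_succ_apply _ q g, h]

/-- The last vertical coface is `τ_alg δ₀`, so its case follows from the first coface and the
commutation of the two cyclic operators. -/
theorem colCoface_rowCyc (hS : ∀ x : H, antipode k (antipode k x) = x) {p i : ℕ} (q : ℕ)
    (hi : i ≤ p + 1) (f : GS k H p q) :
    colCoface (diag k H q) i (rowCyc (prod k H p) f) =
      rowCyc (prod k H (p + 1)) (colCoface (diag k H q) i f) := by
  rcases i with _ | i
  · rw [colCoface_zero, colCoface_zero, actFirst_rowCyc]
  rcases (Nat.lt_succ_iff.mp hi).eq_or_lt with rfl | hi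
  · rw [colCoface_last, colCoface_last, ← colCyc_actFirst _ hS, actFirst_rowCyc, colCyc_rowCyc hS,
      colCyc_actFirst _ hS]
  · rw [colCoface_inner _ hi, colCoface_inner _ hi,
      rowCyc_comp (isCoalgMap_mulAt p i hi) (prod_comp_mulAt p i hi)]

theorem colCoface_coactLast (hS : ∀ x : H, antipode k (antipode k x) = x) {p i : ℕ} (q : ℕ)
    (hi : i ≤ p + 1) (f : GS k H p q) :
    colCoface (diag k H (q + 1)) i (coactLast (prod k H p) f) =
      coactLast (prod k H (p + 1)) (colCoface (diag k H q) i f) := by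
  rcases i with _ | i
  · rw [colCoface_zero, colCoface_zero, actFirst_coactLast]
  rcases (Nat.lt_succ_iff.mp hi).eq_or_lt with rfl | hi
  · rw [colCoface_last, colCoface_last, ← colCyc_actFirst _ hS, actFirst_coactLast,
      colCyc_coactLast hS, colCyc_actFirst _ hS]
  · rw [colCoface_inner _ hi, colCoface_inner _ hi, ← rowCoface_last, ← rowCoface_last,
      rowCoface_comp (isCoalgMap_mulAt p i hi) (prod_comp_mulAt p i hi)]

/-- For the first horizontal coface, `τ_coalg` is applied to both sides: it converts `δ₀` into the
last coface, already settled, and is injective. -/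
theorem colCoface_rowCoface (hS : ∀ x : H, antipode k (antipode k x) = x) {p q i j : ℕ}
    (hi : i ≤ p + 1) (hj : j ≤ q + 1) (f : GS k H p q) :
    colCoface (diag k H (q + 1)) i (rowCoface (prod k H p) j f) =
      rowCoface (prod k H (p + 1)) j (colCoface (diag k H q) i f) := by
  rcases j with _ | j
  · apply rowCyc_injective hS
    rw [rowCoface_zero, rowCoface_zero, ← colCoface_rowCyc hS _ hi,
      rowCyc_coactFirst (isCoalgMap_prod _), rowCyc_coactFirst (isCoalgMap_prod _),
      colCoface_coactLast hS _ hi]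
  rcases (Nat.lt_succ_iff.mp hj).eq_or_lt with rfl | hj
  · rw [rowCoface_last, rowCoface_last, colCoface_coactLast hS _ hi]
  · rw [rowCoface_inner _ hj, rowCoface_inner _ hj, ← toLinearMap_comulAtHom _ _ hj,
      colCoface_comp _ (comulAtHom_comp_diag q j hj)]

theorem colCyc_rowCoface (hS : ∀ x : H, antipode k (antipode k x) = x) {q j : ℕ} (p : ℕ)
    (hj : j ≤ q + 1) (f : GS k H p q) :
    colCyc (diag k H (q + 1)) (rowCoface (prod k H p) j f) =
      rowCoface (prod k H p) j (colCyc (diag k H q) f) := by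
  rcases j with _ | j
  · apply rowCyc_injective hS
    rw [rowCoface_zero, rowCoface_zero, ← colCyc_rowCyc hS,
      rowCyc_coactFirst (isCoalgMap_prod _), rowCyc_coactFirst (isCoalgMap_prod _),
      colCyc_coactLast hS]
  rcases (Nat.lt_succ_iff.mp hj).eq_or_lt with rfl | hj
  · rw [rowCoface_last, rowCoface_last, colCyc_coactLast hS]
  · rw [rowCoface_inner _ hj, rowCoface_inner _ hj, ← toLinearMap_comulAtHom _ _ hj,
      colCyc_comp _ (comulAtHom_comp_diag q j hj)]

theorem isCylindrical_gs (hS : ∀ x : H, antipode k (antipode k x) = x) :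
    Cocyclic.IsCylindrical (k := k) (GS k H) (cofaceV k H) (codegV k H) (tauAlg k H)
      (cofaceH k H) (codegH k H) (tauCoalg k H) where
  column := isParaCocyclic_column hS
  row := isParaCocyclic_row hS
  δv_δh p q i j hi hj := LinearMap.ext fun f => by
    simp only [LinearMap.comp_apply, cofaceV_apply, cofaceH_apply]
    exact colCoface_rowCoface hS hi hj f
  δv_σh p q i j _ hj := LinearMap.ext fun f => by
    simp only [LinearMap.comp_apply, cofaceV_apply, codegH_apply]
    rw [← toLinearMap_counitAtHom _ _ hj, colCoface_comp _ (counitAtHom_comp_diag q j hj)]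
  δv_τh p q i hi := LinearMap.ext fun f => by
    simp only [LinearMap.comp_apply, cofaceV_apply, tauCoalg_apply]
    exact colCoface_rowCyc hS q hi f
  σv_δh p q i j hi _ := LinearMap.ext fun f => by
    simp only [LinearMap.comp_apply, codegV_apply, cofaceH_apply]
    rw [rowCoface_comp (isCoalgMap_oneAt p i hi) (prod_comp_oneAt p i hi)]
  σv_σh p q i j _ _ := rfl
  σv_τh p q i hi := LinearMap.ext fun f => by
    simp only [LinearMap.comp_apply, codegV_apply, tauCoalg_apply]
    rw [rowCyc_comp (isCoalgMap_oneAt p i hi) (prod_comp_oneAt p i hi)]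
  τv_δh p q j hj := LinearMap.ext fun f => by
    simp only [LinearMap.comp_apply, tauAlg_apply hS, cofaceH_apply]
    exact colCyc_rowCoface hS p hj f
  τv_σh p q j hj := LinearMap.ext fun f => by
    simp only [LinearMap.comp_apply, tauAlg_apply hS, codegH_apply]
    rw [← toLinearMap_counitAtHom _ _ hj, colCyc_comp _ (counitAtHom_comp_diag q j hj)]
  τv_τh p q := LinearMap.ext fun f => by
    simp only [LinearMap.comp_apply, tauAlg_apply hS, tauCoalg_apply]
    exact colCyc_rowCyc hS p q f
  cylindrical p q := LinearMap.ext fun f => by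
    rw [LinearMap.comp_apply, tauAlg_pow_apply hS, tauCoalg_pow_apply]
    exact colCyc_iterate_rowCyc_iterate hS p q f

end Cylindrical
end
end GerstenhaberSchack

theorem theorem3p3 (k : Type*) [Field k] (H : Type*) [Ring H] [HopfAlgebra k H]
    (hS : ∀ x : H, HopfAlgebra.antipode k (HopfAlgebra.antipode k x) = x) :
    Cocyclic.IsCylindrical (k := k) (GerstenhaberSchack.GS k H)
      (GerstenhaberSchack.cofaceV k H) (GerstenhaberSchack.codegV k H)
      (GerstenhaberSchack.tauAlg k H)
      (GerstenhaberSchack.cofaceH k H) (GerstenhaberSchack.codegH k H)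
      (GerstenhaberSchack.tauCoalg k H) ∧
    (∀ n : ℕ, GerstenhaberSchack.tauDiag k H n =
      GerstenhaberSchack.tauCoalg k H n n ∘ₗ GerstenhaberSchack.tauAlg k H n n) ∧
    Cocyclic.IsCocyclic (k := k) (GerstenhaberSchack.Diag k H)
      (GerstenhaberSchack.cofaceDiag k H) (GerstenhaberSchack.codegDiag k H)
      (GerstenhaberSchack.tauDiag k H) ∧
    Cocyclic.IsMixedComplex (GerstenhaberSchack.dDiag k H) (GerstenhaberSchack.BDiag k H) ∧
    Cocyclic.cyclicD (GerstenhaberSchack.dDiag k H) (GerstenhaberSchack.BDiag k H) ∘ₗ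
      Cocyclic.cyclicD (GerstenhaberSchack.dDiag k H) (GerstenhaberSchack.BDiag k H) = 0 ∧
    (∀ n : ℤ,
      Cocyclic.cyclicCoboundaries (GerstenhaberSchack.dDiag k H) (GerstenhaberSchack.BDiag k H) n ≤
      Cocyclic.cyclicCocycles (GerstenhaberSchack.dDiag k H) (GerstenhaberSchack.BDiag k H) n) := by
  have hcyl := GerstenhaberSchack.isCylindrical_gs hS
  have hcoc : Cocyclic.IsCocyclic (k := k) (GerstenhaberSchack.Diag k H)
      (GerstenhaberSchack.cofaceDiag k H) (GerstenhaberSchack.codegDiag k H)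
      (GerstenhaberSchack.tauDiag k H) := hcyl.diagonal
  have hmix : Cocyclic.IsMixedComplex (GerstenhaberSchack.dDiag k H)
      (GerstenhaberSchack.BDiag k H) := hcoc.isMixedComplex
  exact ⟨hcyl, fun n => hcyl.τv_τh n n, hcoc, hmix, hmix.cyclicD_comp_cyclicD,
    hmix.cyclicCoboundaries_le⟩
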